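/- Let $\alpha_1,\dots,\alpha_6$ be Leslie coefficients satisfying $\gamma_1=\alpha_3-\alpha_2>0$, Parodi's relation $\alpha_2+\alpha_3=\alpha_6-\alpha_5=:\gamma_2$, and $$\alpha_4>0,\quad 2\alpha_1+3\alpha_4+2\alpha_5+2\alpha_6>0,\quad 2\alpha_4+\alpha_5+\alpha_6>0,\quad 4\gamma_1(2\alpha_4+\alpha_5+\alpha_6)>(\alpha_2+\alpha_3+\gamma_2)^2,$$ and let $g(\theta)=\alpha_1\sin^2\theta\cos^2\theta+\frac{\alpha_5-\alpha_2}{2}\sin^2\theta+\frac{\alpha_3+\alpha_6}{2}\cos^2\theta+\frac{\alpha_4}{2}$. For $T>0$ and $\theta:\mathbb R\times[0,T]\to\mathbb R$ Hölder continuous with exponent $1/2$, let $\Gamma(x,t;\xi,\tau)$, $0\le\tau<t\le T$, be the fundamental solution of $\mathcal L=\partial_t-g(\theta(x,t))\partial_{xx}+\gamma_1$ given by the parametrix method: with $$H^{\xi,\tau}(z,s)=\frac{1}{\sqrt{4\pi g(\theta(\xi,\tau))s}}\,e^{-z^2/(4g(\theta(\xi,\tau))s)},\qquad K(x,t;\xi,\tau)=-\mathcal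 L_{(x,t)}\big[H^{\xi,\tau}(x-\xi,t-\tau)\big],$$ $$\Gamma(x,t;\xi,\tau)=H^{\xi,\tau}(x-\xi,t-\tau)+\int_\tau^t\!\int_{\mathbb R}H^{y,s}(x-y,t-s)\,\Phi(y,s;\xi,\tau)\,dy\,ds,$$ where $\Phi=\sum_{m\ge1}K_m$, $K_1=K$ and $K_{m+1}(x,t;\xi,\tau)=\int_\tau^t\int_{\mathbb R}K(x,t;y,s)K_m(y,s;\xi,\tau)\,dy\,ds$. For a function $F$ on $\Omega_T=\mathbb R\times(0,T]$ put $$M_{F,x}(x,t)=\int_0^t\int_{\mathbb R}\Gamma_x(x,t;\xi,\tau)F(\xi,\tau)\,d\xi\,d\tau .$$ For $\alpha\in(0,1/4)$ and $\lambda>0$ let $\|S\|_{N_T}$ be the maximum of $\|e^{-\lambda t}S\|_{L^\infty(\mathbb R\times[0,T])}$, $\|e^{-\lambda t}S\|_{L^2(\mathbb R\times[0,T])}$ and $$\|S\|_{C^\alpha_*}=\sup\ e^{-\lambda t}\,\frac{|S(x+h_1,t+h_2)-S(x,t)|}{\|(h_1,h_2)\|^{\alpha}},$$ the supremum being over $x,h_1\in\mathbb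 R$, $t\in[0,T]$ and $h_2\le 0$ with $t+h_2\in[0,T]$ and $(h_1,h_2)\ne(0,0)$; thus the weight is taken at the later of the two times. Let $T>1$, $\alpha\in(0,1/4)$, $L\ge0$ and $\kappa\ge0$. There is $\lambda_0>0$, depending only on these numbers and on the Leslie coefficients, such that the following holds for every $\lambda\ge\lambda_0$. Let $\theta$ be Hölder continuous on $\mathbb R\times[0,T]$ with exponent $1/2$ and constant $L$, let $C_0\ge0$, and let $G\in L^\infty(\Omega_T)$ and $f\in L^\infty((0,T),L^2(\mathbb R))$ satisfy $$\|G\|_{L^\infty(\Omega_T)}\le C_0,\qquad \|f\|_{L^\infty((0,T),L^2(\mathbb R))}\le C_0,\qquad \|G_x\|_{L^\infty((0,T),L^1(\mathbb R))}\le\kappa\,C_0 .$$ Then the integrals defining $M_{G,x}$ and $M_{f,x}$ converge absolutely at every point of $\mathbb R\times[0,T]$, and $$\max\{\|M_{G,x}\|_{N_T},\ \|M_{f,x}\|_{N_T}\}\le\max\{C_0,C_0^2\}\,T^2 .$$ -/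

import Mathlib

open MeasureTheory Set

noncomputable section

/-- Leslie coefficients of the liquid crystal, with the relations that are always assumed:
`γ₁ = a3 - a2`, `γ₂ = a6 - a5`, Parodi's relation and the empirical inequalities. -/
structure LeslieCoeffs where
  a1 : ℝ
  a2 : ℝ
  a3 : ℝ
  a4 : ℝ
  a5 : ℝ
  a6 : ℝ
  parodi : a2 + a3 = a6 - a5
  pos_four : 0 < a4
  pos_sum : 0 < 2 * a1 + 3 * a4 + 2 * a5 + 2 * a6
  pos_damping : 0 < a3 - a2
  pos_shear : 0 < 2 * a4 + a5 + a6
  discr : (a2 + a3 + (a6 - a5)) ^ 2 < 4 * (a3 - a2) * (2 * a4 + a5 + a6)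

namespace LeslieCoeffs

/-- The damping constant `γ₁`. -/
def gamma1 (P : LeslieCoeffs) : ℝ := P.a3 - P.a2

/-- The diffusion coefficient `g(θ)`. -/
def g (P : LeslieCoeffs) (th : ℝ) : ℝ :=
  P.a1 * Real.sin th ^ 2 * Real.cos th ^ 2 + (P.a5 - P.a2) / 2 * Real.sin th ^ 2
    + (P.a3 + P.a6) / 2 * Real.cos th ^ 2 + P.a4 / 2

end LeslieCoeffs

/-- The kernel of `∂ₜ - a ∂ₓₓ` with constant `a > 0`, at displacement `z` and time lag `s > 0`. -/
def heatKernel (a z s : ℝ) : ℝ :=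
  1 / Real.sqrt (4 * Real.pi * a * s) * Real.exp (-z ^ 2 / (4 * a * s))

/-- The parametrix `H^{ξ,τ}(x-ξ, t-τ)`: the heat kernel with the coefficient frozen at `(ξ,τ)`. -/
def frozenKernel (P : LeslieCoeffs) (th : ℝ → ℝ → ℝ) (x t ξ τ : ℝ) : ℝ :=
  heatKernel (P.g (th ξ τ)) (x - ξ) (t - τ)

/-- `-𝓛` applied in `(x,t)` to the parametrix, where `𝓛 = ∂ₜ - g(θ(x,t)) ∂ₓₓ + γ₁`. As the
parametrix solves `∂ₜ H = g(θ(ξ,τ)) ∂ₓₓ H` for `t > τ`, this is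
`(g(θ(x,t)) - g(θ(ξ,τ))) ∂ₓₓ H - γ₁ H`. -/
def parametrixError (P : LeslieCoeffs) (th : ℝ → ℝ → ℝ) (x t ξ τ : ℝ) : ℝ :=
  (P.g (th x t) - P.g (th ξ τ)) * iteratedDeriv 2 (fun x' => frozenKernel P th x' t ξ τ) x
    - P.gamma1 * frozenKernel P th x t ξ τ

/-- The iterates of the kernel `parametrixError` under space-time composition. -/
def iteratedError (P : LeslieCoeffs) (th : ℝ → ℝ → ℝ) : ℕ → ℝ → ℝ → ℝ → ℝ → ℝ
  | 0 => parametrixError P th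
  | m + 1 => fun x t ξ τ =>
      ∫ s in τ..t, ∫ y : ℝ, parametrixError P th x t y s * iteratedError P th m y s ξ τ

/-- The density `Φ` of the parametrix method: the solution, as a Neumann series, of the Volterra
equation `Φ = K + ∫∫ K Φ` with `K = parametrixError`, which expresses `𝓛 Γ = 0`. -/
def levyDensity (P : LeslieCoeffs) (th : ℝ → ℝ → ℝ) (x t ξ τ : ℝ) : ℝ :=
  ∑' m : ℕ, iteratedError P th m x t ξ τ

/-- The fundamental solution `Γ(x,t;ξ,τ)` of `𝓛 = ∂ₜ - g(θ) ∂ₓₓ + γ₁`, for `t > τ`. -/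
def fundSol (P : LeslieCoeffs) (th : ℝ → ℝ → ℝ) (x t ξ τ : ℝ) : ℝ :=
  frozenKernel P th x t ξ τ
    + ∫ s in τ..t, ∫ y : ℝ, frozenKernel P th x t y s * levyDensity P th y s ξ τ

/-- The derivative `Γₓ(x,t;ξ,τ)`. -/
def fundSolX (P : LeslieCoeffs) (th : ℝ → ℝ → ℝ) (x t ξ τ : ℝ) : ℝ :=
  deriv (fun x' => fundSol P th x' t ξ τ) x

/-- `M_{F,x}(x,t) = ∫₀ᵗ ∫ Γₓ(x,t;ξ,τ) F(ξ,τ) dξ dτ`. -/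
def duhamelX (P : LeslieCoeffs) (th F : ℝ → ℝ → ℝ) (x t : ℝ) : ℝ :=
  ∫ τ in (0 : ℝ)..t, ∫ ξ : ℝ, fundSolX P th x t ξ τ * F ξ τ

/-- Lebesgue measure on the strip `ℝ × [0,T]` (first coordinate space, second time). -/
def stripMeasure (T : ℝ) : Measure (ℝ × ℝ) :=
  (volume : Measure (ℝ × ℝ)).restrict (univ ×ˢ Icc 0 T)

/-- `‖S‖_{L^p_*} = ‖e^{-λt} S‖_{L^p(ℝ × [0,T])}`. -/
def weightedLpNorm (p : ENNReal) (lam T : ℝ) (S : ℝ → ℝ → ℝ) : ENNReal :=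
  eLpNorm (fun q : ℝ × ℝ => Real.exp (-lam * q.2) * S q.1 q.2) p (stripMeasure T)

/-- The weighted Hölder seminorm of `C^α_*`: the supremum of
`e^{-λt} |S(x+h₁,t+h₂) - S(x,t)| / ‖(h₁,h₂)‖^α` over pairs of distinct points of the strip, the
weight being taken at the later of the two times, that is, `h₂ ≤ 0`. -/
def weightedHolderNorm (α lam T : ℝ) (S : ℝ → ℝ → ℝ) : ENNReal :=
  ⨆ (x : ℝ) (t : ℝ) (h₁ : ℝ) (h₂ : ℝ)
    (_ : t ∈ Icc 0 T ∧ t + h₂ ∈ Icc 0 T ∧ h₂ ≤ 0 ∧ (h₁ ≠ 0 ∨ h₂ ≠ 0)),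
    ENNReal.ofReal (Real.exp (-lam * t) * |S (x + h₁) (t + h₂) - S x t|
      / Real.sqrt (h₁ ^ 2 + h₂ ^ 2) ^ α)

/-- The norm of `N_T = C^α_* ∩ L²_* ∩ L^∞_*`, with value `∞` off that space. -/
def normNT (α lam T : ℝ) (S : ℝ → ℝ → ℝ) : ENNReal :=
  max (weightedLpNorm ⊤ lam T S) (max (weightedLpNorm 2 lam T S) (weightedHolderNorm α lam T S))

/-- `‖∂ₓ G‖_{L^∞((0,T), L¹(ℝ))} ≤ D`: for almost every time `τ`, the function `G(·,τ)` is (almost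
everywhere equal to) an absolutely continuous function with an integrable derivative `q`, of
`L¹` norm at most `D`. -/
def SpaceDerivL1Bound (T D : ℝ) (G : ℝ → ℝ → ℝ) : Prop :=
  ∀ᵐ τ ∂(volume.restrict (Ioo 0 T)), ∃ (q : ℝ → ℝ) (b : ℝ),
    Integrable q ∧ (∫ z, |q z|) ≤ D ∧ ∀ᵐ ξ : ℝ, G ξ τ = b + ∫ z in Iic ξ, q z

end

/-! Everything is measured against one Gaussian. Let `M` bound the diffusion coefficient `a = g(θ)`
and let σ be the time lag. The space derivatives of order j ≤ 4 of the parametrix are at most C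
σ^(-j/2) times the heat kernel of constant diffusion `64 * M`. Since this majorant has the same
constant everywhere, it reproduces itself exactly under space-time composition
(`lintegral_hk_comp`), and estimating a composition reduces to convolving weights in σ. Hölder
continuity of order 1/2 improves the singularity of the parametrix error from σ^(-1) to σ^(-3/4)
(`exists_ek_bound`). In a scale of weights σ^(-3/4) e^((1+ν)σ) with ν large, composition with the
error halves constants, so the Neumann series is geometric (`exists_iterK_bound`), and Γₓ is at most
C σ^(-1/2) times the majorant on bounded time ranges (`exists_solX_bound`).

Size and Hölder continuity. Bounded and square integrable sources both belong to the class
`IsSource`: their Gaussian averages at lag σ are at most B σ^(-1/4). The class is stable under F ↦ F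
+ ∫∫ Φ F (`exists_isSource_dens`), and by Fubini the Duhamel integral M_{F,x} is the potential of
this new density for the explicit kernel ∂ₓH. Direct estimates of that kernel bound M_{F,x} by C B
t^(1/4) and give Hölder continuity of order 1/4 in x and in t (`exists_duh_estimates`).

Square integrability. For f it is Cauchy-Schwarz against the majorant. For G, which need not decay,
it comes from the cancellation ∫ Γₓ(x,t;ξ,τ) dξ = 0, valid for almost every τ
(`ae_integral_solX_eq_zero`): G(ξ,τ) may be replaced by G(ξ,τ) - G(x,τ), whose Gaussian average has
L¹ norm in x of order √σ ‖Gₓ‖₁. This compensates σ^(-1/2), so M_{G,x} is integrable in x, and being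
bounded it is square integrable.

Cancellation. Formally ∫ Γ dξ = e^(-γ₁(t-τ)) does not depend on x. The integrated form proved here
is that the potential with source 1 after time τ₀ equals u(t) = (1 - e^(-γ₁(t-τ₀)))/γ₁
(`potential_eq_dampedTime`). No second derivative of a potential is taken. The potential is compared
at times t and t - δ, the earlier value being averaged against the Gaussian with the coefficient
frozen at (x,t). By a Taylor expansion in the variance and the Volterra equation, the discrete
equation u(t) - average = δ(1 - γ₁u(t)) holds up to o(δ), uniformly (`exists_one_step`). Averaging
does not increase a supremum, so N steps of size R/N accumulate an error tending to 0. The space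
derivative of the potential therefore vanishes, and differentiating in τ₀ gives the cancellation.

Weights. Since e^(-λt) t^β ≤ λ^(-β), a bound by a positive power of t becomes small for large λ. For
the C^α seminorm, α < 1/4 leaves the power t^(1/4-α), and for the L² norm ∫ e^(-2λt) dt supplies the
factor. All estimates are linear in C₀, and the norms obtained are at most C₀, hence at most max{C₀,
C₀²} T². -/

open scoped ENNReal NNReal Topology

/-! ### The heat kernel and its derivatives -/

/-- The centred Gaussian density of variance `2 v`; it vanishes for `v ≤ 0`. -/
noncomputable def gk (v z : ℝ) : ℝ := 1 / √(4 * Real.pi * v) * Real.exp (-z ^ 2 / (4 * v))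

/-- The derivative of order `j` in `z` of `gk v z`. -/
noncomputable def gkd : ℕ → ℝ → ℝ → ℝ
  | 0, v, z => gk v z
  | 1, v, z => -(z * gk v z) / (2 * v)
  | j + 2, v, z => -(z * gkd (j + 1) v z + (j + 1) * gkd j v z) / (2 * v)

lemma heatKernel_eq (a z s : ℝ) : heatKernel a z s = gk (a * s) z := by
  simp only [heatKernel, gk]
  ring_nf

lemma gk_nonneg (v z : ℝ) : 0 ≤ gk v z := by unfold gk; positivity

/-- The square root of a nonpositive number is 0, and so is the inverse of 0. Kernels therefore
vanish by themselves at nonpositive time lags, and integrals over τ < s < t can be written over the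
whole of space-time. -/
lemma gk_of_nonpos {v : ℝ} (hv : v ≤ 0) (z : ℝ) : gk v z = 0 := by
  have : 4 * Real.pi * v ≤ 0 := by have := Real.pi_pos; nlinarith
  simp [gk, Real.sqrt_eq_zero_of_nonpos this]

lemma gkd_of_nonpos {v : ℝ} (hv : v ≤ 0) (z : ℝ) (j : ℕ) : gkd j v z = 0 := by
  induction j using Nat.strong_induction_on with
  | _ j ih =>
    match j with
    | 0 => exact gk_of_nonpos hv z
    | 1 => simp [gkd, gk_of_nonpos hv z]
    | j + 2 => simp [gkd, ih (j + 1) (by omega), ih j (by omega)]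

lemma gk_eq_gaussianPDFReal {v : ℝ} (hv : 0 < v) (z : ℝ) :
    gk v z = ProbabilityTheory.gaussianPDFReal 0 (2 * v).toNNReal z := by
  rw [gk, ProbabilityTheory.gaussianPDFReal_def, Real.coe_toNNReal _ (by positivity)]
  simp only [one_div]
  ring_nf

lemma measurable_gk : Measurable fun p : ℝ × ℝ => gk p.1 p.2 := by
  unfold gk; fun_prop

lemma measurable_gkd (j : ℕ) : Measurable fun p : ℝ × ℝ => gkd j p.1 p.2 := by
  induction j using Nat.strong_induction_on with
  | _ j ih =>
    match j with
    | 0 => exact measurable_gk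
    | 1 =>
      have := measurable_gk
      simp only [gkd]
      fun_prop
    | j + 2 =>
      have h1 := ih (j + 1) (by omega)
      have h2 := ih j (by omega)
      simp only [gkd]
      fun_prop

@[fun_prop]
lemma measurable_gk_comp {α : Type*} [MeasurableSpace α] {f g : α → ℝ} (hf : Measurable f)
    (hg : Measurable g) : Measurable fun x => gk (f x) (g x) :=
  measurable_gk.comp (hf.prodMk hg)

@[fun_prop]
lemma measurable_gkd_comp {α : Type*} [MeasurableSpace α] {f g : α → ℝ} (hf : Measurable f)
    (hg : Measurable g) (j : ℕ) : Measurable fun x => gkd j (f x) (g x) :=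
  (measurable_gkd j).comp (hf.prodMk hg)

lemma lintegral_gk {v : ℝ} (hv : 0 < v) : ∫⁻ z, ENNReal.ofReal (gk v z) = 1 := by
  have h : (2 * v).toNNReal ≠ 0 := by
    have : (0 : ℝ) < 2 * v := by positivity
    simpa using hv
  simpa only [gk_eq_gaussianPDFReal hv] using
    ProbabilityTheory.lintegral_gaussianPDFReal_eq_one 0 h

lemma integral_gk {v : ℝ} (hv : 0 < v) : ∫ z, gk v z = 1 := by
  have h : (2 * v).toNNReal ≠ 0 := by simpa using hv
  simpa only [gk_eq_gaussianPDFReal hv] using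
    ProbabilityTheory.integral_gaussianPDFReal_eq_one 0 h

lemma integrable_gk (v : ℝ) : Integrable (gk v) := by
  rcases le_or_gt v 0 with hv | hv
  · have : gk v = fun _ => 0 := funext (gk_of_nonpos hv)
    simp [this]
  · have : gk v = ProbabilityTheory.gaussianPDFReal 0 (2 * v).toNNReal :=
      funext (gk_eq_gaussianPDFReal hv)
    rw [this]
    exact ProbabilityTheory.integrable_gaussianPDFReal _ _

/-- Completing the square in y. The second Gaussian on the right has total mass one in y, which
gives the semigroup property. -/
lemma gk_mul_gk {v w : ℝ} (hv : 0 < v) (hw : 0 < w) (x y : ℝ) :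
    gk v (x - y) * gk w y = gk (v + w) x * gk (v * w / (v + w)) (y - x * w / (v + w)) := by
  have hpi := Real.pi_pos
  have hvw : 0 < v + w := by positivity
  have e1 : √(4 * Real.pi * v) * √(4 * Real.pi * w)
      = √(4 * Real.pi * (v + w)) * √(4 * Real.pi * (v * w / (v + w))) := by
    rw [← Real.sqrt_mul (by positivity), ← Real.sqrt_mul (by positivity)]
    congr 1
    field_simp
  have e2 : -(x - y) ^ 2 / (4 * v) + -y ^ 2 / (4 * w)
      = -x ^ 2 / (4 * (v + w)) + -(y - x * w / (v + w)) ^ 2 / (4 * (v * w / (v + w))) := by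
    field_simp
    ring
  simp only [gk]
  rw [mul_mul_mul_comm, mul_mul_mul_comm (1 / √(4 * Real.pi * (v + w))), ← Real.exp_add,
    ← Real.exp_add, e2, div_mul_div_comm, div_mul_div_comm, e1]

/-- The semigroup property of the heat kernel. -/
lemma lintegral_gk_mul_gk {v w : ℝ} (hv : 0 < v) (hw : 0 < w) (x z : ℝ) :
    ∫⁻ y, ENNReal.ofReal (gk v (x - y)) * ENNReal.ofReal (gk w (y - z))
      = ENNReal.ofReal (gk (v + w) (x - z)) := by
  have h1 : ∀ y, ENNReal.ofReal (gk v (x - y)) * ENNReal.ofReal (gk w (y - z))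
      = ENNReal.ofReal (gk (v + w) (x - z)) *
        ENNReal.ofReal (gk (v * w / (v + w)) (y - (z + (x - z) * w / (v + w)))) := by
    intro y
    rw [← ENNReal.ofReal_mul (gk_nonneg _ _), ← ENNReal.ofReal_mul (gk_nonneg _ _)]
    have := gk_mul_gk hv hw (x - z) (y - z)
    rw [show x - z - (y - z) = x - y by ring] at this
    rw [this]
    ring_nf
  simp_rw [h1]
  rw [lintegral_const_mul _ (by fun_prop),
    lintegral_sub_right_eq_self (fun y => ENNReal.ofReal (gk (v * w / (v + w)) y)),
    lintegral_gk (by positivity), mul_one]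

lemma integral_gk_mul_gk {v w : ℝ} (hv : 0 < v) (hw : 0 < w) (x z : ℝ) :
    ∫ y, gk v (x - y) * gk w (y - z) = gk (v + w) (x - z) := by
  rw [integral_eq_lintegral_of_nonneg_ae
    (Filter.Eventually.of_forall fun y => mul_nonneg (gk_nonneg _ _) (gk_nonneg _ _))
    (by fun_prop)]
  simp_rw [ENNReal.ofReal_mul (gk_nonneg _ _)]
  rw [lintegral_gk_mul_gk hv hw, ENNReal.toReal_ofReal (gk_nonneg _ _)]

lemma lintegral_gk_sub {v : ℝ} (hv : 0 < v) (x : ℝ) :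
    ∫⁻ y, ENNReal.ofReal (gk v (x - y)) = 1 := by
  rw [lintegral_sub_left_eq_self (fun y => ENNReal.ofReal (gk v y)), lintegral_gk hv]

lemma lintegral_gk_sub' {v : ℝ} (hv : 0 < v) (x : ℝ) :
    ∫⁻ y, ENNReal.ofReal (gk v (y - x)) = 1 := by
  rw [lintegral_sub_right_eq_self (fun y => ENNReal.ofReal (gk v y)), lintegral_gk hv]

lemma gk_le_sup {v : ℝ} (hv : 0 < v) (z : ℝ) : gk v z ≤ 1 / √v := by
  have hpi := Real.pi_gt_three
  unfold gk
  have h1 : Real.exp (-z ^ 2 / (4 * v)) ≤ 1 := by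
    rw [Real.exp_le_one_iff, neg_div, neg_nonpos]; positivity
  have h2 : 1 / √(4 * Real.pi * v) ≤ 1 / √v := by
    apply one_div_le_one_div_of_le (by positivity)
    apply Real.sqrt_le_sqrt
    nlinarith
  calc _ ≤ 1 / √v * 1 := by gcongr
    _ = _ := mul_one _

lemma gk_le_of_le {u v w : ℝ} (hu : 0 < u) (huv : u ≤ v) (hvw : v ≤ w) (z : ℝ) :
    gk v z ≤ √(w / u) * gk w z := by
  have hpi := Real.pi_pos
  have hv : 0 < v := hu.trans_le huv
  have hw : 0 < w := hv.trans_le hvw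
  unfold gk
  rw [← mul_assoc]
  have h1 : 1 / √(4 * Real.pi * v) ≤ √(w / u) * (1 / √(4 * Real.pi * w)) := by
    rw [Real.sqrt_div hw.le, Real.sqrt_mul (by positivity), Real.sqrt_mul (by positivity) w]
    have hsu : 0 < √u := Real.sqrt_pos.2 hu
    have hsw : 0 < √w := Real.sqrt_pos.2 hw
    have hsv : √u ≤ √v := Real.sqrt_le_sqrt huv
    rw [show √w / √u * (1 / (√(4 * Real.pi) * √w)) = 1 / (√(4 * Real.pi) * √u) by field_simp]
    gcongr
  have h2 : Real.exp (-z ^ 2 / (4 * v)) ≤ Real.exp (-z ^ 2 / (4 * w)) := by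
    apply Real.exp_le_exp.2
    rw [neg_div, neg_div, neg_le_neg_iff]
    gcongr
  gcongr

lemma gk_le_two {v : ℝ} (hv : 0 < v) (z : ℝ) : gk v z ≤ 2 * gk (2 * v) z := by
  refine (gk_le_of_le hv le_rfl (by linarith : v ≤ 2 * v) z).trans ?_
  have : √(2 * v / v) ≤ 2 := by
    rw [mul_div_assoc, div_self hv.ne', mul_one]
    nlinarith [Real.sq_sqrt (show (0 : ℝ) ≤ 2 by norm_num), Real.sqrt_nonneg 2]
  exact mul_le_mul_of_nonneg_right this (gk_nonneg _ _)

lemma one_div_sqrt_le_two {v : ℝ} (hv : 0 < v) :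
    1 / √(4 * Real.pi * v) ≤ 2 * (1 / √(4 * Real.pi * (2 * v))) := by
  have hX : 0 < 4 * Real.pi * v := by have := Real.pi_pos; positivity
  rw [show 4 * Real.pi * (2 * v) = 2 * (4 * Real.pi * v) by ring]
  set X := 4 * Real.pi * v
  have h1 : √(2 * X) ≤ 2 * √X := by
    rw [Real.sqrt_le_left (by positivity), mul_pow, Real.sq_sqrt hX.le]
    linarith
  have h2 : 0 < √X := Real.sqrt_pos.2 hX
  have h3 : 0 < √(2 * X) := Real.sqrt_pos.2 (by positivity)
  rw [mul_one_div, div_le_div_iff₀ h2 h3]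
  linarith

/-- A shift of length at most `√v` is absorbed by doubling the variance. -/
lemma gk_shift_le {v : ℝ} (hv : 0 < v) {z w : ℝ} (h : (z - w) ^ 2 ≤ v) :
    gk v z ≤ 4 * gk (2 * v) w := by
  have hpi := Real.pi_pos
  unfold gk
  have h1 : Real.exp (-z ^ 2 / (4 * v)) ≤ 2 * Real.exp (-w ^ 2 / (4 * (2 * v))) := by
    -- Equivalent to w² ≤ 2v + 2z², which follows from w² ≤ 2(z - w)² + 2z².
    have h3 : -z ^ 2 / (4 * v) ≤ 1 / 4 + -w ^ 2 / (4 * (2 * v)) := by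
      rw [← sub_nonneg]
      have : 1 / 4 + -w ^ 2 / (4 * (2 * v)) - -z ^ 2 / (4 * v)
          = (2 * v - w ^ 2 + 2 * z ^ 2) / (8 * v) := by field_simp; ring
      rw [this]
      apply div_nonneg _ (by positivity)
      nlinarith [sq_nonneg (2 * z - w)]
    have h4 : Real.exp (1 / 4) ≤ 2 := by
      have := Real.exp_one_lt_d9
      have h5 : Real.exp (1 / 4) ^ 4 = Real.exp 1 := by rw [← Real.exp_nat_mul]; norm_num
      by_contra hcon
      push Not at hcon
      have : (2 : ℝ) ^ 4 < Real.exp (1 / 4) ^ 4 := by gcongr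
      linarith
    calc _ ≤ Real.exp (1 / 4 + -w ^ 2 / (4 * (2 * v))) := Real.exp_le_exp.2 h3
      _ = Real.exp (1 / 4) * Real.exp (-w ^ 2 / (4 * (2 * v))) := Real.exp_add _ _
      _ ≤ _ := by gcongr
  have h2 := one_div_sqrt_le_two hv
  calc _ ≤ 2 * (1 / √(4 * Real.pi * (2 * v))) * (2 * Real.exp (-w ^ 2 / (4 * (2 * v)))) := by
        gcongr
    _ = _ := by ring

/-- Half of the Gaussian exponent absorbs the factor |z|/√v; the other half is the Gaussian of
doubled variance. Every polynomial factor is traded for a power of the variance in this way. -/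
lemma abs_mul_gk_le {v : ℝ} (hv : 0 < v) (z : ℝ) : |z| * gk v z ≤ 4 * √v * gk (2 * v) z := by
  have hpi := Real.pi_pos
  unfold gk
  have hs : 0 < √v := Real.sqrt_pos.2 hv
  set y := |z| / √v with hy
  have hz : |z| = y * √v := by rw [hy]; field_simp
  have hy0 : 0 ≤ y := by positivity
  have hz2 : z ^ 2 = y ^ 2 * v := by
    rw [← sq_abs, hz, mul_pow, Real.sq_sqrt hv.le]
  have e1 : -z ^ 2 / (4 * v) = -y ^ 2 / 8 + -z ^ 2 / (4 * (2 * v)) := by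
    rw [hz2]; field_simp; ring
  have h1 : y * Real.exp (-y ^ 2 / 8) ≤ 2 := by
    have := Real.add_one_le_exp (y ^ 2 / 8)
    rw [neg_div, Real.exp_neg, ← div_eq_mul_inv, div_le_iff₀ (Real.exp_pos _)]
    nlinarith [sq_nonneg (y - 2)]
  have h2 := one_div_sqrt_le_two hv
  rw [e1, Real.exp_add, hz]
  calc y * √v * (1 / √(4 * Real.pi * v) *
        (Real.exp (-y ^ 2 / 8) * Real.exp (-z ^ 2 / (4 * (2 * v)))))
      = (y * Real.exp (-y ^ 2 / 8)) * (1 / √(4 * Real.pi * v)) *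
        (√v * Real.exp (-z ^ 2 / (4 * (2 * v)))) := by ring
    _ ≤ 2 * (2 * (1 / √(4 * Real.pi * (2 * v)))) *
        (√v * Real.exp (-z ^ 2 / (4 * (2 * v)))) := by gcongr
    _ = _ := by ring

/-- Interpolates between `gk_le_two` and `abs_mul_gk_le` by w ≤ 1 + w² with w² = |z|/√v. This is how
the Hölder modulus √|x - ξ| of the coefficient becomes a quarter power of the time lag. -/
lemma sqrt_abs_mul_gk_le {v : ℝ} (hv : 0 < v) (z : ℝ) :
    √|z| * gk v z ≤ 6 * √√v * gk (2 * v) z := by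
  have hs : 0 < √v := Real.sqrt_pos.2 hv
  have hss : 0 < √√v := Real.sqrt_pos.2 hs
  have e : √√v ^ 2 = √v := Real.sq_sqrt hs.le
  have h1 : √|z| ≤ √√v * (1 + |z| / √v) := by
    have h2 : √|z| ^ 2 = |z| := Real.sq_sqrt (abs_nonneg z)
    have h3 : |z| / √v = (√|z| / √√v) ^ 2 := by rw [div_pow, e, h2]
    set w := √|z| / √√v with hw
    have h4 : √|z| = √√v * w := by rw [hw]; field_simp
    rw [h3, h4]
    gcongr
    nlinarith [sq_nonneg (w - 1)]
  have h5 := abs_mul_gk_le hv z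
  have h6 := gk_le_two hv z
  calc √|z| * gk v z ≤ √√v * (1 + |z| / √v) * gk v z := by
        gcongr; exact gk_nonneg _ _
    _ = √√v * (gk v z + (|z| * gk v z) / √v) := by field_simp
    _ ≤ √√v * (2 * gk (2 * v) z + (4 * √v * gk (2 * v) z) / √v) := by gcongr
    _ = _ := by field_simp; ring

lemma hasDerivAt_gk_right (v z : ℝ) : HasDerivAt (gk v) (gkd 1 v z) z := by
  rcases le_or_gt v 0 with hv | hv
  · have : gk v = fun _ => 0 := funext (gk_of_nonpos hv)
    rw [this, gkd_of_nonpos hv]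
    exact hasDerivAt_const _ _
  · have h1 : HasDerivAt (fun z : ℝ => -z ^ 2 / (4 * v)) (-(2 * z) / (4 * v)) z := by
      simpa using (((hasDerivAt_id z).pow 2).neg).div_const (4 * v)
    have h2 := (h1.exp).const_mul (1 / √(4 * Real.pi * v))
    refine h2.congr_deriv ?_
    simp only [gkd, gk]
    field_simp
    ring

lemma hasDerivAt_gkd_right (j : ℕ) (v z : ℝ) :
    HasDerivAt (fun z => gkd j v z) (gkd (j + 1) v z) z := by
  induction j using Nat.strong_induction_on with
  | _ j ih =>
    match j with
    | 0 => exact hasDerivAt_gk_right v z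
    | 1 =>
      have h := (((hasDerivAt_id z).mul (hasDerivAt_gk_right v z)).neg).div_const (2 * v)
      refine h.congr_deriv ?_
      simp only [id, gkd]
      push_cast
      ring
    | j + 2 =>
      have h := (((hasDerivAt_id z).mul (ih (j + 1) (by omega))).add
        ((ih j (by omega)).const_mul ((j : ℝ) + 1))).neg.div_const (2 * v)
      refine h.congr_deriv ?_
      simp only [id, gkd]
      push_cast
      ring

/-- The heat equation in the variance variable. It turns increments in time, and changes of the
frozen coefficient, into two further space derivatives. -/
lemma hasDerivAt_gk_left {v : ℝ} (hv : 0 < v) (z : ℝ) :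
    HasDerivAt (fun v => gk v z) (gkd 2 v z) v := by
  have hpi := Real.pi_pos
  have h0 : 4 * Real.pi * v ≠ 0 := by positivity
  have h1 : HasDerivAt (fun v : ℝ => 4 * Real.pi * v) (4 * Real.pi) v := by
    simpa using (hasDerivAt_id v).const_mul (4 * Real.pi)
  have h2 := (h1.sqrt h0).inv (Real.sqrt_ne_zero'.2 (by positivity))
  have h3 : HasDerivAt (fun v : ℝ => -z ^ 2 / (4 * v)) (z ^ 2 / (4 * v ^ 2)) v := by
    have := ((hasDerivAt_inv hv.ne').const_mul (-z ^ 2 / 4))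
    refine (this.congr_deriv ?_).congr_of_eventuallyEq (Filter.Eventually.of_forall fun w => ?_)
    · field_simp
    · simp only [div_eq_mul_inv, mul_inv]; ring
  have h4 := h2.mul h3.exp
  simp only [gk]
  have hs : √(4 * Real.pi * v) ^ 2 = 4 * Real.pi * v := Real.sq_sqrt (by positivity)
  have hs0 : 0 < √(4 * Real.pi * v) := Real.sqrt_pos.2 (by positivity)
  refine (h4.congr_deriv ?_).congr_of_eventuallyEq (Filter.Eventually.of_forall fun w => ?_)
  · simp only [gkd, gk, hs, Pi.inv_apply]
    push_cast
    field_simp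
    ring
  · simp [one_div]

lemma hasDerivAt_gkd_left (j : ℕ) {v : ℝ} (hv : 0 < v) (z : ℝ) :
    HasDerivAt (fun v => gkd j v z) (gkd (j + 2) v z) v := by
  have h2v : HasDerivAt (fun v : ℝ => 2 * v) 2 v := by
    simpa using (hasDerivAt_id v).const_mul (2 : ℝ)
  induction j using Nat.strong_induction_on with
  | _ j ih =>
    match j with
    | 0 => exact hasDerivAt_gk_left hv z
    | 1 =>
      have h := (((hasDerivAt_gk_left hv z).const_mul z).neg).div h2v (by positivity)
      refine h.congr_deriv ?_
      simp only [Pi.neg_apply, gkd]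
      push_cast
      field_simp
      ring
    | j + 2 =>
      have h := (((ih (j + 1) (by omega)).const_mul z).add
        ((ih j (by omega)).const_mul ((j : ℝ) + 1))).neg.div h2v (by positivity)
      have e : gkd (j + 2) v z = -(z * gkd (j + 1) v z + (j + 1) * gkd j v z) / (2 * v) := by
        simp only [gkd]
      have e4 : gkd (j + 2 + 2) v z
          = -(z * gkd (j + 3) v z + (j + 3) * gkd (j + 2) v z) / (2 * v) := by
        simp only [gkd]; push_cast; ring
      have e' : z * gkd (j + 1) v z + (j + 1) * gkd j v z = -(2 * v) * gkd (j + 2) v z := by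
        rw [e]; field_simp
      refine h.congr_deriv ?_
      simp only [Pi.neg_apply, Pi.add_apply]
      rw [e4, e']
      simp only [show j + 1 + 2 = j + 3 from rfl]
      field_simp
      ring

/-- Induction along the recursion for `gkd`. Each order spends one application of `abs_mul_gk_le`,
hence one doubling of the variance, which is the origin of 2 ^ j. -/
lemma exists_gkd_bound (j : ℕ) : ∃ C : ℝ, 0 < C ∧ ∀ v z : ℝ, 0 < v →
    |gkd j v z| ≤ C * (√v)⁻¹ ^ j * gk (2 ^ j * v) z := by
  induction j using Nat.strong_induction_on with
  | _ j ih =>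
    match j with
    | 0 => exact ⟨1, one_pos, fun v z hv => by simp [gkd, abs_of_nonneg (gk_nonneg v z)]⟩
    | 1 =>
      refine ⟨2, two_pos, fun v z hv => ?_⟩
      have h := abs_mul_gk_le hv z
      have hs : 0 < √v := Real.sqrt_pos.2 hv
      have hs2 : √v ^ 2 = v := Real.sq_sqrt hv.le
      simp only [gkd, pow_one]
      rw [abs_div, abs_neg, abs_mul, abs_of_nonneg (gk_nonneg v z),
        abs_of_pos (by positivity : 0 < 2 * v), div_le_iff₀ (by positivity)]
      calc _ ≤ _ := h
        _ = 2 * (√v)⁻¹ * gk (2 * v) z * (2 * √v ^ 2) := by field_simp; norm_num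
        _ = _ := by rw [hs2]
    | j + 2 =>
      obtain ⟨C₁, hC₁, h₁⟩ := ih (j + 1) (by omega)
      obtain ⟨C₀, hC₀, h₀⟩ := ih j (by omega)
      refine ⟨2 * √(2 ^ (j + 1)) * C₁ + 2 * (j + 1) * C₀, by positivity, fun v z hv => ?_⟩
      have hs : 0 < √v := Real.sqrt_pos.2 hv
      have hs2 : √v ^ 2 = v := Real.sq_sqrt hv.le
      have k1 := h₁ v z hv
      have k0 := h₀ v z hv
      have m1 := abs_mul_gk_le (show 0 < 2 ^ (j + 1) * v by positivity) z
      rw [← mul_assoc 2, ← pow_succ', Real.sqrt_mul (by positivity)] at m1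
      have m0 : gk (2 ^ j * v) z ≤ 4 * gk (2 ^ (j + 2) * v) z := by
        have a1 := gk_le_two (show 0 < 2 ^ j * v by positivity) z
        have a2 := gk_le_two (show 0 < 2 * (2 ^ j * v) by positivity) z
        rw [show 2 * (2 * (2 ^ j * v)) = 2 ^ (j + 2) * v by ring] at a2
        linarith
      set s := (√v)⁻¹ with hsdef
      have hs0 : 0 < s := by positivity
      have hss : s * √v = 1 := inv_mul_cancel₀ hs.ne'
      have hsv : 1 / (2 * v) = s ^ 2 / 2 := by rw [hsdef, inv_pow, hs2]; field_simp
      set g := gk (2 ^ (j + 2) * v) z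
      simp only [gkd]
      rw [abs_div, abs_neg, abs_of_pos (by positivity : 0 < 2 * v), div_eq_mul_one_div, hsv]
      have b1 : |z * gkd (j + 1) v z + (j + 1) * gkd j v z|
          ≤ C₁ * s ^ (j + 1) * (4 * (√(2 ^ (j + 1)) * √v) * g) + (j + 1) * (C₀ * s ^ j * (4 * g)) := by
        refine (abs_add_le _ _).trans ?_
        rw [abs_mul, abs_mul, abs_of_nonneg (by positivity : (0 : ℝ) ≤ (j : ℝ) + 1)]
        gcongr ?_ + _ * ?_
        · calc |z| * |gkd (j + 1) v z| ≤ |z| * (C₁ * s ^ (j + 1) * gk (2 ^ (j + 1) * v) z) := by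
                gcongr
            _ = C₁ * s ^ (j + 1) * (|z| * gk (2 ^ (j + 1) * v) z) := by ring
            _ ≤ _ := by gcongr
        · calc _ ≤ _ := k0
            _ ≤ _ := by gcongr
      calc _ ≤ (C₁ * s ^ (j + 1) * (4 * (√(2 ^ (j + 1)) * √v) * g)
            + (j + 1) * (C₀ * s ^ j * (4 * g))) * (s ^ 2 / 2) := by gcongr
        _ = (2 * √(2 ^ (j + 1)) * C₁ * (s * √v) + 2 * (j + 1) * C₀) * s ^ (j + 2) * g := by ring
        _ = _ := by rw [hss]; ring

/-! ### Singular weights in time -/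

/-- The weight `σ ^ (-ρ)` on positive time lags. -/
noncomputable def tw (ρ σ : ℝ) : ℝ≥0∞ := if 0 < σ then ENNReal.ofReal (σ ^ (-ρ)) else 0

/-- The weight `σ ^ (-3/4) e ^ (μ σ)` on positive time lags. -/
noncomputable def kw (μ σ : ℝ) : ℝ≥0∞ :=
  if 0 < σ then ENNReal.ofReal (σ ^ (-(3 / 4) : ℝ) * Real.exp (μ * σ)) else 0

/-- Convolution of time weights. -/
noncomputable def tconv (w₁ w₂ : ℝ → ℝ≥0∞) (σ : ℝ) : ℝ≥0∞ := ∫⁻ s, w₁ (σ - s) * w₂ s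

lemma tw_of_pos {ρ σ : ℝ} (h : 0 < σ) : tw ρ σ = ENNReal.ofReal (σ ^ (-ρ)) := if_pos h
lemma tw_of_nonpos {ρ σ : ℝ} (h : σ ≤ 0) : tw ρ σ = 0 := if_neg h.not_gt
lemma kw_of_pos {μ σ : ℝ} (h : 0 < σ) :
    kw μ σ = ENNReal.ofReal (σ ^ (-(3 / 4) : ℝ) * Real.exp (μ * σ)) := if_pos h
lemma kw_of_nonpos {μ σ : ℝ} (h : σ ≤ 0) : kw μ σ = 0 := if_neg h.not_gt

@[fun_prop]
lemma measurable_tw (ρ : ℝ) : Measurable (tw ρ) :=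
  Measurable.ite measurableSet_Ioi (by fun_prop) measurable_const

@[fun_prop]
lemma measurable_kw (μ : ℝ) : Measurable (kw μ) :=
  Measurable.ite measurableSet_Ioi (by fun_prop) measurable_const

lemma tw_lt_top (ρ σ : ℝ) : tw ρ σ < ∞ := by unfold tw; split_ifs <;> simp

lemma tw_add {ρ ρ' σ : ℝ} : tw ρ σ * tw ρ' σ = tw (ρ + ρ') σ := by
  rcases le_or_gt σ 0 with h | h
  · simp [tw_of_nonpos h]
  · rw [tw_of_pos h, tw_of_pos h, tw_of_pos h, ← ENNReal.ofReal_mul (by positivity),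
      ← Real.rpow_add h]
    ring_nf

/-- Lowering the singularity costs a power of the time horizon. -/
lemma tw_le_tw {ρ ρ' σ T : ℝ} (hρ : ρ ≤ ρ') (hσ : σ ≤ T) :
    tw ρ σ ≤ ENNReal.ofReal (T ^ (ρ' - ρ)) * tw ρ' σ := by
  rcases le_or_gt σ 0 with h | h
  · simp [tw_of_nonpos h]
  · rw [tw_of_pos h, tw_of_pos h,
      ← ENNReal.ofReal_mul (Real.rpow_nonneg (h.le.trans hσ) _)]
    apply ENNReal.ofReal_le_ofReal
    rw [show -ρ = (ρ' - ρ) + -ρ' by ring, Real.rpow_add h]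
    gcongr

lemma kw_le_tw {μ σ T : ℝ} (hμ : 0 ≤ μ) (hσ : σ ≤ T) :
    kw μ σ ≤ ENNReal.ofReal (Real.exp (μ * T)) * tw (3 / 4) σ := by
  rcases le_or_gt σ 0 with h | h
  · simp [kw_of_nonpos h]
  · rw [tw_of_pos h, kw_of_pos h, ← ENNReal.ofReal_mul (by positivity)]
    apply ENNReal.ofReal_le_ofReal
    rw [mul_comm]
    gcongr

lemma lintegral_rpow_Ioo {ρ σ : ℝ} (hρ : ρ < 1) (hσ : 0 ≤ σ) :
    ∫⁻ s in Ioo 0 σ, ENNReal.ofReal (s ^ (-ρ)) = ENNReal.ofReal (σ ^ (1 - ρ) / (1 - ρ)) := by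
  have hint : IntegrableOn (fun s : ℝ => s ^ (-ρ)) (Ioc 0 σ) :=
    (intervalIntegrable_iff_integrableOn_Ioc_of_le hσ).1
      (intervalIntegral.intervalIntegrable_rpow' (by linarith))
  rw [restrict_Ioo_eq_restrict_Ioc, ← ofReal_integral_eq_lintegral_ofReal hint
    ((ae_restrict_iff' measurableSet_Ioc).2 (Filter.Eventually.of_forall fun s hs =>
      Real.rpow_nonneg hs.1.le _)),
    ← intervalIntegral.integral_of_le hσ, integral_rpow (Or.inl (by linarith)),
    Real.zero_rpow (by linarith)]
  ring_nf

lemma lintegral_tw_Iio {ρ σ : ℝ} (hρ : ρ < 1) (hσ : 0 ≤ σ) :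
    ∫⁻ s in Iio σ, tw ρ s = ENNReal.ofReal (σ ^ (1 - ρ) / (1 - ρ)) := by
  rw [← lintegral_rpow_Ioo hρ hσ, ← lintegral_indicator measurableSet_Iio,
    ← lintegral_indicator measurableSet_Ioo]
  congr 1
  funext s
  by_cases h1 : 0 < s <;> by_cases h2 : s < σ <;> simp [indicator, tw, h1, h2]

/-- Integration of a time weight over the past of `t` after time `τ`. -/
lemma lintegral_tw_sub {ρ t τ : ℝ} (hρ : ρ < 1) (h : τ ≤ t) :
    ∫⁻ s in Ioi τ, tw ρ (t - s) = ENNReal.ofReal ((t - τ) ^ (1 - ρ) / (1 - ρ)) := by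
  rw [← lintegral_tw_Iio hρ (sub_nonneg.2 h), ← lintegral_indicator measurableSet_Iio,
    ← lintegral_indicator measurableSet_Ioi,
    ← lintegral_sub_left_eq_self (fun s => (Iio (t - τ)).indicator (tw ρ) s) t]
  congr 1
  funext s
  simp [indicator]

/-- A Beta integral estimated without its exact value: on each half of (0, σ) one of the weights is
at most its value at σ/2, and the other is integrated. -/
lemma tw_tconv_le {a b : ℝ} (ha : 0 ≤ a) (ha1 : a < 1) (hb : 0 ≤ b) (hb1 : b < 1) :
    ∃ C : ℝ, 0 < C ∧ ∀ σ, tconv (tw a) (tw b) σ ≤ ENNReal.ofReal C * tw (a + b - 1) σ := by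
  have h2a : (0 : ℝ) < 1 - a := by linarith
  have h2b : (0 : ℝ) < 1 - b := by linarith
  refine ⟨2 ^ a / (1 - b) + 2 ^ b / (1 - a), by positivity, fun σ => ?_⟩
  have hsupp : tconv (tw a) (tw b) σ = ∫⁻ s in Ioo 0 σ, tw a (σ - s) * tw b s := by
    rw [tconv, ← lintegral_indicator measurableSet_Ioo]
    congr 1
    funext s
    by_cases h1 : 0 < s <;> by_cases h2 : s < σ <;> simp [indicator, tw, h1, h2]
  rcases le_or_gt σ 0 with h | h
  · rw [hsupp, Ioo_eq_empty (by linarith)]; simp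
  rw [hsupp]
  have hpt : ∀ s ∈ Ioo 0 σ, tw a (σ - s) * tw b s
      ≤ ENNReal.ofReal ((σ / 2) ^ (-a)) * ENNReal.ofReal (s ^ (-b))
        + ENNReal.ofReal ((σ / 2) ^ (-b)) * tw a (σ - s) := by
    intro s hs
    have hs' : 0 < σ - s := by linarith [hs.2]
    rw [tw_of_pos hs', tw_of_pos hs.1]
    rcases le_total s (σ / 2) with h1 | h1
    · refine le_add_right ?_
      gcongr ENNReal.ofReal ?_ * _
      exact Real.rpow_le_rpow_of_nonpos (by positivity) (by linarith) (by linarith)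
    · refine le_add_left ?_
      rw [mul_comm]
      gcongr ENNReal.ofReal ?_ * _
      exact Real.rpow_le_rpow_of_nonpos (by positivity) (by linarith) (by linarith)
  refine (setLIntegral_mono' measurableSet_Ioo hpt).trans ?_
  rw [lintegral_add_left (by fun_prop), lintegral_const_mul _ (by fun_prop),
    lintegral_const_mul _ (by fun_prop), lintegral_rpow_Ioo hb1 h.le]
  have h3 : ∫⁻ s in Ioo 0 σ, tw a (σ - s) ≤ ENNReal.ofReal (σ ^ (1 - a) / (1 - a)) := by
    refine (lintegral_mono_set Ioo_subset_Ioi_self).trans ?_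
    rw [lintegral_tw_sub ha1 h.le, sub_zero]
  refine (add_le_add_right (mul_le_mul_right h3 _) _).trans (le_of_eq ?_)
  rw [tw_of_pos h, ← ENNReal.ofReal_mul (by positivity), ← ENNReal.ofReal_mul (by positivity),
    ← ENNReal.ofReal_add (by positivity) (by positivity), ← ENNReal.ofReal_mul (by positivity)]
  congr 1
  have e1 : (σ / 2) ^ (-a) * (σ ^ (1 - b) / (1 - b))
      = 2 ^ a / (1 - b) * σ ^ (-(a + b - 1)) := by
    rw [Real.div_rpow h.le (by norm_num), Real.rpow_neg (by norm_num : (0 : ℝ) ≤ 2) a,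
      show -(a + b - 1) = -a + (1 - b) by ring, Real.rpow_add h]
    field_simp
  have e2 : (σ / 2) ^ (-b) * (σ ^ (1 - a) / (1 - a))
      = 2 ^ b / (1 - a) * σ ^ (-(a + b - 1)) := by
    rw [Real.div_rpow h.le (by norm_num), Real.rpow_neg (by norm_num : (0 : ℝ) ≤ 2) b,
      show -(a + b - 1) = -b + (1 - a) by ring, Real.rpow_add h]
    field_simp
  rw [e1, e2]
  ring

lemma tconv_const_mul {w₁ w₂ : ℝ → ℝ≥0∞} (h₁ : Measurable w₁) (h₂ : Measurable w₂) (A B : ℝ≥0∞)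
    (σ : ℝ) : tconv (fun s => A * w₁ s) (fun s => B * w₂ s) σ = A * B * tconv w₁ w₂ σ := by
  rw [tconv, tconv, ← lintegral_const_mul _ (by fun_prop)]
  congr 1; funext s; ring

/-- The negative power of ν in this Gamma integral is the small factor that makes the Neumann series
converge. -/
lemma lintegral_kw_neg {ν : ℝ} (hν : 0 < ν) :
    ∫⁻ s, kw (-ν) s = ENNReal.ofReal (ν ^ (-(1 / 4) : ℝ) * Real.Gamma (1 / 4)) := by
  have h1 : ∫⁻ s, kw (-ν) s
      = ∫⁻ s in Ioi 0, ENNReal.ofReal (s ^ (1 / 4 - 1 : ℝ) * Real.exp (-(ν * s))) := by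
    rw [← lintegral_indicator measurableSet_Ioi]
    congr 1; funext s
    by_cases h : 0 < s
    · simp only [indicator, mem_Ioi, h, if_true, kw]
      norm_num
    · simp [indicator, kw, h]
  have h2 := Real.integral_rpow_mul_exp_neg_mul_Ioi (a := 1 / 4) (by norm_num) hν
  have hpos : 0 < ν ^ (-(1 / 4) : ℝ) * Real.Gamma (1 / 4) := by
    have := Real.Gamma_pos_of_pos (show (0 : ℝ) < 1 / 4 by norm_num)
    positivity
  have e : (1 / ν) ^ (1 / 4 : ℝ) = ν ^ (-(1 / 4) : ℝ) := by
    rw [one_div, Real.inv_rpow hν.le, Real.rpow_neg hν.le]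
  rw [e] at h2
  rw [h1, ← h2, ofReal_integral_eq_lintegral_ofReal]
  · by_contra hcon
    rw [integral_undef hcon] at h2
    exact hpos.ne h2
  · exact (ae_restrict_iff' measurableSet_Ioi).2 (Filter.Eventually.of_forall fun s hs =>
      mul_nonneg (Real.rpow_nonneg (le_of_lt hs) _) (Real.exp_pos _).le)

/-- Convolution with `kw 1` is a contraction in the scale `kw μ` for large `μ`. -/
lemma kw_tconv_le {ν : ℝ} (hν : 0 < ν) (σ : ℝ) :
    tconv (kw 1) (kw (1 + ν)) σ
      ≤ ENNReal.ofReal (8 * Real.Gamma (1 / 4) * ν ^ (-(1 / 4) : ℝ)) * kw (1 + ν) σ := by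
  have hsupp : tconv (kw 1) (kw (1 + ν)) σ = ∫⁻ s in Ioo 0 σ, kw 1 (σ - s) * kw (1 + ν) s := by
    rw [tconv, ← lintegral_indicator measurableSet_Ioo]
    congr 1
    funext s
    by_cases h1 : 0 < s <;> by_cases h2 : s < σ <;> simp [indicator, kw, h1, h2]
  rcases le_or_gt σ 0 with h | h
  · rw [hsupp, Ioo_eq_empty (by linarith)]; simp
  have hG := Real.Gamma_pos_of_pos (show (0 : ℝ) < 1 / 4 by norm_num)
  set A : ℝ := (σ / 2) ^ (-(3 / 4) : ℝ) * Real.exp ((1 + ν) * σ) with hA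
  have hA0 : 0 ≤ A := by positivity
  have hpt : ∀ s ∈ Ioo 0 σ, kw 1 (σ - s) * kw (1 + ν) s
      ≤ ENNReal.ofReal A * kw (-ν) s + ENNReal.ofReal A * kw (-ν) (σ - s) := by
    intro s hs
    have hs' : 0 < σ - s := by linarith [hs.2]
    have hs0 : 0 < s := hs.1
    rw [kw_of_pos hs', kw_of_pos hs0, kw_of_pos hs', kw_of_pos hs0,
      ← ENNReal.ofReal_mul (by positivity), ← ENNReal.ofReal_mul (by positivity),
      ← ENNReal.ofReal_mul (by positivity), hA]
    -- The full growth e^((1+ν)σ) is extracted and e^(-ν(σ-s)) remains. On the first half s ≤ σ - s,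
    -- so this is at most e^(-νs). Either half thus reduces to the total integral of `kw (-ν)`.
    have e : Real.exp (1 * (σ - s)) * Real.exp ((1 + ν) * s)
        = Real.exp ((1 + ν) * σ) * Real.exp (-ν * (σ - s)) := by
      rw [← Real.exp_add, ← Real.exp_add]; ring_nf
    rcases le_total s (σ / 2) with h1 | h1
    · refine le_add_right (ENNReal.ofReal_le_ofReal ?_)
      have h3 : (σ - s) ^ (-(3 / 4) : ℝ) ≤ (σ / 2) ^ (-(3 / 4) : ℝ) :=
        Real.rpow_le_rpow_of_nonpos (by positivity) (by linarith) (by norm_num)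
      have h4 : Real.exp (-ν * (σ - s)) ≤ Real.exp (-ν * s) := by
        apply Real.exp_le_exp.2; nlinarith
      calc _ = (σ - s) ^ (-(3 / 4) : ℝ) * s ^ (-(3 / 4) : ℝ)
            * (Real.exp (1 * (σ - s)) * Real.exp ((1 + ν) * s)) := by ring
        _ ≤ (σ / 2) ^ (-(3 / 4) : ℝ) * s ^ (-(3 / 4) : ℝ)
            * (Real.exp ((1 + ν) * σ) * Real.exp (-ν * s)) := by rw [e]; gcongr
        _ = _ := by ring
    · refine le_add_left (ENNReal.ofReal_le_ofReal ?_)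
      have h3 : s ^ (-(3 / 4) : ℝ) ≤ (σ / 2) ^ (-(3 / 4) : ℝ) :=
        Real.rpow_le_rpow_of_nonpos (by positivity) (by linarith) (by norm_num)
      calc _ = (σ - s) ^ (-(3 / 4) : ℝ) * s ^ (-(3 / 4) : ℝ)
            * (Real.exp (1 * (σ - s)) * Real.exp ((1 + ν) * s)) := by ring
        _ ≤ (σ - s) ^ (-(3 / 4) : ℝ) * (σ / 2) ^ (-(3 / 4) : ℝ)
            * (Real.exp ((1 + ν) * σ) * Real.exp (-ν * (σ - s))) := by rw [e]; gcongr
        _ = _ := by ring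
  rw [hsupp]
  refine (setLIntegral_mono' measurableSet_Ioo hpt).trans ((setLIntegral_le_lintegral _ _).trans ?_)
  rw [lintegral_add_left (by fun_prop), lintegral_const_mul _ (by fun_prop),
    lintegral_const_mul _ (by fun_prop), lintegral_sub_left_eq_self (kw (-ν)) σ,
    lintegral_kw_neg hν, ← ENNReal.ofReal_mul hA0, ← ENNReal.ofReal_add (by positivity)
    (by positivity), kw_of_pos h, ← ENNReal.ofReal_mul (by positivity)]
  apply ENNReal.ofReal_le_ofReal
  have e1 : (σ / 2) ^ (-(3 / 4) : ℝ) ≤ 4 * σ ^ (-(3 / 4) : ℝ) := by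
    rw [Real.div_rpow h.le (by norm_num), Real.rpow_neg (by norm_num : (0 : ℝ) ≤ 2),
      div_inv_eq_mul, mul_comm]
    gcongr
    calc (2 : ℝ) ^ (3 / 4 : ℝ) ≤ 2 ^ (1 : ℝ) :=
          Real.rpow_le_rpow_of_exponent_le (by norm_num) (by norm_num)
      _ ≤ 4 := by norm_num
  rw [hA]
  calc _ = (σ / 2) ^ (-(3 / 4) : ℝ) * (Real.exp ((1 + ν) * σ) *
        (2 * (ν ^ (-(1 / 4) : ℝ) * Real.Gamma (1 / 4)))) := by ring
    _ ≤ 4 * σ ^ (-(3 / 4) : ℝ) * (Real.exp ((1 + ν) * σ) *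
        (2 * (ν ^ (-(1 / 4) : ℝ) * Real.Gamma (1 / 4)))) := by gcongr
    _ = _ := by ring

/-! ### Gaussian majorants on space-time -/

/-- The heat kernel with diffusion constant `c` between two space-time points. -/
noncomputable def hk (c : ℝ) (p q : ℝ × ℝ) : ℝ≥0∞ :=
  ENNReal.ofReal (gk (c * (p.2 - q.2)) (p.1 - q.1))

@[fun_prop]
lemma measurable_hk_comp {α : Type*} [MeasurableSpace α] {f g : α → ℝ × ℝ} {c : ℝ}
    (hf : Measurable f) (hg : Measurable g) : Measurable fun x => hk c (f x) (g x) := by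
  unfold hk
  fun_prop

lemma hk_lt_top (c : ℝ) (p q : ℝ × ℝ) : hk c p q < ∞ := ENNReal.ofReal_lt_top

lemma hk_of_le {c : ℝ} (hc : 0 ≤ c) {p q : ℝ × ℝ} (h : p.2 ≤ q.2) : hk c p q = 0 := by
  rw [hk, gk_of_nonpos (by nlinarith), ENNReal.ofReal_zero]

/-- Integration over space-time, time outermost. -/
lemma lintegral_spacetime {F : ℝ × ℝ → ℝ≥0∞} (hF : Measurable F) :
    ∫⁻ r, F r = ∫⁻ s, ∫⁻ y, F (y, s) := by
  rw [Measure.volume_eq_prod, lintegral_prod_symm' _ hF]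

/-- Both Gaussians have the same diffusion constant, so the Chapman-Kolmogorov identity is exact:
the majorant is not widened by composition, however often it is iterated, and only the time weights
convolve. The vanishing of the weights for s ≤ 0 confines the integral to intermediate times. -/
lemma lintegral_hk_comp {c : ℝ} (hc : 0 < c) {w₁ w₂ : ℝ → ℝ≥0∞} (hw₁ : Measurable w₁)
    (hw₂ : Measurable w₂) (p q : ℝ × ℝ) (h1 : ∀ s ≤ 0, w₁ s = 0) (h2 : ∀ s ≤ 0, w₂ s = 0) :
    ∫⁻ r : ℝ × ℝ, (w₁ (p.2 - r.2) * hk c p r) * (w₂ (r.2 - q.2) * hk c r q)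
      = tconv w₁ w₂ (p.2 - q.2) * hk c p q := by
  rw [lintegral_spacetime (by fun_prop), tconv, ← lintegral_mul_const _ (by fun_prop),
    ← lintegral_sub_right_eq_self (fun s => w₁ (p.2 - q.2 - s) * w₂ s * hk c p q) q.2]
  congr 1
  funext s
  dsimp only
  rw [show p.2 - q.2 - (s - q.2) = p.2 - s by ring]
  by_cases hs1 : p.2 - s ≤ 0
  · simp [h1 _ hs1]
  by_cases hs2 : s - q.2 ≤ 0
  · simp [h2 _ hs2]
  push Not at hs1 hs2
  simp only [hk]
  calc _ = ∫⁻ y, w₁ (p.2 - s) * w₂ (s - q.2) *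
        (ENNReal.ofReal (gk (c * (p.2 - s)) (p.1 - y)) *
          ENNReal.ofReal (gk (c * (s - q.2)) (y - q.1))) := by
        congr 1; funext y; ring
    _ = _ := by
        rw [lintegral_const_mul _ (by fun_prop), lintegral_gk_mul_gk (by positivity)
          (by positivity)]
        congr 4; ring

/-! ### Frozen-coefficient kernels -/

/-- A continuous diffusion coefficient on space-time, with values in `[m, M]`, `0 < m`, and
Hölder continuous of order `1/2` with constant `L`. -/
structure IsCoeff (m M L : ℝ) (a : ℝ × ℝ → ℝ) : Prop where
  cont : Continuous a
  m_pos : 0 < m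
  le_a : ∀ p, m ≤ a p
  a_le : ∀ p, a p ≤ M
  L_nonneg : 0 ≤ L
  holder : ∀ p q : ℝ × ℝ, |a p - a q| ≤ L * (√|p.1 - q.1| + √|p.2 - q.2|)

namespace IsCoeff

variable {m M L : ℝ} {a : ℝ × ℝ → ℝ}

lemma a_pos (h : IsCoeff m M L a) (p : ℝ × ℝ) : 0 < a p := h.m_pos.trans_le (h.le_a p)

lemma m_le_M (h : IsCoeff m M L a) : m ≤ M := (h.le_a 0).trans (h.a_le 0)

lemma M_pos (h : IsCoeff m M L a) : 0 < M := h.m_pos.trans_le h.m_le_M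

lemma abs_sub_le (h : IsCoeff m M L a) (p q : ℝ × ℝ) : |a p - a q| ≤ M := by
  have := h.m_pos
  rw [abs_sub_le_iff]
  constructor <;> linarith [h.le_a p, h.le_a q, h.a_le p, h.a_le q]

end IsCoeff

/-- The `j`-th space derivative of the heat kernel with the coefficient frozen at `q`. -/
noncomputable def fk (a : ℝ × ℝ → ℝ) (j : ℕ) (p q : ℝ × ℝ) : ℝ :=
  gkd j (a q * (p.2 - q.2)) (p.1 - q.1)

/-- The error kernel of the parametrix. -/
noncomputable def ek (a : ℝ × ℝ → ℝ) (γ : ℝ) (p q : ℝ × ℝ) : ℝ :=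
  (a p - a q) * fk a 2 p q - γ * fk a 0 p q

lemma fk_zero_eq (a : ℝ × ℝ → ℝ) (p q : ℝ × ℝ) :
    fk a 0 p q = gk (a q * (p.2 - q.2)) (p.1 - q.1) := rfl

lemma fk_of_le {m M L : ℝ} {a : ℝ × ℝ → ℝ} (h : IsCoeff m M L a) (j : ℕ) {p q : ℝ × ℝ}
    (hpq : p.2 ≤ q.2) : fk a j p q = 0 :=
  gkd_of_nonpos (mul_nonpos_of_nonneg_of_nonpos (h.a_pos q).le (sub_nonpos.2 hpq)) _ _

lemma ek_of_le {m M L : ℝ} {a : ℝ × ℝ → ℝ} (h : IsCoeff m M L a) (γ : ℝ) {p q : ℝ × ℝ}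
    (hpq : p.2 ≤ q.2) : ek a γ p q = 0 := by
  simp [ek, fk_of_le h _ hpq]

lemma measurable_fk {m M L : ℝ} {a : ℝ × ℝ → ℝ} (h : IsCoeff m M L a) (j : ℕ) :
    Measurable fun z : (ℝ × ℝ) × (ℝ × ℝ) => fk a j z.1 z.2 := by
  have := h.cont.measurable
  unfold fk
  fun_prop

lemma measurable_ek {m M L : ℝ} {a : ℝ × ℝ → ℝ} (h : IsCoeff m M L a) (γ : ℝ) :
    Measurable fun z : (ℝ × ℝ) × (ℝ × ℝ) => ek a γ z.1 z.2 := by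
  have := h.cont.measurable
  have h2 := measurable_fk h 2
  have h0 := measurable_fk h 0
  unfold ek
  fun_prop

/-- Gaussians with comparable variances are dominated by the common majorant. -/
lemma gk_le_majorant {m M : ℝ} (hm : 0 < m) {σ v : ℝ} (hσ : 0 < σ)
    (h1 : m * σ ≤ v) (h2 : v ≤ 64 * M * σ) (z : ℝ) :
    gk v z ≤ √(64 * M / m) * gk (64 * M * σ) z := by
  have := gk_le_of_le (mul_pos hm hσ) h1 h2 z
  rwa [mul_div_mul_right _ _ hσ.ne'] at this

lemma inv_sqrt_pow_eq {σ : ℝ} (hσ : 0 < σ) (j : ℕ) : (√σ)⁻¹ ^ j = σ ^ (-(j / 2 : ℝ)) := by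
  rw [Real.sqrt_eq_rpow, ← Real.rpow_neg hσ.le, ← Real.rpow_natCast, ← Real.rpow_mul hσ.le]
  congr 1
  ring

/-- Fixes the common majorant: order at most four multiplies the variance by at most 16, and 16 · 4M
= 64M. -/
lemma exists_gkd_le {m M : ℝ} (hm : 0 < m) (hmM : m ≤ M) {j : ℕ} (hj : j ≤ 4) :
    ∃ C : ℝ, 0 < C ∧ ∀ σ v z : ℝ, 0 < σ → m * σ ≤ v → v ≤ 4 * M * σ →
      |gkd j v z| ≤ C * σ ^ (-(j / 2 : ℝ)) * gk (64 * M * σ) z := by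
  obtain ⟨C, hC, hb⟩ := exists_gkd_bound j
  have hM : 0 < M := hm.trans_le hmM
  refine ⟨C * (√m)⁻¹ ^ j * √(64 * M / m), by positivity, fun σ v z hσ h1 h2 => ?_⟩
  have hmσ : 0 < m * σ := by positivity
  have hv : 0 < v := hmσ.trans_le h1
  have hj1 : (1 : ℝ) ≤ 2 ^ j := one_le_pow₀ (by norm_num)
  have hj2 : (2 : ℝ) ^ j ≤ 2 ^ 4 := pow_le_pow_right₀ (by norm_num) hj
  refine (hb v z hv).trans ?_
  have k1 : (√v)⁻¹ ^ j ≤ (√m)⁻¹ ^ j * σ ^ (-(j / 2 : ℝ)) := by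
    rw [← inv_sqrt_pow_eq hσ, ← mul_pow, ← mul_inv, ← Real.sqrt_mul hm.le]
    gcongr
  have k2 : gk (2 ^ j * v) z ≤ √(64 * M / m) * gk (64 * M * σ) z := by
    apply gk_le_majorant hm hσ
    · nlinarith
    · calc (2 : ℝ) ^ j * v ≤ 2 ^ 4 * (4 * M * σ) := by gcongr
        _ = _ := by ring
  calc _ ≤ C * ((√m)⁻¹ ^ j * σ ^ (-(j / 2 : ℝ))) * (√(64 * M / m) * gk (64 * M * σ) z) := by
        gcongr
        exact gk_nonneg _ _
    _ = _ := by ring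

lemma exists_fk_bound {m M : ℝ} (hm : 0 < m) (hmM : m ≤ M) {j : ℕ} (hj : j ≤ 4) :
    ∃ C : ℝ, 0 < C ∧ ∀ (L : ℝ) (a : ℝ × ℝ → ℝ), IsCoeff m M L a → ∀ p q : ℝ × ℝ,
      ‖fk a j p q‖ₑ ≤ ENNReal.ofReal C * (tw (j / 2) (p.2 - q.2) * hk (64 * M) p q) := by
  obtain ⟨C, hC, hb⟩ := exists_gkd_le hm hmM hj
  refine ⟨C, hC, fun L a h p q => ?_⟩
  rcases le_or_gt p.2 q.2 with hpq | hpq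
  · simp [fk_of_le h j hpq]
  have hσ : 0 < p.2 - q.2 := sub_pos.2 hpq
  rw [tw_of_pos hσ, hk, ← ENNReal.ofReal_mul (by positivity), ← ENNReal.ofReal_mul hC.le,
    Real.enorm_eq_ofReal_abs, ← mul_assoc]
  apply ENNReal.ofReal_le_ofReal
  refine hb _ _ _ hσ ?_ ?_
  · gcongr; exact h.le_a q
  · have := h.a_le q
    have := h.M_pos
    nlinarith

/-- Half a power of the distance gains a quarter power of the time lag. -/
lemma exists_sqrt_mul_gk_le {m M : ℝ} (hm : 0 < m) (hmM : m ≤ M) :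
    ∃ C : ℝ, 0 < C ∧ ∀ σ v z : ℝ, 0 < σ → m * σ ≤ v → v ≤ 32 * M * σ →
      (√|z| + √|σ|) * gk v z
        ≤ C * (σ ^ (1 / 4 : ℝ) + σ ^ (1 / 2 : ℝ)) * gk (64 * M * σ) z := by
  have hM : 0 < M := hm.trans_le hmM
  refine ⟨(6 * (32 * M) ^ (1 / 4 : ℝ) + 2) * √(64 * M / m), by positivity,
    fun σ v z hσ h1 h2 => ?_⟩
  have hv : 0 < v := (mul_pos hm hσ).trans_le h1
  have e1 : √√v ≤ (32 * M) ^ (1 / 4 : ℝ) * σ ^ (1 / 4 : ℝ) := by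
    rw [Real.sqrt_eq_rpow, Real.sqrt_eq_rpow, ← Real.rpow_mul hv.le,
      ← Real.mul_rpow (by positivity) hσ.le]
    norm_num
    exact Real.rpow_le_rpow hv.le h2 (by norm_num)
  have e2 : √|σ| = σ ^ (1 / 2 : ℝ) := by rw [abs_of_pos hσ, Real.sqrt_eq_rpow]
  have k1 := sqrt_abs_mul_gk_le hv z
  have k2 := gk_le_two hv z
  have k3 : gk (2 * v) z ≤ √(64 * M / m) * gk (64 * M * σ) z :=
    gk_le_majorant hm hσ (by nlinarith) (by linarith) z
  have hg := gk_nonneg (2 * v) z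
  set A := σ ^ (1 / 4 : ℝ)
  set B := σ ^ (1 / 2 : ℝ)
  have hA : 0 ≤ A := by positivity
  have hB : 0 ≤ B := by positivity
  set N := (32 * M) ^ (1 / 4 : ℝ)
  have hN : 0 ≤ N := by positivity
  rw [e2]
  calc (√|z| + B) * gk v z = √|z| * gk v z + B * gk v z := by ring
    _ ≤ 6 * (N * A) * gk (2 * v) z + B * (2 * gk (2 * v) z) := by
        have k1' : √|z| * gk v z ≤ 6 * (N * A) * gk (2 * v) z := k1.trans (by gcongr)
        have k2' : B * gk v z ≤ B * (2 * gk (2 * v) z) := by gcongr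
        gcongr
    _ = (6 * N * A + 2 * B) * gk (2 * v) z := by ring
    _ ≤ (6 * N + 2) * (A + B) * gk (2 * v) z := by
        refine mul_le_mul_of_nonneg_right ?_ hg
        have : 0 ≤ N * B := by positivity
        nlinarith
    _ ≤ (6 * N + 2) * (A + B) * (√(64 * M / m) * gk (64 * M * σ) z) := by gcongr
    _ = _ := by ring

/-- The Hölder continuity of the coefficient improves the time singularity. -/
lemma exists_coeff_sub_mul_gk_le {m M L : ℝ} (hm : 0 < m) (hmM : m ≤ M) (hL : 0 ≤ L) :
    ∃ C : ℝ, 0 < C ∧ ∀ (a : ℝ × ℝ → ℝ), IsCoeff m M L a → ∀ (p q : ℝ × ℝ) (v : ℝ),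
      0 < p.2 - q.2 → m * (p.2 - q.2) ≤ v → v ≤ 32 * M * (p.2 - q.2) →
      |a p - a q| * gk v (p.1 - q.1)
        ≤ C * ((p.2 - q.2) ^ (1 / 4 : ℝ) + (p.2 - q.2) ^ (1 / 2 : ℝ))
          * gk (64 * M * (p.2 - q.2)) (p.1 - q.1) := by
  obtain ⟨C, hC, hc⟩ := exists_sqrt_mul_gk_le hm hmM
  refine ⟨(L + 1) * C, by positivity, fun a h p q v hσ h1 h2 => ?_⟩
  have hk := hc _ _ (p.1 - q.1) hσ h1 h2
  calc _ ≤ (L + 1) * (√|p.1 - q.1| + √|p.2 - q.2|) * gk v (p.1 - q.1) := by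
        refine mul_le_mul_of_nonneg_right ((h.holder p q).trans ?_) (gk_nonneg _ _)
        gcongr
        linarith
    _ = (L + 1) * ((√|p.1 - q.1| + √|p.2 - q.2|) * gk v (p.1 - q.1)) := by ring
    _ ≤ _ := mul_le_mul_of_nonneg_left hk (by positivity)
    _ = _ := by ring

lemma rpow_le_exp {σ r : ℝ} (hσ : 0 < σ) (hr0 : 0 ≤ r) (hr1 : r ≤ 1) :
    σ ^ r ≤ Real.exp σ := by
  rcases le_total σ 1 with h | h
  · exact (Real.rpow_le_one hσ.le h hr0).trans (Real.one_le_exp hσ.le)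
  · calc σ ^ r ≤ σ ^ (1 : ℝ) := Real.rpow_le_rpow_of_exponent_le h hr1
      _ = σ := Real.rpow_one _
      _ ≤ _ := by linarith [Real.add_one_le_exp σ]

/-- The second derivative is of order σ^(-1), and the Hölder difference of the coefficient gains
σ^(1/4) + σ^(1/2), so the worst term is σ^(-3/4). The other terms are only larger for long lags,
where the factor e^σ in `kw 1` absorbs them; no time horizon is needed. -/
lemma exists_ek_bound {m M L γ : ℝ} (hm : 0 < m) (hmM : m ≤ M) (hL : 0 ≤ L) (hγ : 0 ≤ γ) :
    ∃ C : ℝ, 0 < C ∧ ∀ (a : ℝ × ℝ → ℝ), IsCoeff m M L a → ∀ p q : ℝ × ℝ,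
      ‖ek a γ p q‖ₑ ≤ ENNReal.ofReal C * (kw 1 (p.2 - q.2) * hk (64 * M) p q) := by
  obtain ⟨C₂, hC₂, hb⟩ := exists_gkd_bound 2
  obtain ⟨C₁, hC₁, hc⟩ := exists_coeff_sub_mul_gk_le hm hmM hL
  have hM : 0 < M := hm.trans_le hmM
  refine ⟨C₂ / m * C₁ * 2 + γ * √(64 * M / m), by positivity, fun a h p q => ?_⟩
  rcases le_or_gt p.2 q.2 with hpq | hpq
  · simp [ek_of_le h γ hpq]
  have hσ : 0 < p.2 - q.2 := sub_pos.2 hpq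
  have ha := h.a_pos q
  have h1 := h.le_a q
  have h2 := h.a_le q
  rw [kw_of_pos hσ, hk, ← ENNReal.ofReal_mul (by positivity), ← ENNReal.ofReal_mul (by positivity),
    Real.enorm_eq_ofReal_abs]
  apply ENNReal.ofReal_le_ofReal
  have hc' := hc a h p q (4 * (a q * (p.2 - q.2))) hσ (by nlinarith) (by nlinarith)
  have hb' := hb (a q * (p.2 - q.2)) (p.1 - q.1) (by positivity)
  have h0 : gk (a q * (p.2 - q.2)) (p.1 - q.1)
      ≤ √(64 * M / m) * gk (64 * M * (p.2 - q.2)) (p.1 - q.1) :=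
    gk_le_majorant hm hσ (by nlinarith) (by nlinarith) _
  unfold ek fk
  rw [show gkd 0 (a q * (p.2 - q.2)) (p.1 - q.1) = gk (a q * (p.2 - q.2)) (p.1 - q.1) from rfl]
  set σ := p.2 - q.2
  set z := p.1 - q.1
  set G := gk (64 * M * σ) z
  have hG : 0 ≤ G := gk_nonneg _ _
  have hs : (√(a q * σ))⁻¹ ^ 2 ≤ 1 / m * σ ^ (-1 : ℝ) := by
    rw [inv_pow, Real.sq_sqrt (by positivity), Real.rpow_neg_one, mul_inv, one_div]
    gcongr
  have hexp : (1 : ℝ) ≤ Real.exp (1 * σ) := Real.one_le_exp (by positivity)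
  have r1 : σ ^ (-1 : ℝ) * σ ^ (1 / 4 : ℝ) ≤ σ ^ (-(3 / 4) : ℝ) * Real.exp (1 * σ) := by
    rw [← Real.rpow_add hσ]
    norm_num
    exact le_mul_of_one_le_right (by positivity) (by simpa using hexp)
  have r2 : σ ^ (-1 : ℝ) * σ ^ (1 / 2 : ℝ) ≤ σ ^ (-(3 / 4) : ℝ) * Real.exp (1 * σ) := by
    rw [← Real.rpow_add hσ, show (-1 + 1 / 2 : ℝ) = -(3 / 4) + 1 / 4 by norm_num,
      Real.rpow_add hσ, one_mul]
    gcongr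
    exact rpow_le_exp hσ (by norm_num) (by norm_num)
  have r3 : 1 ≤ σ ^ (-(3 / 4) : ℝ) * Real.exp (1 * σ) := by
    calc (1 : ℝ) = σ ^ (-(3 / 4) : ℝ) * σ ^ (3 / 4 : ℝ) := by
          rw [← Real.rpow_add hσ]; norm_num
      _ ≤ _ := by
          rw [one_mul]; gcongr
          exact rpow_le_exp hσ (by norm_num) (by norm_num)
  set E := σ ^ (-(3 / 4) : ℝ) * Real.exp (1 * σ)
  calc |(a p - a q) * gkd 2 (a q * σ) z - γ * gk (a q * σ) z|
      ≤ |a p - a q| * |gkd 2 (a q * σ) z| + γ * gk (a q * σ) z := by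
        refine (abs_sub _ _).trans ?_
        rw [abs_mul, abs_mul, abs_of_nonneg hγ, abs_of_nonneg (gk_nonneg _ _)]
    _ ≤ |a p - a q| * (C₂ * (1 / m * σ ^ (-1 : ℝ)) * gk (4 * (a q * σ)) z)
        + γ * (√(64 * M / m) * G) := by
        gcongr
        refine hb'.trans ?_
        norm_num
        norm_num at hs
        gcongr
        exact gk_nonneg _ _
    _ = C₂ / m * σ ^ (-1 : ℝ) * (|a p - a q| * gk (4 * (a q * σ)) z)
        + γ * √(64 * M / m) * G * 1 := by ring
    _ ≤ C₂ / m * σ ^ (-1 : ℝ) * (C₁ * (σ ^ (1 / 4 : ℝ) + σ ^ (1 / 2 : ℝ)) * G)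
        + γ * √(64 * M / m) * G * E := by gcongr
    _ = C₂ / m * C₁ * (σ ^ (-1 : ℝ) * σ ^ (1 / 4 : ℝ) + σ ^ (-1 : ℝ) * σ ^ (1 / 2 : ℝ)) * G
        + γ * √(64 * M / m) * G * E := by ring
    _ ≤ C₂ / m * C₁ * (E + E) * G + γ * √(64 * M / m) * G * E := by gcongr
    _ = _ := by ring

/-! ### Composition of space-time kernels -/

section Composition

lemma lintegral_enorm_mul_le {c : ℝ} (hc : 0 < c) {w₁ w₂ : ℝ → ℝ≥0∞} (hw₁ : Measurable w₁)
    (hw₂ : Measurable w₂) (h1 : ∀ s ≤ 0, w₁ s = 0) (h2 : ∀ s ≤ 0, w₂ s = 0)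
    {k₁ k₂ : ℝ × ℝ → ℝ × ℝ → ℝ} {A₁ A₂ : ℝ≥0∞}
    (hk₁ : ∀ p q, ‖k₁ p q‖ₑ ≤ A₁ * (w₁ (p.2 - q.2) * hk c p q))
    (hk₂ : ∀ p q, ‖k₂ p q‖ₑ ≤ A₂ * (w₂ (p.2 - q.2) * hk c p q)) (p q : ℝ × ℝ) :
    ∫⁻ r, ‖k₁ p r‖ₑ * ‖k₂ r q‖ₑ ≤ A₁ * A₂ * (tconv w₁ w₂ (p.2 - q.2) * hk c p q) := by
  calc ∫⁻ r, ‖k₁ p r‖ₑ * ‖k₂ r q‖ₑ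
      ≤ ∫⁻ r : ℝ × ℝ, A₁ * A₂ *
          ((w₁ (p.2 - r.2) * hk c p r) * (w₂ (r.2 - q.2) * hk c r q)) := by
        refine lintegral_mono fun r => (mul_le_mul' (hk₁ p r) (hk₂ r q)).trans (le_of_eq ?_)
        ring
    _ = _ := by
        rw [lintegral_const_mul _ (by fun_prop), lintegral_hk_comp hc hw₁ hw₂ p q h1 h2]

lemma integrable_of_lintegral_enorm_mul {α : Type*} [MeasurableSpace α] {μ : Measure α}
    {f g : α → ℝ} (hf : AEStronglyMeasurable (fun x => f x * g x) μ)
    (h : ∫⁻ x, ‖f x‖ₑ * ‖g x‖ₑ ∂μ < ∞) : Integrable (fun x => f x * g x) μ :=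
  ⟨hf, by simpa [HasFiniteIntegral, enorm_mul] using h⟩

lemma enorm_integral_mul_le {α : Type*} [MeasurableSpace α] {μ : Measure α} (f g : α → ℝ) :
    ‖∫ x, f x * g x ∂μ‖ₑ ≤ ∫⁻ x, ‖f x‖ₑ * ‖g x‖ₑ ∂μ := by
  refine (enorm_integral_le_lintegral_enorm _).trans (le_of_eq ?_)
  simp [enorm_mul]

/-- An integral over space-time as an iterated integral over the support in time. -/
lemma integral_spacetime_interval {f : ℝ × ℝ → ℝ} {τ t : ℝ} (hf : Integrable f)
    (h : ∀ r : ℝ × ℝ, ¬ (τ < r.2 ∧ r.2 < t) → f r = 0) :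
    ∫ s in τ..t, ∫ y, f (y, s) = ∫ r, f r := by
  have hz : ∀ s, ¬ (τ < s ∧ s < t) → ∫ y, f (y, s) = 0 := fun s hs => by
    simp [h (_, s) hs]
  rcases le_or_gt τ t with hle | hlt
  · rw [intervalIntegral.integral_of_le hle, setIntegral_eq_integral_of_forall_compl_eq_zero,
      Measure.volume_eq_prod, integral_prod_symm _ hf]
    intro s hs
    exact hz s fun h' => hs ⟨h'.1, h'.2.le⟩
  · have h0 : ∀ r, f r = 0 := fun r => h r fun h' => by linarith [h'.1, h'.2]
    simp [h0]

end Composition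

/-! ### The Neumann series -/

/-- The iterates of the error kernel under space-time composition. -/
noncomputable def iterK (a : ℝ × ℝ → ℝ) (γ : ℝ) : ℕ → ℝ × ℝ → ℝ × ℝ → ℝ
  | 0 => ek a γ
  | n + 1 => fun p q => ∫ r, ek a γ p r * iterK a γ n r q

/-- The sum of the iterates of the error kernel. -/
noncomputable def densK (a : ℝ × ℝ → ℝ) (γ : ℝ) (p q : ℝ × ℝ) : ℝ := ∑' n, iterK a γ n p q

lemma measurable_comp_kernel {k₁ k₂ : ℝ × ℝ → ℝ × ℝ → ℝ}
    (h₁ : Measurable fun z : (ℝ × ℝ) × (ℝ × ℝ) => k₁ z.1 z.2)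
    (h₂ : Measurable fun z : (ℝ × ℝ) × (ℝ × ℝ) => k₂ z.1 z.2) :
    Measurable fun z : (ℝ × ℝ) × (ℝ × ℝ) => ∫ r, k₁ z.1 r * k₂ r z.2 := by
  have h : Measurable fun w : ((ℝ × ℝ) × (ℝ × ℝ)) × (ℝ × ℝ) => k₁ w.1.1 w.2 * k₂ w.2 w.1.2 :=
    (h₁.comp (by fun_prop : Measurable fun w : ((ℝ × ℝ) × (ℝ × ℝ)) × (ℝ × ℝ) =>
      (w.1.1, w.2))).mul (h₂.comp (by fun_prop : Measurable fun w : ((ℝ × ℝ) × (ℝ × ℝ)) × (ℝ × ℝ) =>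
      (w.2, w.1.2)))
  exact h.stronglyMeasurable.integral_prod_right'.measurable

lemma measurable_iterK {m M L : ℝ} {a : ℝ × ℝ → ℝ} (h : IsCoeff m M L a) (γ : ℝ) (n : ℕ) :
    Measurable fun z : (ℝ × ℝ) × (ℝ × ℝ) => iterK a γ n z.1 z.2 := by
  induction n with
  | zero => exact measurable_ek h γ
  | succ n ih => exact measurable_comp_kernel (measurable_ek h γ) ih

/-- In the weight `kw (1 + ν)` composition with the error kernel is a contraction with factor 1/2.
The second clause bounds the absolute composition; it closes the induction and later permits sum and
integral to be exchanged. -/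
lemma exists_iterK_bound {m M L γ : ℝ} (hm : 0 < m) (hmM : m ≤ M) (hL : 0 ≤ L) (hγ : 0 ≤ γ) :
    ∃ C ν : ℝ, 0 < C ∧ 0 < ν ∧ ∀ (a : ℝ × ℝ → ℝ), IsCoeff m M L a → ∀ (n : ℕ) (p q : ℝ × ℝ),
      ‖iterK a γ n p q‖ₑ
          ≤ ENNReal.ofReal (C * (1 / 2) ^ n) * (kw (1 + ν) (p.2 - q.2) * hk (64 * M) p q) ∧
        ∫⁻ r, ‖ek a γ p r‖ₑ * ‖iterK a γ n r q‖ₑ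
          ≤ ENNReal.ofReal (C * (1 / 2) ^ (n + 1)) *
            (kw (1 + ν) (p.2 - q.2) * hk (64 * M) p q) := by
  obtain ⟨C, hC, hb⟩ := exists_ek_bound hm hmM hL hγ
  have hG := Real.Gamma_pos_of_pos (show (0 : ℝ) < 1 / 4 by norm_num)
  -- With ν = D⁴ the factor C · 8 Γ(1/4) ν^(-1/4) equals 8 C Γ(1/4) / D = 1/2.
  set D : ℝ := 16 * C * Real.Gamma (1 / 4) with hD
  have hD0 : 0 < D := by positivity
  have hM : 0 < 64 * M := by have := hm.trans_le hmM; positivity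
  have hkey : ∀ a : ℝ × ℝ → ℝ, IsCoeff m M L a → ∀ (n : ℕ),
      (∀ p q, ‖iterK a γ n p q‖ₑ ≤ ENNReal.ofReal (C * (1 / 2) ^ n)
        * (kw (1 + D ^ 4) (p.2 - q.2) * hk (64 * M) p q)) →
      ∀ p q, ∫⁻ r, ‖ek a γ p r‖ₑ * ‖iterK a γ n r q‖ₑ
          ≤ ENNReal.ofReal (C * (1 / 2) ^ (n + 1)) *
            (kw (1 + D ^ 4) (p.2 - q.2) * hk (64 * M) p q) := by
    intro a h n ih p q
    refine (lintegral_enorm_mul_le hM (measurable_kw _) (measurable_kw _)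
      (fun _ => kw_of_nonpos) (fun _ => kw_of_nonpos) (hb a h) ih p q).trans ?_
    calc _ ≤ ENNReal.ofReal C * ENNReal.ofReal (C * (1 / 2) ^ n) *
          (ENNReal.ofReal (8 * Real.Gamma (1 / 4) * (D ^ 4) ^ (-(1 / 4) : ℝ)) *
            kw (1 + D ^ 4) (p.2 - q.2) * hk (64 * M) p q) := by
          gcongr
          exact kw_tconv_le (by positivity) _
      _ = ENNReal.ofReal (C * (C * (1 / 2) ^ n) *
            (8 * Real.Gamma (1 / 4) * (D ^ 4) ^ (-(1 / 4) : ℝ))) *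
            (kw (1 + D ^ 4) (p.2 - q.2) * hk (64 * M) p q) := by
          rw [ENNReal.ofReal_mul (p := C * (C * (1 / 2) ^ n)) (by positivity),
            ENNReal.ofReal_mul (p := C) (q := C * (1 / 2) ^ n) (by positivity)]
          ring
      _ = _ := by
          congr 2
          have : (D ^ 4) ^ (-(1 / 4) : ℝ) = D⁻¹ := by
            rw [← Real.rpow_natCast, ← Real.rpow_mul hD0.le, ← Real.rpow_neg_one]
            norm_num
          rw [this, hD]
          field_simp
          ring
  have hit : ∀ a : ℝ × ℝ → ℝ, IsCoeff m M L a → ∀ (n : ℕ), ∀ p q,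
      ‖iterK a γ n p q‖ₑ ≤ ENNReal.ofReal (C * (1 / 2) ^ n)
        * (kw (1 + D ^ 4) (p.2 - q.2) * hk (64 * M) p q) := by
    intro a h n
    induction n with
    | zero =>
      intro p q
      refine (hb a h p q).trans ?_
      rw [pow_zero, mul_one]
      refine mul_le_mul_right (mul_le_mul_left ?_ _) _
      unfold kw
      split_ifs with hσ
      · gcongr
        have : 0 ≤ D ^ 4 := by positivity
        nlinarith
      · exact le_rfl
    | succ n ih =>
      intro p q
      exact (enorm_integral_mul_le _ _).trans (hkey a h n ih p q)
  exact ⟨C, D ^ 4, hC, by positivity, fun a h n p q => ⟨hit a h n p q, hkey a h n (hit a h n) p q⟩⟩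

lemma kw_lt_top (μ σ : ℝ) : kw μ σ < ∞ := by unfold kw; split_ifs <;> simp

lemma summable_iterK {m M L γ : ℝ} (hγ : 0 ≤ γ) {a : ℝ × ℝ → ℝ} (h : IsCoeff m M L a)
    (p q : ℝ × ℝ) : Summable fun n => iterK a γ n p q := by
  obtain ⟨C, ν, hC, hν, hb⟩ := exists_iterK_bound h.m_pos h.m_le_M h.L_nonneg hγ
  set W := kw (1 + ν) (p.2 - q.2) * hk (64 * M) p q
  have hW : W ≠ ∞ := (ENNReal.mul_lt_top (kw_lt_top _ _) (hk_lt_top _ _ _)).ne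
  refine Summable.of_norm_bounded (g := fun n => C * (1 / 2) ^ n * W.toReal)
    (((summable_geometric_two).mul_left C).mul_right _) fun n => ?_
  have := (hb a h n p q).1
  rw [← ofReal_norm] at this
  have h2 := ENNReal.toReal_mono (ENNReal.mul_ne_top ENNReal.ofReal_ne_top hW) this
  rwa [ENNReal.toReal_ofReal (norm_nonneg _), ENNReal.toReal_mul,
    ENNReal.toReal_ofReal (by positivity)] at h2

lemma measurable_densK {m M L γ : ℝ} (hγ : 0 ≤ γ) {a : ℝ × ℝ → ℝ} (h : IsCoeff m M L a) :
    Measurable fun z : (ℝ × ℝ) × (ℝ × ℝ) => densK a γ z.1 z.2 := by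
  refine measurable_of_tendsto_metrizable
    (f := fun n => fun z : (ℝ × ℝ) × (ℝ × ℝ) => ∑ i ∈ Finset.range n, iterK a γ i z.1 z.2)
    (fun n => Finset.measurable_sum _ fun i _ => measurable_iterK h γ i) ?_
  exact tendsto_pi_nhds.2 fun z => (summable_iterK hγ h z.1 z.2).hasSum.tendsto_sum_nat

lemma tsum_half_pow (C : ℝ) (hC : 0 ≤ C) :
    ∑' n : ℕ, ENNReal.ofReal (C * (1 / 2) ^ n) = ENNReal.ofReal (2 * C) := by
  rw [← ENNReal.ofReal_tsum_of_nonneg (fun n => by positivity)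
    ((summable_geometric_two).mul_left C), tsum_mul_left, tsum_geometric_two, mul_comm]

/-- Summation of the geometric series of `exists_iterK_bound`. The second clause is what justifies
integrating the series term by term in the Volterra equation. -/
lemma exists_densK_bound {m M L γ : ℝ} (hm : 0 < m) (hmM : m ≤ M) (hL : 0 ≤ L) (hγ : 0 ≤ γ) :
    ∃ C ν : ℝ, 0 < C ∧ 0 < ν ∧ ∀ (a : ℝ × ℝ → ℝ), IsCoeff m M L a → ∀ (p q : ℝ × ℝ),
      ‖densK a γ p q‖ₑ ≤ ENNReal.ofReal C * (kw (1 + ν) (p.2 - q.2) * hk (64 * M) p q) ∧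
      ∑' n, ∫⁻ r, ‖ek a γ p r‖ₑ * ‖iterK a γ n r q‖ₑ
        ≤ ENNReal.ofReal C * (kw (1 + ν) (p.2 - q.2) * hk (64 * M) p q) := by
  obtain ⟨C, ν, hC, hν, hb⟩ := exists_iterK_bound hm hmM hL hγ
  refine ⟨2 * C, ν, by positivity, hν, fun a h p q => ⟨?_, ?_⟩⟩
  · rw [← tsum_half_pow C hC.le, ← ENNReal.tsum_mul_right]
    refine le_trans ?_ (ENNReal.tsum_le_tsum fun n => (hb a h n p q).1)
    have hs := (summable_iterK hγ h p q)
    refine le_of_tendsto hs.hasSum.tendsto_sum_nat.enorm (Filter.Eventually.of_forall fun n => ?_)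
    exact (enorm_sum_le _ _).trans (ENNReal.sum_le_tsum _)
  · rw [← tsum_half_pow C hC.le, ← ENNReal.tsum_mul_right]
    refine ENNReal.tsum_le_tsum fun n => (hb a h n p q).2.trans ?_
    refine mul_le_mul_left (ENNReal.ofReal_le_ofReal ?_) _
    rw [pow_succ]
    have : 0 ≤ C * (1 / 2) ^ n := by positivity
    linarith

/-- The Volterra equation for the density. -/
lemma densK_eq {m M L γ : ℝ} (hγ : 0 ≤ γ) {a : ℝ × ℝ → ℝ} (h : IsCoeff m M L a)
    (p q : ℝ × ℝ) : densK a γ p q = ek a γ p q + ∫ r, ek a γ p r * densK a γ r q := by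
  obtain ⟨C, ν, hC, hν, hb⟩ := exists_densK_bound h.m_pos h.m_le_M h.L_nonneg hγ
  have h1 : ∫ r, ek a γ p r * densK a γ r q = ∑' n, ∫ r, ek a γ p r * iterK a γ n r q := by
    rw [← integral_tsum]
    · simp only [densK, tsum_mul_left]
    · intro n
      have h1 : Measurable fun r => ek a γ p r :=
        (measurable_ek h γ).comp (by fun_prop : Measurable fun r : ℝ × ℝ => (p, r))
      have h2 : Measurable fun r => iterK a γ n r q :=
        (measurable_iterK h γ n).comp (by fun_prop : Measurable fun r : ℝ × ℝ => (r, q))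
      exact (h1.mul h2).aestronglyMeasurable
    · refine ne_of_lt (lt_of_le_of_lt ?_ (ENNReal.mul_lt_top (a := ENNReal.ofReal C) (by simp)
        (ENNReal.mul_lt_top (kw_lt_top (1 + ν) (p.2 - q.2)) (hk_lt_top (64 * M) p q))))
      simpa [enorm_mul] using (hb a h p q).2
  rw [h1, densK, (summable_iterK hγ h p q).tsum_eq_zero_add]
  rfl

lemma densK_of_le {m M L γ : ℝ} (hγ : 0 ≤ γ) {a : ℝ × ℝ → ℝ} (h : IsCoeff m M L a)
    {p q : ℝ × ℝ} (hpq : p.2 ≤ q.2) : densK a γ p q = 0 := by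
  obtain ⟨C, ν, hC, hν, hb⟩ := exists_densK_bound h.m_pos h.m_le_M h.L_nonneg hγ
  have := (hb a h p q).1
  rw [kw_of_nonpos (by linarith)] at this
  simpa using this

/-! ### The space derivative of potentials -/

lemma IsCoeff.measurable_fk_comp {m M L : ℝ} {a : ℝ × ℝ → ℝ} (h : IsCoeff m M L a) (j : ℕ)
    {α : Type*} [MeasurableSpace α] {f g : α → ℝ × ℝ} (hf : Measurable f) (hg : Measurable g) :
    Measurable fun x => fk a j (f x) (g x) :=
  (measurable_fk h j).comp (hf.prodMk hg)

lemma IsCoeff.measurable_ek_comp {m M L : ℝ} {a : ℝ × ℝ → ℝ} (h : IsCoeff m M L a) (γ : ℝ)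
    {α : Type*} [MeasurableSpace α] {f g : α → ℝ × ℝ} (hf : Measurable f) (hg : Measurable g) :
    Measurable fun x => ek a γ (f x) (g x) :=
  (measurable_ek h γ).comp (hf.prodMk hg)

lemma IsCoeff.measurable_densK_comp {m M L γ : ℝ} {a : ℝ × ℝ → ℝ} (h : IsCoeff m M L a)
    (hγ : 0 ≤ γ) {α : Type*} [MeasurableSpace α] {f g : α → ℝ × ℝ} (hf : Measurable f)
    (hg : Measurable g) : Measurable fun x => densK a γ (f x) (g x) :=
  (measurable_densK hγ h).comp (hf.prodMk hg)

lemma hasDerivAt_fk (a : ℝ × ℝ → ℝ) (j : ℕ) (x t : ℝ) (q : ℝ × ℝ) :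
    HasDerivAt (fun x' => fk a j (x', t) q) (fk a (j + 1) (x, t) q) x :=
  (hasDerivAt_gkd_right j (a q * (t - q.2)) (x - q.1)).comp_sub_const x q.1

lemma exists_abs_fk_le {m M L : ℝ} {a : ℝ × ℝ → ℝ} (h : IsCoeff m M L a) {j : ℕ} (hj : j ≤ 4) :
    ∃ C : ℝ, 0 < C ∧ ∀ p q : ℝ × ℝ, q.2 < p.2 →
      |fk a j p q| ≤ C * (p.2 - q.2) ^ (-(j / 2 : ℝ)) *
        gk (64 * M * (p.2 - q.2)) (p.1 - q.1) := by
  obtain ⟨C, hC, hb⟩ := exists_gkd_le h.m_pos h.m_le_M hj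
  refine ⟨C, hC, fun p q hpq => ?_⟩
  have hσ : 0 < p.2 - q.2 := sub_pos.2 hpq
  refine hb _ _ _ hσ ?_ ?_
  · gcongr; exact h.le_a q
  · have := h.a_le q
    have := h.M_pos
    nlinarith

/-- Differentiation of a frozen-coefficient potential at a fixed earlier time. -/
lemma hasDerivAt_slice {m M L : ℝ} {a : ℝ × ℝ → ℝ} (h : IsCoeff m M L a) {φ : ℝ → ℝ}
    (hφ : Measurable φ) {B : ℝ} (hB : ∀ y, |φ y| ≤ B) {t s : ℝ} (hst : s < t) (x : ℝ) :
    HasDerivAt (fun x' => ∫ y, fk a 0 (x', t) (y, s) * φ y)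
      (∫ y, fk a 1 (x, t) (y, s) * φ y) x := by
  obtain ⟨C₀, hC₀, hb₀⟩ := exists_abs_fk_le h (j := 0) (by norm_num)
  obtain ⟨C₁, hC₁, hb₁⟩ := exists_abs_fk_le h (j := 1) (by norm_num)
  have hσ : 0 < t - s := sub_pos.2 hst
  have hM := h.M_pos
  set v := 64 * M * (t - s) with hv
  have hv0 : 0 < v := by positivity
  have hB0 : 0 ≤ B := (abs_nonneg _).trans (hB 0)
  have hmeas : ∀ j x', AEStronglyMeasurable (fun y => fk a j (x', t) (y, s) * φ y) volume :=
    fun j x' => ((h.measurable_fk_comp j measurable_const (by fun_prop)).mul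
      hφ).aestronglyMeasurable
  refine (hasDerivAt_integral_of_dominated_loc_of_deriv_le
    -- The radius √v is the largest for which `gk_shift_le` dominates all the translates at once by
    -- a Gaussian centred at x.
    (s := Metric.ball x (√v)) (Metric.ball_mem_nhds x (Real.sqrt_pos.2 hv0))
    (F := fun x' y => fk a 0 (x', t) (y, s) * φ y)
    (F' := fun x' y => fk a 1 (x', t) (y, s) * φ y)
    (bound := fun y => C₁ * (t - s) ^ (-((1 : ℕ) / 2 : ℝ)) * (4 * gk (2 * v) (x - y)) * B)
    (Filter.Eventually.of_forall (hmeas 0)) ?_ (hmeas 1 x) ?_ ?_ ?_).2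
  · refine Integrable.mono'
      (g := fun y => C₀ * (t - s) ^ (-((0 : ℕ) / 2 : ℝ)) * gk v (x - y) * B) ?_ (hmeas 0 x)
      (Filter.Eventually.of_forall fun y => ?_)
    · exact (((integrable_gk v).comp_sub_left x).const_mul _).mul_const _
    · rw [Real.norm_eq_abs, abs_mul]
      exact mul_le_mul (hb₀ (x, t) (y, s) hst) (hB y) (abs_nonneg _)
        (mul_nonneg (by positivity) (gk_nonneg _ _))
  · refine Filter.Eventually.of_forall fun y x' hx' => ?_
    rw [Real.norm_eq_abs, abs_mul]
    have h1 := hb₁ (x', t) (y, s) hst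
    have h2 : gk v (x' - y) ≤ 4 * gk (2 * v) (x - y) := by
      apply gk_shift_le hv0
      rw [show x' - y - (x - y) = x' - x by ring]
      rw [Metric.mem_ball, Real.dist_eq] at hx'
      have := Real.sq_sqrt hv0.le
      rw [← this, ← sq_abs]
      gcongr
    have := gk_nonneg (2 * v) (x - y)
    refine mul_le_mul (h1.trans ?_) (hB y) (abs_nonneg _) (by positivity)
    gcongr
  · exact ((((integrable_gk (2 * v)).comp_sub_left x).const_mul 4).const_mul _).mul_const _
  · exact Filter.Eventually.of_forall fun y x' _ => (hasDerivAt_fk a 0 x' t (y, s)).mul_const _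

/-- The measure-theoretic size of a potential in terms of Gaussian averages of the density. -/
lemma lintegral_fk_mul_le {m M L : ℝ} {a : ℝ × ℝ → ℝ} (h : IsCoeff m M L a) (j : ℕ)
    {C : ℝ}
    (hb : ∀ p q : ℝ × ℝ, ‖fk a j p q‖ₑ ≤
      ENNReal.ofReal C * (tw (j / 2) (p.2 - q.2) * hk (64 * M) p q))
    {ψ : ℝ × ℝ → ℝ} (hψ : Measurable ψ) (p : ℝ × ℝ) {N : ℝ → ℝ≥0∞}
    (hN : ∀ s < p.2, ∫⁻ y, hk (64 * M) p (y, s) * ‖ψ (y, s)‖ₑ ≤ N s) (s : ℝ) :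
    ∫⁻ y, ‖fk a j p (y, s)‖ₑ * ‖ψ (y, s)‖ₑ ≤ ENNReal.ofReal C * (tw (j / 2) (p.2 - s) * N s) := by
  rcases le_or_gt p.2 s with hs | hs
  · simp [fk_of_le h j (show p.2 ≤ (_, s).2 from hs)]
  calc ∫⁻ y, ‖fk a j p (y, s)‖ₑ * ‖ψ (y, s)‖ₑ
      ≤ ∫⁻ y, ENNReal.ofReal C * tw (j / 2) (p.2 - s) *
          (hk (64 * M) p (y, s) * ‖ψ (y, s)‖ₑ) := by
        refine lintegral_mono fun y => (mul_le_mul_left (hb p (y, s)) _).trans (le_of_eq ?_)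
        ring
    _ = ENNReal.ofReal C * tw (j / 2) (p.2 - s) *
          ∫⁻ y, hk (64 * M) p (y, s) * ‖ψ (y, s)‖ₑ := lintegral_const_mul _ (by fun_prop)
    _ ≤ ENNReal.ofReal C * tw (j / 2) (p.2 - s) * N s := by gcongr; exact hN s hs
    _ = _ := mul_assoc _ _ _

/-- The derivative is taken under the integral in two stages: in y at fixed s, where mere
boundedness of the slice suffices, then in s, where `N` must dominate uniformly in x'. One space
derivative costs the integrable factor σ^(-1/2). -/
lemma hasDerivAt_potential {m M L : ℝ} {a : ℝ × ℝ → ℝ} (h : IsCoeff m M L a) {ψ : ℝ × ℝ → ℝ}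
    (hψ : Measurable ψ) {t : ℝ} (hB : ∀ s < t, ∃ B, ∀ y, |ψ (y, s)| ≤ B) {N : ℝ → ℝ≥0∞}
    (hNm : Measurable N)
    (hN : ∀ s < t, ∀ x, ∫⁻ y, hk (64 * M) (x, t) (y, s) * ‖ψ (y, s)‖ₑ ≤ N s)
    (hN0 : ∫⁻ s, tw 0 (t - s) * N s < ∞) (hN1 : ∫⁻ s, tw (1 / 2) (t - s) * N s < ∞) (x : ℝ) :
    (∀ x', Integrable fun r => fk a 0 (x', t) r * ψ r) ∧
    (Integrable fun r => fk a 1 (x, t) r * ψ r) ∧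
    HasDerivAt (fun x' => ∫ r, fk a 0 (x', t) r * ψ r) (∫ r, fk a 1 (x, t) r * ψ r) x := by
  obtain ⟨C₀, hC₀, hb₀⟩ := exists_fk_bound h.m_pos h.m_le_M (j := 0) (by norm_num)
  obtain ⟨C₁, hC₁, hb₁⟩ := exists_fk_bound h.m_pos h.m_le_M (j := 1) (by norm_num)
  have hb0 := lintegral_fk_mul_le h 0 (hb₀ L a h) hψ
  have hb1 := lintegral_fk_mul_le h 1 (hb₁ L a h) hψ
  have e0 : ((0 : ℕ) / 2 : ℝ) = 0 := by norm_num
  have e1 : ((1 : ℕ) / 2 : ℝ) = 1 / 2 := by norm_num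
  rw [e0] at hb0
  rw [e1] at hb1
  have hm : ∀ j x', Measurable fun r => fk a j (x', t) r * ψ r := fun j x' =>
    (h.measurable_fk_comp j measurable_const measurable_id).mul hψ
  have hm' : ∀ j x', Measurable fun r => ‖fk a j (x', t) r‖ₑ * ‖ψ r‖ₑ := fun j x' =>
    (h.measurable_fk_comp j measurable_const measurable_id).enorm.mul hψ.enorm
  have i0 : ∀ x', Integrable fun r => fk a 0 (x', t) r * ψ r := fun x' => by
    refine integrable_of_lintegral_enorm_mul (hm 0 x').aestronglyMeasurable ?_
    rw [lintegral_spacetime (hm' 0 x')]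
    refine (lintegral_mono fun s => hb0 (x', t) (fun s hs => hN s hs x') s).trans_lt ?_
    rw [lintegral_const_mul _ (by fun_prop)]
    exact ENNReal.mul_lt_top ENNReal.ofReal_lt_top hN0
  have i1 : ∀ x', Integrable fun r => fk a 1 (x', t) r * ψ r := fun x' => by
    refine integrable_of_lintegral_enorm_mul (hm 1 x').aestronglyMeasurable ?_
    rw [lintegral_spacetime (hm' 1 x')]
    refine (lintegral_mono fun s => hb1 (x', t) (fun s hs => hN s hs x') s).trans_lt ?_
    rw [lintegral_const_mul _ (by fun_prop)]
    exact ENNReal.mul_lt_top ENNReal.ofReal_lt_top hN1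
  refine ⟨i0, i1 x, ?_⟩
  have k0 : ∀ x', ∫ r, fk a 0 (x', t) r * ψ r = ∫ s, ∫ y, fk a 0 (x', t) (y, s) * ψ (y, s) :=
    fun x' => by rw [Measure.volume_eq_prod, integral_prod_symm _ (i0 x')]
  have k1 : ∫ r, fk a 1 (x, t) r * ψ r = ∫ s, ∫ y, fk a 1 (x, t) (y, s) * ψ (y, s) := by
    rw [Measure.volume_eq_prod, integral_prod_symm _ (i1 x)]
  simp_rw [k0, k1]
  set W : ℝ → ℝ≥0∞ := fun s => ENNReal.ofReal C₁ * (tw (1 / 2) (t - s) * N s) with hW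
  have hWm : Measurable W := by fun_prop
  have hWt : ∫⁻ s, W s ≠ ∞ := by
    rw [hW, lintegral_const_mul _ (by fun_prop)]
    exact (ENNReal.mul_lt_top ENNReal.ofReal_lt_top hN1).ne
  refine (hasDerivAt_integral_of_dominated_loc_of_deriv_le (s := univ) Filter.univ_mem
    (bound := fun s => (W s).toReal)
    (F := fun x' s => ∫ y, fk a 0 (x', t) (y, s) * ψ (y, s))
    (F' := fun x' s => ∫ y, fk a 1 (x', t) (y, s) * ψ (y, s))
    (Filter.Eventually.of_forall fun x' => ?_) ?_ ?_ ?_ ?_ ?_).2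
  · exact (hm 0 x').stronglyMeasurable.integral_prod_left'.aestronglyMeasurable
  · exact (i0 x).integral_prod_right
  · exact (hm 1 x).stronglyMeasurable.integral_prod_left'.aestronglyMeasurable
  · filter_upwards [ae_lt_top hWm hWt] with s hs x' _
    have h1 := (enorm_integral_mul_le (μ := volume) (fun y => fk a 1 (x', t) (y, s))
      (fun y => ψ (y, s))).trans (hb1 (x', t) (fun s hs => hN s hs x') s)
    rw [← ofReal_norm] at h1
    exact (ENNReal.ofReal_le_iff_le_toReal hs.ne).1 h1
  · exact integrable_toReal_of_lintegral_ne_top hWm.aemeasurable hWt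
  · refine Filter.Eventually.of_forall fun s x' _ => ?_
    rcases lt_or_ge s t with hst | hst
    · obtain ⟨B, hB'⟩ := hB s hst
      exact hasDerivAt_slice h (hψ.comp (by fun_prop)) hB' hst x'
    · have z0 : ∀ j x' y, fk a j (x', t) (y, s) = 0 := fun j x' y => fk_of_le h j hst
      simp only [z0, zero_mul, integral_zero]
      exact hasDerivAt_const _ _

/-! ### The fundamental solution and its space derivative -/

/-- The fundamental solution in space-time notation. -/
noncomputable def solK (a : ℝ × ℝ → ℝ) (γ : ℝ) (p q : ℝ × ℝ) : ℝ :=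
  fk a 0 p q + ∫ r, fk a 0 p r * densK a γ r q

/-- The space derivative of the fundamental solution. -/
noncomputable def solX (a : ℝ × ℝ → ℝ) (γ : ℝ) (p q : ℝ × ℝ) : ℝ :=
  fk a 1 p q + ∫ r, fk a 1 p r * densK a γ r q

lemma measurable_solX {m M L γ : ℝ} {a : ℝ × ℝ → ℝ} (h : IsCoeff m M L a) (hγ : 0 ≤ γ) :
    Measurable fun z : (ℝ × ℝ) × (ℝ × ℝ) => solX a γ z.1 z.2 :=
  (measurable_fk h 1).add (measurable_comp_kernel (measurable_fk h 1) (measurable_densK hγ h))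

lemma tconv_kw_sub (w : ℝ → ℝ≥0∞) (μ t τ : ℝ) :
    ∫⁻ s, w (t - s) * kw μ (s - τ) = tconv w (kw μ) (t - τ) := by
  rw [tconv, ← lintegral_sub_right_eq_self (fun s => w (t - τ - s) * kw μ s) τ]
  simp only [sub_sub_sub_cancel_right]

/-- Composition with the density weakens a time singularity by a quarter power, since its own
exponent 3/4 is below 1. -/
lemma exists_tconv_kw_le {b ν T : ℝ} (hb : 0 ≤ b) (hb1 : b < 1) (hν : 0 ≤ ν) :
    ∃ C : ℝ, 0 < C ∧ ∀ σ ≤ T, tconv (tw b) (kw ν) σ ≤ ENNReal.ofReal C * tw (b - 1 / 4) σ := by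
  obtain ⟨C, hC, hc⟩ := tw_tconv_le (a := b) (b := 3 / 4) hb hb1 (by norm_num) (by norm_num)
  refine ⟨Real.exp (ν * T) * C, by positivity, fun σ hσ => ?_⟩
  have hle : tconv (tw b) (kw ν) σ
      ≤ tconv (fun s => 1 * tw b s) (fun s => ENNReal.ofReal (Real.exp (ν * T)) * tw (3 / 4) s) σ := by
    refine lintegral_mono fun s => ?_
    rcases le_or_gt (σ - s) 0 with h1 | h1
    · simp [tw_of_nonpos h1]
    · dsimp only
      rw [one_mul]
      exact mul_le_mul_right (kw_le_tw hν (by linarith)) _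
  refine hle.trans ?_
  rw [tconv_const_mul (measurable_tw _) (measurable_tw _), one_mul, ENNReal.ofReal_mul
    (Real.exp_pos _).le, mul_assoc]
  refine mul_le_mul_right ((hc σ).trans (le_of_eq ?_)) _
  ring_nf

lemma hasDerivAt_solK {m M L γ : ℝ} {a : ℝ × ℝ → ℝ} (h : IsCoeff m M L a) (hγ : 0 ≤ γ)
    (t : ℝ) (q : ℝ × ℝ) (x : ℝ) :
    HasDerivAt (fun x' => solK a γ (x', t) q) (solX a γ (x, t) q) x ∧
      ∀ x', Integrable fun r => fk a 0 (x', t) r * densK a γ r q := by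
  obtain ⟨C, ν, hC, hν, hb⟩ := exists_densK_bound h.m_pos h.m_le_M h.L_nonneg hγ
  have hM := h.M_pos
  have hψ : Measurable fun r => densK a γ r q :=
    h.measurable_densK_comp hγ measurable_id measurable_const
  have hd : ∀ r, ‖densK a γ r q‖ₑ ≤
      ENNReal.ofReal C * (kw (1 + ν) (r.2 - q.2) * hk (64 * M) r q) := fun r => (hb a h r q).1
  -- By the semigroup property the Gaussian average over the intermediate slice at time s is a
  -- Gaussian of the total lag t - q.2. Its supremum `D` depends neither on s nor on x', so only the
  -- integrable time weights remain.
  set D : ℝ≥0∞ := ENNReal.ofReal (1 / √(64 * M * (t - q.2)))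
  have hfin : ∀ b : ℝ, 0 ≤ b → b < 1 →
      ∫⁻ s, tw b (t - s) * (ENNReal.ofReal C * kw (1 + ν) (s - q.2) * D) < ∞ := by
    intro b hb hb1
    obtain ⟨C', hC', hc⟩ := exists_tconv_kw_le (T := t - q.2) hb hb1 (by linarith : 0 ≤ 1 + ν)
    calc ∫⁻ s, tw b (t - s) * (ENNReal.ofReal C * kw (1 + ν) (s - q.2) * D)
        = ENNReal.ofReal C * D * ∫⁻ s, tw b (t - s) * kw (1 + ν) (s - q.2) := by
          rw [← lintegral_const_mul _ (by fun_prop)]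
          congr 1; funext s; ring
      _ < ∞ := by
          rw [tconv_kw_sub]
          refine ENNReal.mul_lt_top (ENNReal.mul_lt_top ENNReal.ofReal_lt_top
            ENNReal.ofReal_lt_top) ((hc _ le_rfl).trans_lt
            (ENNReal.mul_lt_top ENNReal.ofReal_lt_top (tw_lt_top _ _)))
  have key := hasDerivAt_potential h hψ (t := t)
    (N := fun s => ENNReal.ofReal C * kw (1 + ν) (s - q.2) * D) ?_ (by fun_prop) ?_
    (hfin 0 le_rfl one_pos) (hfin (1 / 2) (by norm_num) (by norm_num)) x
  · exact ⟨(hasDerivAt_fk a 0 x t q).add key.2.2, key.1⟩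
  · intro s _
    rcases le_or_gt s q.2 with hs | hs
    · exact ⟨0, fun y => by rw [densK_of_le hγ h hs, abs_zero]⟩
    · have hsq : 0 < s - q.2 := sub_pos.2 hs
      set E := ENNReal.ofReal C * (kw (1 + ν) (s - q.2) *
        ENNReal.ofReal (1 / √(64 * M * (s - q.2))))
      have hE : E ≠ ∞ := (ENNReal.mul_lt_top ENNReal.ofReal_lt_top
        (ENNReal.mul_lt_top (kw_lt_top _ _) ENNReal.ofReal_lt_top)).ne
      refine ⟨E.toReal, fun y => ?_⟩
      rw [← Real.norm_eq_abs]
      refine (ENNReal.ofReal_le_iff_le_toReal hE).1 ?_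
      rw [ofReal_norm]
      exact (hd (y, s)).trans (mul_le_mul_right (mul_le_mul_right
        (ENNReal.ofReal_le_ofReal (gk_le_sup (by positivity) _)) _) _)
  · intro s hs x'
    calc ∫⁻ y, hk (64 * M) (x', t) (y, s) * ‖densK a γ (y, s) q‖ₑ
        ≤ ∫⁻ y, ENNReal.ofReal C * kw (1 + ν) (s - q.2) *
          (hk (64 * M) (x', t) (y, s) * hk (64 * M) (y, s) q) := by
          refine lintegral_mono fun y => (mul_le_mul_right (hd (y, s)) _).trans (le_of_eq ?_)
          ring
      _ = ENNReal.ofReal C * kw (1 + ν) (s - q.2) *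
          ∫⁻ y, hk (64 * M) (x', t) (y, s) * hk (64 * M) (y, s) q :=
          lintegral_const_mul _ (by fun_prop)
      _ ≤ _ := by
          rcases le_or_gt s q.2 with hsq | hsq
          · simp [kw_of_nonpos (sub_nonpos.2 hsq)]
          · gcongr
            have h1 : 0 < t - s := sub_pos.2 hs
            have h2 : 0 < s - q.2 := sub_pos.2 hsq
            have h3 : 0 < t - q.2 := by linarith
            simp only [hk]
            rw [lintegral_gk_mul_gk (by positivity) (by positivity)]
            refine (ENNReal.ofReal_le_ofReal (gk_le_sup (by positivity) _)).trans (le_of_eq ?_)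
            congr 3
            ring

/-- The correction term has the weaker singularity σ^(-1/4), which a power of the horizon raises to
the σ^(-1/2) of the leading term. The second clause is the absolute convergence used for Fubini in
`integral_solX_mul`. -/
lemma exists_solX_bound {m M L γ : ℝ} (hm : 0 < m) (hmM : m ≤ M) (hL : 0 ≤ L) (hγ : 0 ≤ γ)
    {T : ℝ} (hT : 0 < T) :
    ∃ C : ℝ, 0 < C ∧ ∀ (a : ℝ × ℝ → ℝ), IsCoeff m M L a → ∀ (p q : ℝ × ℝ), p.2 - q.2 ≤ T →
      ‖solX a γ p q‖ₑ ≤ ENNReal.ofReal C * (tw (1 / 2) (p.2 - q.2) * hk (64 * M) p q) ∧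
      ∫⁻ r, ‖fk a 1 p r‖ₑ * ‖densK a γ r q‖ₑ
        ≤ ENNReal.ofReal C * (tw (1 / 2) (p.2 - q.2) * hk (64 * M) p q) := by
  obtain ⟨C, ν, hC, hν, hb⟩ := exists_densK_bound hm hmM hL hγ
  obtain ⟨C₁, hC₁, hb₁⟩ := exists_fk_bound hm hmM (j := 1) (by norm_num)
  obtain ⟨C₂, hC₂, hc⟩ := exists_tconv_kw_le (b := 1 / 2) (ν := 1 + ν) (T := T) (by norm_num)
    (by norm_num) (by linarith)
  have hM : 0 < M := hm.trans_le hmM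
  refine ⟨C₁ + C₁ * C * C₂ * T ^ (1 / 4 : ℝ), by positivity, fun a h p q hpq => ?_⟩
  have e1 : ((1 : ℕ) / 2 : ℝ) = 1 / 2 := by norm_num
  rw [e1] at hb₁
  have key : ∫⁻ r, ‖fk a 1 p r‖ₑ * ‖densK a γ r q‖ₑ
      ≤ ENNReal.ofReal (C₁ * C * C₂ * T ^ (1 / 4 : ℝ)) *
        (tw (1 / 2) (p.2 - q.2) * hk (64 * M) p q) := by
    refine (lintegral_enorm_mul_le (c := 64 * M) (by positivity) (measurable_tw _)
      (measurable_kw _) (fun _ => tw_of_nonpos) (fun _ => kw_of_nonpos) (hb₁ L a h)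
      (fun p q => (hb a h p q).1) p q).trans ?_
    have h1 : tw (1 / 2 - 1 / 4) (p.2 - q.2)
        ≤ ENNReal.ofReal (T ^ (1 / 4 : ℝ)) * tw (1 / 2) (p.2 - q.2) := by
      refine (tw_le_tw (ρ' := 1 / 2) (by norm_num) hpq).trans (le_of_eq ?_)
      norm_num
    calc _ ≤ ENNReal.ofReal C₁ * ENNReal.ofReal C * (ENNReal.ofReal C₂ *
          (ENNReal.ofReal (T ^ (1 / 4 : ℝ)) * tw (1 / 2) (p.2 - q.2)) * hk (64 * M) p q) := by
          gcongr
          exact (hc _ hpq).trans (mul_le_mul_right h1 _)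
      _ = _ := by
          rw [ENNReal.ofReal_mul (by positivity), ENNReal.ofReal_mul (by positivity),
            ENNReal.ofReal_mul (by positivity)]
          ring
  constructor
  · refine (enorm_add_le _ _).trans ?_
    rw [ENNReal.ofReal_add (by positivity) (by positivity), add_mul]
    exact add_le_add (hb₁ L a h p q) ((enorm_integral_mul_le _ _).trans key)
  · refine key.trans ?_
    gcongr
    linarith

/-! ### Fubini for compositions -/

lemma integral_comp_swap {α β : Type*} [MeasurableSpace α] [MeasurableSpace β] {μ : Measure α}
    {ν : Measure β} [SFinite μ] [SFinite ν] {k₁ : α → ℝ} {k₂ : α → β → ℝ} {F : β → ℝ}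
    (hk₁ : Measurable k₁) (hk₂ : Measurable fun z : α × β => k₂ z.1 z.2) (hF : Measurable F)
    (hfin : ∫⁻ q, (∫⁻ r, ‖k₁ r‖ₑ * ‖k₂ r q‖ₑ ∂μ) * ‖F q‖ₑ ∂ν < ∞) :
    Integrable (fun q => (∫ r, k₁ r * k₂ r q ∂μ) * F q) ν ∧
    Integrable (fun r => k₁ r * ∫ q, k₂ r q * F q ∂ν) μ ∧
    ∫ q, (∫ r, k₁ r * k₂ r q ∂μ) * F q ∂ν = ∫ r, k₁ r * ∫ q, k₂ r q * F q ∂ν ∂μ := by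
  have hm : Measurable fun z : α × β => k₁ z.1 * k₂ z.1 z.2 * F z.2 :=
    ((hk₁.comp measurable_fst).mul hk₂).mul (hF.comp measurable_snd)
  have hint : Integrable (fun z : α × β => k₁ z.1 * k₂ z.1 z.2 * F z.2) (μ.prod ν) := by
    refine ⟨hm.aestronglyMeasurable, ?_⟩
    rw [HasFiniteIntegral, lintegral_prod_symm' _ hm.enorm]
    refine lt_of_le_of_lt (le_of_eq ?_) hfin
    congr 1; funext q
    have : Measurable fun r => ‖k₁ r‖ₑ * ‖k₂ r q‖ₑ :=
      hk₁.enorm.mul (hk₂.comp (by fun_prop : Measurable fun r => (r, q))).enorm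
    rw [← lintegral_mul_const _ this]
    simp [enorm_mul]
  have e1 : ∀ q, (∫ r, k₁ r * k₂ r q ∂μ) * F q = ∫ r, k₁ r * k₂ r q * F q ∂μ := fun q => by
    rw [integral_mul_const]
  have e2 : ∀ r, k₁ r * ∫ q, k₂ r q * F q ∂ν = ∫ q, k₁ r * k₂ r q * F q ∂ν := fun r => by
    rw [← integral_const_mul]; simp only [mul_assoc]
  simp_rw [e1, e2]
  exact ⟨hint.integral_prod_right, hint.integral_prod_left, (integral_integral_swap hint).symm⟩

/-! ### Differences of frozen kernels -/

lemma enorm_sub_le_lintegral_deriv {f f' : ℝ → ℝ} {x y : ℝ} (hxy : x ≤ y)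
    (hf : ∀ z ∈ Icc x y, HasDerivAt f (f' z) z) (hc : ContinuousOn f' (Icc x y)) :
    ‖f y - f x‖ₑ ≤ ∫⁻ z in Ioc x y, ‖f' z‖ₑ := by
  rw [← uIcc_of_le hxy] at hf hc
  rw [← intervalIntegral.integral_eq_sub_of_hasDerivAt hf hc.intervalIntegrable,
    intervalIntegral.integral_of_le hxy]
  exact enorm_integral_le_lintegral_enorm _

/-- The fundamental theorem of calculus followed by Tonelli. The weight `φ` is kept because in the
estimates for sources only averages of the density against kernels are controlled, not its values.
-/
lemma lintegral_fk_sub_space_le {m M L : ℝ} {a : ℝ × ℝ → ℝ} (h : IsCoeff m M L a) (j : ℕ)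
    {t s x x' : ℝ} {φ : ℝ → ℝ≥0∞} (hφ : Measurable φ) {N : ℝ≥0∞}
    (hN : ∀ z, ∫⁻ y, ‖fk a (j + 1) (z, t) (y, s)‖ₑ * φ y ≤ N) :
    ∫⁻ y, ‖fk a j (x, t) (y, s) - fk a j (x', t) (y, s)‖ₑ * φ y
      ≤ ENNReal.ofReal |x - x'| * N := by
  wlog hxx : x' ≤ x generalizing x x'
  · have := this (x := x') (x' := x) (le_of_not_ge hxx)
    rw [abs_sub_comm]
    refine le_trans (le_of_eq ?_) this
    congr 1; funext y
    rw [← enorm_neg, neg_sub]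
  have hmeas : Measurable fun w : ℝ × ℝ => ‖fk a (j + 1) (w.2, t) (w.1, s)‖ₑ :=
    (h.measurable_fk_comp _ (by fun_prop) (by fun_prop)).enorm
  calc _ ≤ ∫⁻ y, ∫⁻ z in Ioc x' x, ‖fk a (j + 1) (z, t) (y, s)‖ₑ * φ y := by
        refine lintegral_mono fun y => ?_
        have hsl : Measurable fun z => ‖fk a (j + 1) (z, t) (y, s)‖ₑ :=
          (h.measurable_fk_comp _ (by fun_prop) (by fun_prop)).enorm
        rw [lintegral_mul_const _ hsl]
        gcongr
        refine enorm_sub_le_lintegral_deriv hxx (f := fun z => fk a j (z, t) (y, s))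
          (fun z _ => hasDerivAt_fk a j z t (y, s)) ?_
        exact fun z _ => (hasDerivAt_fk a (j + 1) z t (y, s)).continuousAt.continuousWithinAt
    _ = ∫⁻ z in Ioc x' x, ∫⁻ y, ‖fk a (j + 1) (z, t) (y, s)‖ₑ * φ y := by
        rw [lintegral_lintegral_swap]
        exact (hmeas.mul (hφ.comp measurable_fst)).aemeasurable
    _ ≤ ∫⁻ z in Ioc x' x, N := lintegral_mono fun z => hN z
    _ = _ := by
        rw [setLIntegral_const, Real.volume_Ioc, abs_of_nonneg (sub_nonneg.2 hxx), mul_comm]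

lemma hasDerivAt_fk_time {m M L : ℝ} {a : ℝ × ℝ → ℝ} (h : IsCoeff m M L a) (j : ℕ)
    {x t : ℝ} {q : ℝ × ℝ} (hq : q.2 < t) :
    HasDerivAt (fun t' => fk a j (x, t') q) (a q * fk a (j + 2) (x, t) q) t := by
  have hv : 0 < a q * (t - q.2) := mul_pos (h.a_pos q) (sub_pos.2 hq)
  have h1 : HasDerivAt (fun t' : ℝ => a q * (t' - q.2)) (a q) t := by
    simpa using ((hasDerivAt_id t).sub_const q.2).const_mul (a q)
  have h2 := (hasDerivAt_gkd_left j hv (x - q.1)).comp t h1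
  rw [mul_comm]
  exact h2

/-- The frozen kernel solves a heat equation, so its time derivative is the frozen coefficient times
two space derivatives. -/
lemma lintegral_fk_sub_time_le {m M L : ℝ} {a : ℝ × ℝ → ℝ} (h : IsCoeff m M L a) (j : ℕ)
    {t t' s x : ℝ} (hs : s < t') (ht : t' ≤ t) {φ : ℝ → ℝ≥0∞} (hφ : Measurable φ) :
    ∫⁻ y, ‖fk a j (x, t) (y, s) - fk a j (x, t') (y, s)‖ₑ * φ y
      ≤ ENNReal.ofReal M *
        ∫⁻ r in Ioc t' t, ∫⁻ y, ‖fk a (j + 2) (x, r) (y, s)‖ₑ * φ y := by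
  have hmeas : Measurable fun w : ℝ × ℝ => ‖fk a (j + 2) (x, w.2) (w.1, s)‖ₑ :=
    (h.measurable_fk_comp _ (by fun_prop) (by fun_prop)).enorm
  calc _ ≤ ∫⁻ y, ∫⁻ r in Ioc t' t,
        ENNReal.ofReal M * (‖fk a (j + 2) (x, r) (y, s)‖ₑ * φ y) := by
        refine lintegral_mono fun y => ?_
        have hsl : Measurable fun r => ‖fk a (j + 2) (x, r) (y, s)‖ₑ :=
          (h.measurable_fk_comp _ (by fun_prop) (by fun_prop)).enorm
        simp_rw [← mul_assoc]
        rw [lintegral_mul_const _ (by fun_prop)]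
        gcongr
        refine (enorm_sub_le_lintegral_deriv ht (f := fun r => fk a j (x, r) (y, s))
          (fun r hr => hasDerivAt_fk_time h j (hs.trans_le hr.1)) ?_).trans ?_
        · intro r hr
          exact ((hasDerivAt_fk_time h (j + 2)
            (hs.trans_le hr.1)).continuousAt.const_mul _).continuousWithinAt
        · refine lintegral_mono fun r => ?_
          dsimp only
          rw [enorm_mul, Real.enorm_eq_ofReal (h.a_pos _).le]
          gcongr
          exact h.a_le _
    _ = ∫⁻ r in Ioc t' t, ∫⁻ y,
        ENNReal.ofReal M * (‖fk a (j + 2) (x, r) (y, s)‖ₑ * φ y) := by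
        rw [lintegral_lintegral_swap]
        exact (measurable_const.mul (hmeas.mul (hφ.comp measurable_fst))).aemeasurable
    _ = _ := by
        rw [← lintegral_const_mul]
        · congr 1; funext r
          rw [lintegral_const_mul]
          exact (h.measurable_fk_comp _ (by fun_prop) (by fun_prop)).enorm.mul hφ
        · exact (hmeas.mul (hφ.comp measurable_fst)).lintegral_prod_left'

/-- Gaussian averages of a function at a fixed time control its frozen-kernel potentials. -/
lemma lintegral_fk_slice_le {M : ℝ} {a : ℝ × ℝ → ℝ} (j : ℕ) {C : ℝ}
    (hb : ∀ p q : ℝ × ℝ, ‖fk a j p q‖ₑ ≤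
      ENNReal.ofReal C * (tw (j / 2) (p.2 - q.2) * hk (64 * M) p q))
    {φ : ℝ → ℝ≥0∞} (hφ : Measurable φ) (p : ℝ × ℝ) (s : ℝ) :
    ∫⁻ y, ‖fk a j p (y, s)‖ₑ * φ y
      ≤ ENNReal.ofReal C * (tw (j / 2) (p.2 - s) * ∫⁻ y, hk (64 * M) p (y, s) * φ y) := by
  rw [← mul_assoc, ← lintegral_const_mul _ (by fun_prop)]
  refine lintegral_mono fun y => (mul_le_mul_left (hb p (y, s)) _).trans (le_of_eq ?_)
  ring

lemma lintegral_hk_slice {c : ℝ} (hc : 0 < c) {p : ℝ × ℝ} {s : ℝ} (hs : s < p.2) :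
    ∫⁻ y, hk c p (y, s) = 1 :=
  lintegral_gk_sub (mul_pos hc (sub_pos.2 hs)) p.1

/-- Space-time integrals against a weighted Gaussian majorant of a function of time. -/
lemma lintegral_weight_hk {c : ℝ} (hc : 0 < c) {w G : ℝ → ℝ≥0∞} (hw : Measurable w)
    (hG : Measurable G) (p : ℝ × ℝ) :
    ∫⁻ r : ℝ × ℝ, (w (p.2 - r.2) * hk c p r) * G r.2 = ∫⁻ s in Iio p.2, w (p.2 - s) * G s := by
  rw [lintegral_spacetime (by fun_prop), ← lintegral_indicator measurableSet_Iio]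
  congr 1; funext s
  by_cases hs : s < p.2
  · simp only [indicator, mem_Iio, hs, if_true]
    calc _ = ∫⁻ y, w (p.2 - s) * G s * hk c p (y, s) := by congr 1; funext y; ring
      _ = _ := by rw [lintegral_const_mul _ (by fun_prop), lintegral_hk_slice hc hs, mul_one]
  · have : ∀ y, hk c p (y, s) = 0 := fun y => hk_of_le hc.le (not_lt.1 hs)
    simp [indicator, hs, this]

/-! ### Bounded densities and their error potentials -/

/-- A measurable density that vanishes up to time `τ₀` and is bounded by `B` up to time `T`. -/
structure IsBddDensity (τ₀ T : ℝ) (B : ℝ≥0) (ψ : ℝ × ℝ → ℝ) : Prop where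
  meas : Measurable ψ
  zero : ∀ r : ℝ × ℝ, r.2 ≤ τ₀ → ψ r = 0
  bdd : ∀ r : ℝ × ℝ, r.2 ≤ T → ‖ψ r‖ₑ ≤ B

lemma measurableSet_after (θ : ℝ) : MeasurableSet {r : ℝ × ℝ | θ < r.2} :=
  measurableSet_lt measurable_const measurable_snd

lemma lintegral_tw_hk_after {c : ℝ} (hc : 0 < c) {ρ : ℝ} (hρ : ρ < 1) {p : ℝ × ℝ} {θ : ℝ}
    (hθ : θ ≤ p.2) :
    ∫⁻ r in {r : ℝ × ℝ | θ < r.2}, tw ρ (p.2 - r.2) * hk c p r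
      = ENNReal.ofReal ((p.2 - θ) ^ (1 - ρ) / (1 - ρ)) := by
  have hG : Measurable fun s : ℝ => (Ioi θ).indicator (fun _ => (1 : ℝ≥0∞)) s :=
    measurable_const.indicator measurableSet_Ioi
  rw [← lintegral_indicator (measurableSet_after θ), ← lintegral_tw_sub hρ hθ,
    ← lintegral_indicator measurableSet_Ioi]
  have h1 := lintegral_weight_hk hc (measurable_tw ρ) hG p
  refine Eq.trans ?_ (h1.trans ?_)
  · congr 1; funext r
    by_cases hr : θ < r.2 <;> simp [indicator, hr]
  · rw [← lintegral_indicator measurableSet_Iio]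
    congr 1; funext s
    by_cases h2 : s < p.2 <;> by_cases h3 : θ < s <;>
      simp [indicator, h2, h3, tw_of_nonpos, not_lt.1]

namespace IsBddDensity

variable {m M L τ₀ T : ℝ} {B : ℝ≥0} {ψ : ℝ × ℝ → ℝ} {a : ℝ × ℝ → ℝ}

/-- The contribution to a potential of the times after `θ`. -/
lemma lintegral_after_le (hψ : IsBddDensity τ₀ T B ψ) {c : ℝ} (hc : 0 < c) {ρ : ℝ} (hρ : ρ < 1)
    {p : ℝ × ℝ} {θ : ℝ} (hθ : θ ≤ p.2) (hp : p.2 ≤ T) {k : ℝ × ℝ → ℝ} {A : ℝ≥0∞}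
    (hk : ∀ r : ℝ × ℝ, τ₀ < r.2 → ‖k r‖ₑ ≤ A * (tw ρ (p.2 - r.2) * hk c p r)) :
    ∫⁻ r in {r : ℝ × ℝ | θ < r.2}, ‖k r‖ₑ * ‖ψ r‖ₑ
      ≤ A * B * ENNReal.ofReal ((p.2 - θ) ^ (1 - ρ) / (1 - ρ)) := by
  rw [← lintegral_tw_hk_after hc hρ hθ, ← lintegral_const_mul _ (by fun_prop)]
  refine lintegral_mono fun r => ?_
  dsimp only
  rcases le_or_gt r.2 τ₀ with h0 | h0
  · simp [hψ.zero r h0]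
  rcases le_or_gt p.2 r.2 with h1 | h1
  · have := hk r h0
    rw [tw_of_nonpos (by linarith)] at this
    simp only [zero_mul, mul_zero, nonpos_iff_eq_zero] at this
    simp [this]
  · calc _ ≤ A * (tw ρ (p.2 - r.2) * _root_.hk c p r) * B :=
        mul_le_mul' (hk r h0) (hψ.bdd r (h1.le.trans hp))
      _ = _ := by ring

lemma lintegral_le (hψ : IsBddDensity τ₀ T B ψ) {c : ℝ} (hc : 0 < c) {ρ : ℝ} (hρ : ρ < 1)
    {p : ℝ × ℝ} (h0 : τ₀ ≤ p.2) (hp : p.2 ≤ T) {k : ℝ × ℝ → ℝ} {A : ℝ≥0∞}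
    (hk : ∀ r : ℝ × ℝ, τ₀ < r.2 → ‖k r‖ₑ ≤ A * (tw ρ (p.2 - r.2) * hk c p r)) :
    ∫⁻ r, ‖k r‖ₑ * ‖ψ r‖ₑ ≤ A * B * ENNReal.ofReal ((p.2 - τ₀) ^ (1 - ρ) / (1 - ρ)) := by
  refine le_trans (le_of_eq ?_) (hψ.lintegral_after_le hc hρ h0 hp hk)
  rw [← lintegral_indicator (measurableSet_after τ₀)]
  congr 1; funext r
  by_cases hr : τ₀ < r.2
  · simp [indicator, hr]
  · simp [indicator, hr, hψ.zero r (not_lt.1 hr)]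

lemma integrable_mul (hψ : IsBddDensity τ₀ T B ψ) {c : ℝ} (hc : 0 < c) {ρ : ℝ} (hρ : ρ < 1)
    {p : ℝ × ℝ} (h0 : τ₀ ≤ p.2) (hp : p.2 ≤ T) {k : ℝ × ℝ → ℝ} (hkm : Measurable k) {A : ℝ≥0}
    (hk : ∀ r : ℝ × ℝ, τ₀ < r.2 → ‖k r‖ₑ ≤ A * (tw ρ (p.2 - r.2) * hk c p r)) :
    Integrable fun r => k r * ψ r := by
  refine integrable_of_lintegral_enorm_mul (hkm.mul hψ.meas).aestronglyMeasurable ?_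
  refine (hψ.lintegral_le hc hρ h0 hp hk).trans_lt ?_
  exact ENNReal.mul_lt_top (ENNReal.mul_lt_top ENNReal.coe_lt_top ENNReal.coe_lt_top)
    ENNReal.ofReal_lt_top

end IsBddDensity

/-- On a bounded time range the error kernel has a singularity of order `3/4`. -/
lemma exists_ek_bound_tw {m M L γ : ℝ} {a : ℝ × ℝ → ℝ} (h : IsCoeff m M L a) (hγ : 0 ≤ γ)
    (S : ℝ) : ∃ C : ℝ≥0, ∀ p q : ℝ × ℝ, p.2 - q.2 ≤ S →
      ‖ek a γ p q‖ₑ ≤ C * (tw (3 / 4) (p.2 - q.2) * hk (64 * M) p q) := by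
  obtain ⟨C, hC, hb⟩ := exists_ek_bound h.m_pos h.m_le_M h.L_nonneg hγ
  refine ⟨(C * Real.exp (1 * S)).toNNReal, fun p q hpq => (hb a h p q).trans ?_⟩
  change _ ≤ ENNReal.ofReal (C * Real.exp (1 * S)) * _
  rw [ENNReal.ofReal_mul hC.le, mul_assoc, ← mul_assoc (ENNReal.ofReal (Real.exp (1 * S)))]
  gcongr
  exact kw_le_tw zero_le_one hpq

lemma exists_fk_bound_nnreal {m M L : ℝ} {a : ℝ × ℝ → ℝ} (h : IsCoeff m M L a) {j : ℕ}
    (hj : j ≤ 4) : ∃ C : ℝ≥0, ∀ p q : ℝ × ℝ,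
      ‖fk a j p q‖ₑ ≤ C * (tw (j / 2) (p.2 - q.2) * hk (64 * M) p q) := by
  obtain ⟨C, hC, hb⟩ := exists_fk_bound h.m_pos h.m_le_M hj
  exact ⟨C.toNNReal, hb L a h⟩

/-- A deliberately crude bound: derivatives of order up to four have time exponents at most 2, so
ε^(-2) serves for all of them away from the diagonal. Nothing is lost, because ε is sent to 0 only
after the step size. -/
lemma tw_le_inv_sq {ρ σ ε : ℝ} (hε : 0 < ε) (hε1 : ε ≤ 1) (hσ : ε ≤ σ) (hρ0 : 0 ≤ ρ)
    (hρ : ρ ≤ 2) : tw ρ σ ≤ ENNReal.ofReal ((ε ^ 2)⁻¹) := by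
  rw [tw_of_pos (hε.trans_le hσ)]
  apply ENNReal.ofReal_le_ofReal
  calc σ ^ (-ρ) ≤ ε ^ (-ρ) := Real.rpow_le_rpow_of_nonpos hε hσ (by linarith)
    _ ≤ ε ^ (-2 : ℝ) := Real.rpow_le_rpow_of_exponent_ge hε hε1 (by linarith)
    _ = _ := by rw [Real.rpow_neg hε.le]; norm_num

/-- The modulus of continuity of the slices of the frozen kernels, away from the diagonal. -/
lemma exists_lintegral_fk_sub_le {m M L : ℝ} {a : ℝ × ℝ → ℝ} (h : IsCoeff m M L a) {j : ℕ}
    (hj : j ≤ 2) : ∃ C : ℝ≥0, ∀ ε : ℝ, 0 < ε → ε ≤ 1 → ∀ (p r : ℝ × ℝ) (s : ℝ),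
      s ≤ r.2 - ε → r.2 ≤ p.2 →
      ∫⁻ y, ‖fk a j p (y, s) - fk a j r (y, s)‖ₑ
        ≤ C * ENNReal.ofReal ((ε ^ 2)⁻¹ * (|p.1 - r.1| + |p.2 - r.2|)) := by
  obtain ⟨C₁, hb₁⟩ := exists_fk_bound h.m_pos h.m_le_M (j := j + 1) (by omega)
  obtain ⟨C₂, hb₂⟩ := exists_fk_bound h.m_pos h.m_le_M (j := j + 2) (by omega)
  have hM := h.M_pos
  have hM' : 0 < 64 * M := by positivity
  refine ⟨C₁.toNNReal + M.toNNReal * C₂.toNNReal, fun ε hε hε1 p r s hs hpr => ?_⟩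
  have hj' : (j : ℝ) ≤ 2 := by exact_mod_cast hj
  have hE : 0 ≤ (ε ^ 2)⁻¹ := by positivity
  set E := ENNReal.ofReal ((ε ^ 2)⁻¹) with hEd
  have h1 : ∫⁻ y, ‖fk a j p (y, s) - fk a j (r.1, p.2) (y, s)‖ₑ
      ≤ ENNReal.ofReal |p.1 - r.1| * (ENNReal.ofReal C₁ * E) := by
    have := lintegral_fk_sub_space_le h j (t := p.2) (s := s) (x := p.1) (x' := r.1)
      (φ := fun _ => 1) measurable_const (N := ENNReal.ofReal C₁ * E) (fun z => by
        refine (lintegral_fk_slice_le (j + 1) (hb₁.2 L a h) measurable_const (z, p.2) s).trans ?_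
        simp only [mul_one]
        rw [lintegral_hk_slice hM' (show s < (z, p.2).2 by simp; linarith), mul_one]
        gcongr
        refine tw_le_inv_sq hε hε1 (by linarith) (by positivity) ?_
        push_cast
        linarith)
    simpa using this
  have h2 : ∫⁻ y, ‖fk a j (r.1, p.2) (y, s) - fk a j r (y, s)‖ₑ
      ≤ ENNReal.ofReal M * (ENNReal.ofReal C₂ * E * ENNReal.ofReal |p.2 - r.2|) := by
    have := lintegral_fk_sub_time_le h j (t := p.2) (t' := r.2) (s := s) (x := r.1)
      (by linarith) hpr (φ := fun _ => 1) measurable_const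
    simp only [mul_one] at this
    refine this.trans (mul_le_mul_right ?_ _)
    rw [abs_of_nonneg (sub_nonneg.2 hpr), ← Real.volume_Ioc, ← setLIntegral_const]
    refine setLIntegral_mono measurable_const fun z hz => ?_
    have h3 := (lintegral_fk_slice_le (j + 2) (hb₂.2 L a h) (φ := fun _ => 1)
      measurable_const (r.1, z) s)
    simp only [mul_one] at h3
    refine h3.trans ?_
    rw [lintegral_hk_slice hM' (show s < (r.1, z).2 by simp; linarith [hz.1]), mul_one]
    gcongr
    refine tw_le_inv_sq hε hε1 (by linarith [hz.1]) (by positivity) ?_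
    push_cast
    linarith
  calc _ ≤ ∫⁻ y, (‖fk a j p (y, s) - fk a j (r.1, p.2) (y, s)‖ₑ
        + ‖fk a j (r.1, p.2) (y, s) - fk a j r (y, s)‖ₑ) := by
        refine lintegral_mono fun y => ?_
        rw [show fk a j p (y, s) - fk a j r (y, s)
          = (fk a j p (y, s) - fk a j (r.1, p.2) (y, s))
            + (fk a j (r.1, p.2) (y, s) - fk a j r (y, s)) by ring]
        exact enorm_add_le _ _
    _ ≤ ENNReal.ofReal |p.1 - r.1| * (ENNReal.ofReal C₁ * E)
        + ENNReal.ofReal M * (ENNReal.ofReal C₂ * E * ENNReal.ofReal |p.2 - r.2|) := by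
        rw [lintegral_add_left]
        · exact add_le_add h1 h2
        · exact ((h.measurable_fk_comp j measurable_const (by fun_prop)).sub
            (h.measurable_fk_comp j measurable_const (by fun_prop))).enorm
    _ ≤ _ := by
        rw [ENNReal.ofReal_mul hE, ENNReal.ofReal_add (abs_nonneg _) (abs_nonneg _)]
        push_cast
        change _ ≤ (ENNReal.ofReal C₁ + ENNReal.ofReal M * ENNReal.ofReal C₂) * _
        rw [← hEd]
        set X := ENNReal.ofReal |p.1 - r.1|
        set Y := ENNReal.ofReal |p.2 - r.2|
        calc _ ≤ X * (ENNReal.ofReal C₁ * E) + ENNReal.ofReal M * (ENNReal.ofReal C₂ * E * Y)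
              + (Y * (ENNReal.ofReal C₁ * E) + ENNReal.ofReal M * (ENNReal.ofReal C₂ * E * X)) :=
              le_self_add
          _ = _ := by ring

lemma exists_lintegral_ek_sub_le {m M L γ : ℝ} {a : ℝ × ℝ → ℝ} (h : IsCoeff m M L a)
    (hγ : 0 ≤ γ) : ∃ C : ℝ≥0, ∀ ε : ℝ, 0 < ε → ε ≤ 1 → ∀ (p r : ℝ × ℝ) (s : ℝ),
      s ≤ r.2 - ε → r.2 ≤ p.2 → |p.1 - r.1| ≤ 1 → |p.2 - r.2| ≤ 1 →
      ∫⁻ y, ‖ek a γ p (y, s) - ek a γ r (y, s)‖ₑ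
        ≤ C * ENNReal.ofReal ((ε ^ 2)⁻¹ * (√|p.1 - r.1| + √|p.2 - r.2|)) := by
  obtain ⟨C₀, hb₀⟩ := exists_lintegral_fk_sub_le h (j := 0) (by norm_num)
  obtain ⟨C₂, hb₂⟩ := exists_lintegral_fk_sub_le h (j := 2) (by norm_num)
  obtain ⟨C, hb⟩ := exists_fk_bound h.m_pos h.m_le_M (j := 2) (by norm_num)
  have hM := h.M_pos
  have hL := h.L_nonneg
  have hM' : 0 < 64 * M := by positivity
  refine ⟨L.toNNReal * C.toNNReal + M.toNNReal * C₂ + γ.toNNReal * C₀,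
    fun ε hε hε1 p r s hs hpr h1 h2 => ?_⟩
  have hE : 0 ≤ (ε ^ 2)⁻¹ := by positivity
  set X := ENNReal.ofReal ((ε ^ 2)⁻¹ * (√|p.1 - r.1| + √|p.2 - r.2|)) with hX
  have hle : ∀ z : ℝ, |z| ≤ 1 → |z| ≤ √|z| := fun z hz => by
    have := Real.sq_sqrt (abs_nonneg z)
    have h3 : √|z| ≤ 1 := by rw [Real.sqrt_le_left one_pos.le]; linarith
    nlinarith [Real.sqrt_nonneg |z|]
  have hXle : ENNReal.ofReal ((ε ^ 2)⁻¹ * (|p.1 - r.1| + |p.2 - r.2|)) ≤ X := by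
    apply ENNReal.ofReal_le_ofReal
    gcongr
    · exact hle _ h1
    · exact hle _ h2
  have i0 := (hb₀ ε hε hε1 p r s hs hpr).trans (mul_le_mul_right hXle _)
  have i2 := (hb₂ ε hε hε1 p r s hs hpr).trans (mul_le_mul_right hXle _)
  have i3 : ENNReal.ofReal |a p - a r| * ∫⁻ y, ‖fk a 2 p (y, s)‖ₑ
      ≤ ENNReal.ofReal L * ENNReal.ofReal C * X := by
    have h3 := lintegral_fk_slice_le 2 (hb.2 L a h) (φ := fun _ => 1) measurable_const p s
    simp only [mul_one] at h3
    rw [lintegral_hk_slice hM' (show s < p.2 by linarith), mul_one] at h3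
    have h4 : ENNReal.ofReal |a p - a r|
        ≤ ENNReal.ofReal L * ENNReal.ofReal (√|p.1 - r.1| + √|p.2 - r.2|) := by
      rw [← ENNReal.ofReal_mul hL]
      exact ENNReal.ofReal_le_ofReal (h.holder p r)
    have h5 : tw ((2 : ℕ) / 2) (p.2 - s) ≤ ENNReal.ofReal ((ε ^ 2)⁻¹) :=
      tw_le_inv_sq hε hε1 (by linarith) (by norm_num) (by norm_num)
    calc _ ≤ (ENNReal.ofReal L * ENNReal.ofReal (√|p.1 - r.1| + √|p.2 - r.2|)) *
          (ENNReal.ofReal C * ENNReal.ofReal ((ε ^ 2)⁻¹)) :=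
          mul_le_mul' h4 (h3.trans (mul_le_mul_right h5 _))
      _ = _ := by rw [hX, ENNReal.ofReal_mul hE]; ring
  have m2 : ∀ p, Measurable fun y => fk a 2 p (y, s) := fun p =>
    h.measurable_fk_comp 2 measurable_const (by fun_prop)
  have m0 : ∀ p, Measurable fun y => fk a 0 p (y, s) := fun p =>
    h.measurable_fk_comp 0 measurable_const (by fun_prop)
  calc _ ≤ ∫⁻ y, (ENNReal.ofReal |a p - a r| * ‖fk a 2 p (y, s)‖ₑ
        + ENNReal.ofReal M * ‖fk a 2 p (y, s) - fk a 2 r (y, s)‖ₑ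
        + ENNReal.ofReal γ * ‖fk a 0 p (y, s) - fk a 0 r (y, s)‖ₑ) := by
        refine lintegral_mono fun y => ?_
        -- The difference is split into the change of the coefficient, which produces the square
        -- roots, and the changes of the two kernels, which are Lipschitz. For increments at most 1
        -- the Lipschitz terms are also bounded by square roots.
        rw [show ek a γ p (y, s) - ek a γ r (y, s) = (a p - a r) * fk a 2 p (y, s)
          + (a r - a (y, s)) * (fk a 2 p (y, s) - fk a 2 r (y, s))
          + (-γ) * (fk a 0 p (y, s) - fk a 0 r (y, s)) by unfold ek; ring]
        refine (enorm_add_le _ _).trans (add_le_add ((enorm_add_le _ _).trans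
          (add_le_add ?_ ?_)) ?_)
        · rw [enorm_mul, Real.enorm_eq_ofReal_abs (a p - a r)]
        · rw [enorm_mul, Real.enorm_eq_ofReal_abs (a r - a (y, s))]
          gcongr
          exact h.abs_sub_le _ _
        · rw [enorm_mul, enorm_neg, Real.enorm_eq_ofReal hγ]
    _ = ENNReal.ofReal |a p - a r| * (∫⁻ y, ‖fk a 2 p (y, s)‖ₑ)
        + ENNReal.ofReal M * (∫⁻ y, ‖fk a 2 p (y, s) - fk a 2 r (y, s)‖ₑ)
        + ENNReal.ofReal γ * (∫⁻ y, ‖fk a 0 p (y, s) - fk a 0 r (y, s)‖ₑ) := by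
        have n1 := (m2 p).enorm
        have n2 : Measurable fun y => ‖fk a 2 p (y, s) - fk a 2 r (y, s)‖ₑ :=
          ((m2 p).sub (m2 r)).enorm
        have n3 : Measurable fun y => ‖fk a 0 p (y, s) - fk a 0 r (y, s)‖ₑ :=
          ((m0 p).sub (m0 r)).enorm
        rw [lintegral_add_right _ (n3.const_mul _), lintegral_add_right _ (n2.const_mul _),
          lintegral_const_mul _ n1, lintegral_const_mul _ n2, lintegral_const_mul _ n3]
    _ ≤ ENNReal.ofReal L * ENNReal.ofReal C * X + ENNReal.ofReal M * (C₂ * X)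
        + ENNReal.ofReal γ * (C₀ * X) := by gcongr
    _ = _ := by
        push_cast
        change _ = (ENNReal.ofReal L * ENNReal.ofReal C + ENNReal.ofReal M * C₂
          + ENNReal.ofReal γ * C₀) * X
        ring

/-- The error potential of a bounded density is uniformly continuous. -/
lemma exists_error_potential_modulus {m M L γ : ℝ} {a : ℝ × ℝ → ℝ} (h : IsCoeff m M L a)
    (hγ : 0 ≤ γ) {τ₀ T : ℝ} {B : ℝ≥0} {ψ : ℝ × ℝ → ℝ} (hψ : IsBddDensity τ₀ T B ψ) :
    ∃ C : ℝ≥0, ∀ ε : ℝ, 0 < ε → ε ≤ 1 → ∀ p r : ℝ × ℝ, τ₀ ≤ r.2 → r.2 ≤ p.2 → p.2 ≤ T →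
      ‖(∫ q, ek a γ p q * ψ q) - ∫ q, ek a γ r q * ψ q‖ₑ
        ≤ C * ENNReal.ofReal (ε ^ (1 / 4 : ℝ) + (ε ^ 2)⁻¹ * (√|p.1 - r.1| + √|p.2 - r.2|)) := by
  obtain ⟨C₁, hb₁⟩ := exists_ek_bound_tw h hγ (T - τ₀)
  obtain ⟨C₂, hb₂⟩ := exists_lintegral_ek_sub_le h hγ
  have hM := h.M_pos
  have hM' : 0 < 64 * M := by positivity
  set S := ENNReal.ofReal ((T - τ₀) ^ (1 / 4 : ℝ) * 4)
  refine ⟨C₁ * B * ((T - τ₀) ^ (1 / 4 : ℝ) * 4).toNNReal * 2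
    + (C₁ * B * 16 + C₂ * B * (T - τ₀).toNNReal), fun ε hε hε1 p r hr hpr hp => ?_⟩
  have hek : ∀ p : ℝ × ℝ, p.2 ≤ T → ∀ q : ℝ × ℝ, τ₀ < q.2 →
      ‖ek a γ p q‖ₑ ≤ C₁ * (tw (3 / 4) (p.2 - q.2) * hk (64 * M) p q) :=
    fun p hp q hq => hb₁ p q (by linarith)
  have hint : ∀ p : ℝ × ℝ, τ₀ ≤ p.2 → p.2 ≤ T → Integrable fun q => ek a γ p q * ψ q :=
    fun p h0 hp => hψ.integrable_mul hM' (by norm_num) h0 hp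
      (h.measurable_ek_comp γ measurable_const measurable_id) (hek p hp)
  push_cast
  change _ ≤ (C₁ * B * S * 2 + (C₁ * B * 16 + C₂ * B * ENNReal.ofReal (T - τ₀))) * _
  have hrhs : 0 ≤ (ε ^ 2)⁻¹ * (√|p.1 - r.1| + √|p.2 - r.2|) := by positivity
  have hε4 : 0 ≤ ε ^ (1 / 4 : ℝ) := by positivity
  -- For nearby points, source times after r.2 - ε contribute ε^(1/4) because the singularity is
  -- integrable, and earlier times are handled by the modulus of the kernel. For distant points the
  -- right side is at least a constant, and the size of the potential suffices.
  by_cases hfar : |p.1 - r.1| ≤ 1 ∧ |p.2 - r.2| ≤ ε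
  · obtain ⟨hx, ht⟩ := hfar
    rw [← integral_sub (hint p (hr.trans hpr) hp) (hint r hr (hpr.trans hp))]
    simp_rw [← sub_mul]
    refine (enorm_integral_mul_le _ _).trans ?_
    rw [← lintegral_add_compl _ (measurableSet_after (r.2 - ε)), add_comm]
    have hmp : ∀ p, Measurable fun q => ‖ek a γ p q‖ₑ * ‖ψ q‖ₑ := fun p =>
      (h.measurable_ek_comp γ measurable_const measurable_id).enorm.mul hψ.meas.enorm
    have hnear : ∫⁻ q in {q : ℝ × ℝ | r.2 - ε < q.2}, ‖ek a γ p q - ek a γ r q‖ₑ * ‖ψ q‖ₑ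
        ≤ C₁ * B * 16 * ENNReal.ofReal (ε ^ (1 / 4 : ℝ)) := by
      have n1 : ∀ p' : ℝ × ℝ, r.2 ≤ p'.2 → p'.2 - r.2 ≤ ε → p'.2 ≤ T →
          ∫⁻ q in {q : ℝ × ℝ | r.2 - ε < q.2}, ‖ek a γ p' q‖ₑ * ‖ψ q‖ₑ
          ≤ C₁ * B * ENNReal.ofReal (8 * ε ^ (1 / 4 : ℝ)) := by
        intro p' h1 h2 h3
        refine (hψ.lintegral_after_le hM' (by norm_num : (3 / 4 : ℝ) < 1)
          (by linarith) h3 (hek p' h3)).trans ?_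
        gcongr
        norm_num
        have h4 : (p'.2 - (r.2 - ε)) ^ (1 / 4 : ℝ) ≤ (2 * ε) ^ (1 / 4 : ℝ) := by
          apply Real.rpow_le_rpow <;> linarith
        rw [Real.mul_rpow (by norm_num) hε.le] at h4
        have h5 : (2 : ℝ) ^ (1 / 4 : ℝ) ≤ 2 := by
          calc (2 : ℝ) ^ (1 / 4 : ℝ) ≤ 2 ^ (1 : ℝ) :=
                Real.rpow_le_rpow_of_exponent_le (by norm_num) (by norm_num)
            _ = 2 := Real.rpow_one 2
        nlinarith
      calc _ ≤ ∫⁻ q in {q : ℝ × ℝ | r.2 - ε < q.2},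
            (‖ek a γ p q‖ₑ * ‖ψ q‖ₑ + ‖ek a γ r q‖ₑ * ‖ψ q‖ₑ) := by
            refine lintegral_mono fun q => ?_
            dsimp only
            rw [← add_mul]
            gcongr
            exact enorm_sub_le
        _ ≤ C₁ * B * ENNReal.ofReal (8 * ε ^ (1 / 4 : ℝ))
            + C₁ * B * ENNReal.ofReal (8 * ε ^ (1 / 4 : ℝ)) := by
            rw [lintegral_add_left (hmp p)]
            exact add_le_add (n1 p hpr ((le_abs_self _).trans ht) hp)
              (n1 r le_rfl (by linarith) (hpr.trans hp))
        _ = _ := by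
            rw [ENNReal.ofReal_mul (by norm_num)]
            norm_num
            ring
    have hcompl : ∫⁻ q in {q : ℝ × ℝ | r.2 - ε < q.2}ᶜ, ‖ek a γ p q - ek a γ r q‖ₑ * ‖ψ q‖ₑ
        ≤ C₂ * B * ENNReal.ofReal (T - τ₀) *
          ENNReal.ofReal ((ε ^ 2)⁻¹ * (√|p.1 - r.1| + √|p.2 - r.2|)) := by
      have hd : Measurable fun q => ek a γ p q - ek a γ r q :=
        (h.measurable_ek_comp γ measurable_const measurable_id).sub
          (h.measurable_ek_comp γ measurable_const measurable_id)
      calc _ ≤ ∫⁻ q : ℝ × ℝ, (Ioc τ₀ (r.2 - ε)).indicator (fun _ => (B : ℝ≥0∞)) q.2 *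
            ‖ek a γ p q - ek a γ r q‖ₑ := by
            rw [← lintegral_indicator (measurableSet_after _).compl]
            refine lintegral_mono fun q => ?_
            by_cases h1 : r.2 - ε < q.2
            · simp [indicator, h1]
            by_cases h2 : τ₀ < q.2
            · simp only [indicator, mem_compl_iff, mem_ofPred_eq, h1, not_false_eq_true, if_true,
                mem_Ioc, h2, not_lt.1 h1, and_self]
              rw [mul_comm]
              gcongr
              exact hψ.bdd q (by linarith)
            · simp [indicator, h2, hψ.zero q (not_lt.1 h2)]
        _ = ∫⁻ s in Ioc τ₀ (r.2 - ε), B * ∫⁻ y, ‖ek a γ p (y, s) - ek a γ r (y, s)‖ₑ := by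
            rw [lintegral_spacetime, ← lintegral_indicator measurableSet_Ioc]
            · congr 1; funext s
              by_cases hs : s ∈ Ioc τ₀ (r.2 - ε)
              · simp only [indicator, hs, if_true]
                rw [lintegral_const_mul]
                exact ((h.measurable_ek_comp γ measurable_const (by fun_prop)).sub
                  (h.measurable_ek_comp γ measurable_const (by fun_prop))).enorm
              · simp [indicator, hs]
            · exact ((measurable_const.indicator measurableSet_Ioc).comp measurable_snd).mul
                hd.enorm
        _ ≤ ∫⁻ s in Ioc τ₀ (r.2 - ε), B * (C₂ *
              ENNReal.ofReal ((ε ^ 2)⁻¹ * (√|p.1 - r.1| + √|p.2 - r.2|))) := by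
            refine setLIntegral_mono measurable_const fun s hs => ?_
            gcongr
            exact hb₂ ε hε hε1 p r s hs.2 hpr hx (ht.trans hε1)
        _ ≤ _ := by
            rw [setLIntegral_const, Real.volume_Ioc]
            calc _ ≤ B * (C₂ * ENNReal.ofReal ((ε ^ 2)⁻¹ * (√|p.1 - r.1| + √|p.2 - r.2|))) *
                  ENNReal.ofReal (T - τ₀) := by
                  gcongr
                  linarith
              _ = _ := by ring
    refine (add_le_add hcompl hnear).trans ?_
    rw [ENNReal.ofReal_add hε4 hrhs]
    set X := ENNReal.ofReal (ε ^ (1 / 4 : ℝ))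
    set Y := ENNReal.ofReal ((ε ^ 2)⁻¹ * (√|p.1 - r.1| + √|p.2 - r.2|))
    calc _ ≤ C₂ * B * ENNReal.ofReal (T - τ₀) * Y + C₁ * B * 16 * X
          + (C₁ * B * S * 2 * (X + Y) + C₂ * B * ENNReal.ofReal (T - τ₀) * X
            + C₁ * B * 16 * Y) := le_self_add
      _ = _ := by ring
  · have h1 : 1 ≤ ENNReal.ofReal
        (ε ^ (1 / 4 : ℝ) + (ε ^ 2)⁻¹ * (√|p.1 - r.1| + √|p.2 - r.2|)) := by
      rw [← ENNReal.ofReal_one]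
      apply ENNReal.ofReal_le_ofReal
      have hi : 1 ≤ (ε ^ 2)⁻¹ := by
        rw [one_le_inv₀ (by positivity)]
        exact pow_le_one₀ hε.le hε1
      rw [not_and_or, not_le, not_le] at hfar
      rcases hfar with hf | hf
      · have : 1 ≤ √|p.1 - r.1| := by rw [Real.one_le_sqrt]; exact hf.le
        have h2 : 0 ≤ √|p.2 - r.2| := by positivity
        nlinarith
      · have h3 : ε ≤ √|p.2 - r.2| := by
          apply Real.le_sqrt_of_sq_le
          nlinarith
        have h2 : 0 ≤ √|p.1 - r.1| := by positivity
        have h4 : (ε ^ 2)⁻¹ * ε ≤ (ε ^ 2)⁻¹ * (√|p.1 - r.1| + √|p.2 - r.2|) := by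
          gcongr; linarith
        have h5 : (ε ^ 2)⁻¹ * ε = ε⁻¹ := by field_simp
        have h6 : 1 ≤ ε⁻¹ := (one_le_inv₀ hε).2 hε1
        linarith
    have hK : ∀ p : ℝ × ℝ, τ₀ ≤ p.2 → p.2 ≤ T → ‖∫ q, ek a γ p q * ψ q‖ₑ ≤ C₁ * B * S := by
      intro p h0 hp
      refine (enorm_integral_mul_le _ _).trans ((hψ.lintegral_le hM'
        (by norm_num : (3 / 4 : ℝ) < 1) h0 hp (hek p hp)).trans ?_)
      refine mul_le_mul_right (ENNReal.ofReal_le_ofReal ?_) _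
      have h5 : (p.2 - τ₀) ^ (1 / 4 : ℝ) ≤ (T - τ₀) ^ (1 / 4 : ℝ) := by
        apply Real.rpow_le_rpow <;> linarith
      rw [show (1 : ℝ) - 3 / 4 = 1 / 4 by norm_num]
      linarith
    calc _ ≤ C₁ * B * S + C₁ * B * S :=
          enorm_sub_le.trans (add_le_add (hK p (hr.trans hpr) hp) (hK r hr (hpr.trans hp)))
      _ = C₁ * B * S * 2 * 1 := by ring
      _ ≤ _ := by
          gcongr
          exact le_self_add

/-! ### Taylor expansion of the heat kernel in its variance -/

lemma exists_gkd_var_bound {m M : ℝ} (hm : 0 < m) (hmM : m ≤ M) {j : ℕ} (hj : j ≤ 2) :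
    ∃ C : ℝ, 0 < C ∧ ∀ σ v z : ℝ, 0 < σ → m * σ ≤ v → v ≤ M * σ →
      |gkd (j + 2) v z| ≤ C * σ ^ (-((j + 2 : ℕ) / 2 : ℝ)) * gk (16 * M * σ) z := by
  obtain ⟨C, hC, hb⟩ := exists_gkd_bound (j + 2)
  have hM : 0 < M := hm.trans_le hmM
  refine ⟨C * (√m)⁻¹ ^ (j + 2) * √(16 * M / m), by positivity, fun σ v z hσ h1 h2 => ?_⟩
  have hmσ : 0 < m * σ := by positivity
  have hv : 0 < v := hmσ.trans_le h1
  have hj1 : (1 : ℝ) ≤ 2 ^ (j + 2) := one_le_pow₀ (by norm_num)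
  have hj2 : (2 : ℝ) ^ (j + 2) ≤ 2 ^ 4 := pow_le_pow_right₀ (by norm_num) (by omega)
  refine (hb v z hv).trans ?_
  have k1 : (√v)⁻¹ ^ (j + 2) ≤ (√m)⁻¹ ^ (j + 2) * σ ^ (-((j + 2 : ℕ) / 2 : ℝ)) := by
    rw [← inv_sqrt_pow_eq hσ, ← mul_pow, ← mul_inv, ← Real.sqrt_mul hm.le]
    gcongr
  have k2 : gk (2 ^ (j + 2) * v) z ≤ √(16 * M / m) * gk (16 * M * σ) z := by
    have := gk_le_of_le hmσ (show m * σ ≤ 2 ^ (j + 2) * v by nlinarith)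
      (show 2 ^ (j + 2) * v ≤ 16 * M * σ by
        calc (2 : ℝ) ^ (j + 2) * v ≤ 2 ^ 4 * (M * σ) := by gcongr
          _ = _ := by ring) z
    rwa [mul_div_mul_right _ _ hσ.ne'] at this
  calc _ ≤ C * ((√m)⁻¹ ^ (j + 2) * σ ^ (-((j + 2 : ℕ) / 2 : ℝ))) *
        (√(16 * M / m) * gk (16 * M * σ) z) := by
        gcongr
        exact gk_nonneg _ _
    _ = _ := by ring

lemma exists_gkd_var_sub_le {m M : ℝ} (hm : 0 < m) (hmM : m ≤ M) {j : ℕ} (hj : j ≤ 2) :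
    ∃ C : ℝ, 0 < C ∧ ∀ σ z : ℝ, 0 < σ → ∀ v₀ ∈ Icc (m * σ) (M * σ), ∀ v₁ ∈ Icc (m * σ) (M * σ),
      |gkd j v₁ z - gkd j v₀ z|
        ≤ C * σ ^ (-((j + 2 : ℕ) / 2 : ℝ)) * gk (16 * M * σ) z * |v₁ - v₀| := by
  obtain ⟨C, hC, hb⟩ := exists_gkd_var_bound hm hmM hj
  refine ⟨C, hC, fun σ z hσ v₀ h₀ v₁ h₁ => ?_⟩
  exact (convex_Icc (m * σ) (M * σ)).norm_image_sub_le_of_norm_hasDerivWithin_le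
    (f := fun v => gkd j v z) (f' := fun v => gkd (j + 2) v z)
    (fun v hv => (hasDerivAt_gkd_left j ((mul_pos hm hσ).trans_le hv.1) z).hasDerivWithinAt)
    (fun v hv => hb σ v z hσ hv.1 hv.2) h₀ h₁

/-- Two variance derivatives are four space derivatives, hence σ^(-2). The mean value inequality is
applied to gk minus its linear part, whose derivative is bounded by `exists_gkd_var_sub_le`. -/
lemma exists_gk_taylor {m M : ℝ} (hm : 0 < m) (hmM : m ≤ M) :
    ∃ C : ℝ, 0 < C ∧ ∀ σ z : ℝ, 0 < σ → ∀ v₀ ∈ Icc (m * σ) (M * σ), ∀ v₁ ∈ Icc (m * σ) (M * σ),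
      |gk v₁ z - gk v₀ z - (v₁ - v₀) * gkd 2 v₀ z|
        ≤ C * σ ^ (-2 : ℝ) * gk (16 * M * σ) z * |v₁ - v₀| ^ 2 := by
  obtain ⟨C, hC, hb⟩ := exists_gkd_var_sub_le hm hmM (j := 2) le_rfl
  refine ⟨C, hC, fun σ z hσ v₀ h₀ v₁ h₁ => ?_⟩
  have hsub : uIcc v₀ v₁ ⊆ Icc (m * σ) (M * σ) := uIcc_subset_Icc h₀ h₁
  have e2 : (-((2 + 2 : ℕ) / 2 : ℝ)) = -2 := by norm_num
  rw [e2] at hb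
  have key := (convex_uIcc v₀ v₁).norm_image_sub_le_of_norm_hasDerivWithin_le
    (f := fun v => gk v z - v * gkd 2 v₀ z) (f' := fun v => gkd 2 v z - 1 * gkd 2 v₀ z)
    (C := C * σ ^ (-2 : ℝ) * gk (16 * M * σ) z * |v₁ - v₀|)
    (fun v hv => ((hasDerivAt_gk_left ((mul_pos hm hσ).trans_le (hsub hv).1) z).sub
      ((hasDerivAt_id v).mul_const (gkd 2 v₀ z))).hasDerivWithinAt)
    (fun v hv => by
      rw [one_mul]
      refine (hb σ z hσ v₀ h₀ v (hsub hv)).trans ?_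
      have := gk_nonneg (16 * M * σ) z
      refine mul_le_mul_of_nonneg_left ?_ (by positivity)
      exact abs_sub_left_of_mem_uIcc hv)
    left_mem_uIcc right_mem_uIcc
  rw [Real.norm_eq_abs, Real.norm_eq_abs] at key
  calc _ = |gk v₁ z - v₁ * gkd 2 v₀ z - (gk v₀ z - v₀ * gkd 2 v₀ z)| := by congr 1; ring
    _ ≤ _ := key
    _ = _ := by ring

/-! ### One time step of the averaged potential -/

lemma enorm_le_nnreal_mul {x C w g : ℝ} (hC : 0 ≤ C) (hw : 0 ≤ w)
    (h : |x| ≤ C * w * g) :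
    ‖x‖ₑ ≤ (C.toNNReal : ℝ≥0∞) * (ENNReal.ofReal w * ENNReal.ofReal g) := by
  change _ ≤ ENNReal.ofReal C * _
  rw [← ENNReal.ofReal_mul hw, ← ENNReal.ofReal_mul hC, Real.enorm_eq_ofReal_abs, ← mul_assoc]
  exact ENNReal.ofReal_le_ofReal h

lemma rpow_quarter_add_half_le {σ S : ℝ} (hσ : 0 < σ) (hS : σ ≤ S) :
    σ ^ (1 / 4 : ℝ) + σ ^ (1 / 2 : ℝ) ≤ (1 + S ^ (1 / 4 : ℝ)) * σ ^ (1 / 4 : ℝ) := by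
  have h1 : σ ^ (1 / 2 : ℝ) = σ ^ (1 / 4 : ℝ) * σ ^ (1 / 4 : ℝ) := by
    rw [← Real.rpow_add hσ]; norm_num
  have h2 : σ ^ (1 / 4 : ℝ) ≤ S ^ (1 / 4 : ℝ) := Real.rpow_le_rpow hσ.le hS (by norm_num)
  have h3 : 0 ≤ σ ^ (1 / 4 : ℝ) := by positivity
  rw [h1]
  nlinarith

/-- The frozen kernel at `q`, averaged over a last step of length `δ` with the coefficient at `p`. -/
noncomputable def stepK (a : ℝ × ℝ → ℝ) (δ : ℝ) (p q : ℝ × ℝ) : ℝ :=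
  if q.2 < p.2 - δ then gk (a q * (p.2 - δ - q.2) + a p * δ) (p.1 - q.1) else 0

/-- The kernel with the coefficient at `p`, on the last time interval of length `δ`. -/
noncomputable def lastK (a : ℝ × ℝ → ℝ) (δ : ℝ) (p q : ℝ × ℝ) : ℝ :=
  if p.2 - δ < q.2 then gk (a p * (p.2 - q.2)) (p.1 - q.1) else 0

section Step

variable {m M L : ℝ} {a : ℝ × ℝ → ℝ}

lemma IsCoeff.measurable_stepK (h : IsCoeff m M L a) (δ : ℝ) (p : ℝ × ℝ) :
    Measurable (stepK a δ p) := by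
  have := h.cont.measurable
  unfold stepK
  exact Measurable.ite (measurableSet_lt measurable_snd measurable_const) (by fun_prop)
    measurable_const

lemma IsCoeff.measurable_lastK (δ : ℝ) (p : ℝ × ℝ) :
    Measurable (lastK a δ p) := by
  unfold lastK
  exact Measurable.ite (measurableSet_lt measurable_const measurable_snd) (by fun_prop)
    measurable_const

lemma IsCoeff.step_var_mem (h : IsCoeff m M L a) {δ : ℝ} (hδ : 0 ≤ δ) {p q : ℝ × ℝ}
    (hq : q.2 ≤ p.2 - δ) :
    a q * (p.2 - δ - q.2) + a p * δ ∈ Icc (m * (p.2 - q.2)) (M * (p.2 - q.2)) := by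
  have h1 := h.le_a p
  have h2 := h.le_a q
  have h3 := h.a_le p
  have h4 := h.a_le q
  constructor <;> nlinarith

lemma IsCoeff.frozen_var_mem (h : IsCoeff m M L a) {σ : ℝ} (hσ : 0 ≤ σ) (p : ℝ × ℝ) :
    a p * σ ∈ Icc (m * σ) (M * σ) := by
  have h1 := h.le_a p
  have h3 := h.a_le p
  constructor <;> nlinarith

lemma IsCoeff.exists_stepK_bound (h : IsCoeff m M L a) : ∃ C : ℝ≥0, ∀ δ : ℝ, 0 < δ →
    ∀ p q : ℝ × ℝ, ‖stepK a δ p q‖ₑ ≤ C * (tw 0 (p.2 - q.2) * hk (64 * M) p q) := by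
  refine ⟨(√(64 * M / m)).toNNReal, fun δ hδ p q => ?_⟩
  unfold stepK
  split_ifs with hq
  · have hσ : 0 < p.2 - q.2 := by linarith
    obtain ⟨h1, h2⟩ := h.step_var_mem hδ.le hq.le
    have hM := h.M_pos
    rw [tw_of_pos hσ, hk]
    apply enorm_le_nnreal_mul (Real.sqrt_nonneg _) (by positivity)
    rw [neg_zero, Real.rpow_zero, mul_one, abs_of_nonneg (gk_nonneg _ _)]
    exact gk_le_majorant h.m_pos hσ h1 (by nlinarith) _
  · simp

/-- Averaging a potential over a Gaussian step. -/
lemma integral_step_potential (h : IsCoeff m M L a) {τ₀ T : ℝ} {B : ℝ≥0} {ψ : ℝ × ℝ → ℝ}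
    (hψ : IsBddDensity τ₀ T B ψ) {δ : ℝ} (hδ : 0 < δ) {p : ℝ × ℝ} (h0 : τ₀ ≤ p.2) (hp : p.2 ≤ T) :
    ∫ z, gk (a p * δ) (p.1 - z) * ∫ q, fk a 0 (z, p.2 - δ) q * ψ q
      = ∫ q, stepK a δ p q * ψ q := by
  obtain ⟨C, hb⟩ := h.exists_stepK_bound
  have hpδ : 0 < a p * δ := mul_pos (h.a_pos p) hδ
  have e1 : ∀ q, ∫ z, gk (a p * δ) (p.1 - z) * fk a 0 (z, p.2 - δ) q = stepK a δ p q := by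
    intro q
    by_cases hq : q.2 < p.2 - δ
    · simp only [fk_zero_eq, stepK, if_pos hq]
      rw [integral_gk_mul_gk hpδ (mul_pos (h.a_pos q) (sub_pos.2 hq)), add_comm]
    · have : ∀ z, fk a 0 (z, p.2 - δ) q = 0 := fun z => fk_of_le h 0 (not_lt.1 hq)
      simp [this, stepK, hq]
  have e2 : ∀ q, ∫⁻ z, ‖gk (a p * δ) (p.1 - z)‖ₑ * ‖fk a 0 (z, p.2 - δ) q‖ₑ
      = ‖stepK a δ p q‖ₑ := by
    intro q
    by_cases hq : q.2 < p.2 - δ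
    · simp only [fk_zero_eq, stepK, if_pos hq, Real.enorm_eq_ofReal (gk_nonneg _ _)]
      rw [lintegral_gk_mul_gk hpδ (mul_pos (h.a_pos q) (sub_pos.2 hq)), add_comm]
    · have : ∀ z, fk a 0 (z, p.2 - δ) q = 0 := fun z => fk_of_le h 0 (not_lt.1 hq)
      simp [this, stepK, hq]
  have key := integral_comp_swap (μ := (volume : Measure ℝ)) (ν := (volume : Measure (ℝ × ℝ)))
    (k₁ := fun z => gk (a p * δ) (p.1 - z)) (k₂ := fun z q => fk a 0 (z, p.2 - δ) q) (F := ψ)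
    (by fun_prop) (h.measurable_fk_comp 0 (by fun_prop) (by fun_prop)) hψ.meas ?_
  · rw [← key.2.2]
    simp_rw [e1]
  · simp_rw [e2]
    refine (hψ.lintegral_le (c := 64 * M) (by have := h.M_pos; positivity) one_pos h0 hp
      (fun q _ => hb δ hδ p q)).trans_lt ?_
    exact ENNReal.mul_lt_top (ENNReal.mul_lt_top ENNReal.coe_lt_top ENNReal.coe_lt_top)
      ENNReal.ofReal_lt_top

lemma integral_lastK (h : IsCoeff m M L a) {δ : ℝ} (hδ : 0 < δ) (p : ℝ × ℝ) :
    Integrable (lastK a δ p) ∧ ∫ q, lastK a δ p q = δ := by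
  have hnn : ∀ q, 0 ≤ lastK a δ p q := fun q => by
    unfold lastK; split_ifs
    · exact gk_nonneg _ _
    · exact le_rfl
  have hl : ∫⁻ q, ENNReal.ofReal (lastK a δ p q) = ENNReal.ofReal δ := by
    have := lintegral_tw_hk_after (h.a_pos p) (ρ := 0) one_pos (p := p) (θ := p.2 - δ)
      (by linarith)
    simp only [sub_zero, sub_sub_cancel, Real.rpow_one, div_one] at this
    rw [← this, ← lintegral_indicator (measurableSet_after _)]
    congr 1; funext q
    by_cases hq : p.2 - δ < q.2
    · rcases le_or_gt p.2 q.2 with h1 | h1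
      · simp [lastK, indicator, hq, hk_of_le (h.a_pos p).le h1,
          gk_of_nonpos (mul_nonpos_of_nonneg_of_nonpos (h.a_pos p).le (sub_nonpos.2 h1))]
      · simp [lastK, indicator, hq, hk, tw_of_pos (sub_pos.2 h1)]
    · simp [lastK, indicator, hq]
  have hm := IsCoeff.measurable_lastK (a := a) δ p
  refine ⟨⟨hm.aestronglyMeasurable, ?_⟩, ?_⟩
  · rw [HasFiniteIntegral]
    simp_rw [Real.enorm_eq_ofReal (hnn _)]
    rw [hl]; exact ENNReal.ofReal_lt_top
  · rw [integral_eq_lintegral_of_nonneg_ae (Filter.Eventually.of_forall hnn)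
      hm.aestronglyMeasurable, hl, ENNReal.toReal_ofReal hδ.le]

/-- Averaging over the last step changes the variance from a(q)σ to a(q)σ + (a(p) - a(q))δ. The
linear term of the Taylor expansion is δ times the error kernel without damping, so only the
quadratic remainder is left. One of its two coefficient differences is bounded by M, the other gains
σ^(1/4). -/
lemma exists_far_bound (h : IsCoeff m M L a) (S : ℝ) : ∃ C : ℝ≥0, ∀ δ : ℝ, 0 < δ →
    ∀ p q : ℝ × ℝ, q.2 < p.2 - δ → p.2 - q.2 ≤ S →
      ‖fk a 0 p q - stepK a δ p q + δ * ((a p - a q) * fk a 2 p q)‖ₑ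
        ≤ C * ENNReal.ofReal (δ ^ (9 / 8 : ℝ)) * (tw (7 / 8) (p.2 - q.2) * hk (64 * M) p q) := by
  obtain ⟨C₁, hC₁, hb₁⟩ := exists_gk_taylor h.m_pos h.m_le_M
  obtain ⟨C₂, hC₂, hb₂⟩ := exists_coeff_sub_mul_gk_le h.m_pos h.m_le_M h.L_nonneg
  have hM := h.M_pos
  rcases le_or_gt S 0 with hS | hS
  · exact ⟨0, fun δ hδ p q hq hpq => by linarith⟩
  refine ⟨(C₁ * M * C₂ * (1 + S ^ (1 / 4 : ℝ))).toNNReal, fun δ hδ p q hq hpq => ?_⟩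
  have hσ : 0 < p.2 - q.2 := by linarith
  have hδσ : δ ≤ p.2 - q.2 := by linarith
  rw [tw_of_pos hσ, hk]
  have hv0 := h.frozen_var_mem hσ.le q
  have hv1 := h.step_var_mem hδ.le hq.le
  have t1 := hb₁ _ (p.1 - q.1) hσ _ hv0 _ hv1
  have t2 := hb₂ a h p q (16 * M * (p.2 - q.2)) hσ (by nlinarith [h.m_le_M, h.m_pos])
    (by nlinarith)
  have t3 := rpow_quarter_add_half_le hσ hpq
  have t4 := h.abs_sub_le p q
  have hd : a q * (p.2 - δ - q.2) + a p * δ - a q * (p.2 - q.2) = (a p - a q) * δ := by ring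
  rw [hd] at t1
  rw [mul_assoc (ENNReal.ofNNReal _), ← mul_assoc (ENNReal.ofReal (δ ^ (9 / 8 : ℝ))),
    ← ENNReal.ofReal_mul (by positivity)]
  apply enorm_le_nnreal_mul (by positivity) (by positivity)
  simp only [stepK, if_pos hq, fk]
  set σ := p.2 - q.2
  set z := p.1 - q.1
  set G := gk (64 * M * σ) z
  have hG : 0 ≤ G := gk_nonneg _ _
  have hG16 := gk_nonneg (16 * M * σ) z
  -- The remainder δ² σ^(-7/4) is not integrable at σ = 0, but here δ ≤ σ. Giving up (δ/σ)^(7/8)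
  -- leaves an integrable power of σ and more than one power of δ.
  have key : δ ^ 2 * (σ ^ (-2 : ℝ) * σ ^ (1 / 4 : ℝ)) ≤ δ ^ (9 / 8 : ℝ) * σ ^ (-(7 / 8) : ℝ) := by
    have e1 : δ ^ 2 = δ ^ (9 / 8 : ℝ) * δ ^ (7 / 8 : ℝ) := by
      rw [← Real.rpow_add hδ]; norm_num
    have e2 : σ ^ (-2 : ℝ) * σ ^ (1 / 4 : ℝ) = σ ^ (-(7 / 8) : ℝ) * σ ^ (-(7 / 8) : ℝ) := by
      rw [← Real.rpow_add hσ, ← Real.rpow_add hσ]; norm_num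
    have e3 : δ ^ (7 / 8 : ℝ) * σ ^ (-(7 / 8) : ℝ) ≤ 1 := by
      rw [Real.rpow_neg hσ.le, ← div_eq_mul_inv, div_le_one (by positivity)]
      exact Real.rpow_le_rpow hδ.le hδσ (by norm_num)
    rw [e1, e2]
    calc _ = δ ^ (9 / 8 : ℝ) * σ ^ (-(7 / 8) : ℝ) * (δ ^ (7 / 8 : ℝ) * σ ^ (-(7 / 8) : ℝ)) := by
          ring
      _ ≤ δ ^ (9 / 8 : ℝ) * σ ^ (-(7 / 8) : ℝ) * 1 := by gcongr
      _ = _ := mul_one _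
  calc |gk (a q * σ) z - gk (a q * (p.2 - δ - q.2) + a p * δ) z
        + δ * ((a p - a q) * gkd 2 (a q * σ) z)|
      = |gk (a q * (p.2 - δ - q.2) + a p * δ) z - gk (a q * σ) z
          - (a p - a q) * δ * gkd 2 (a q * σ) z| := by
        rw [← abs_neg]; congr 1; ring
    _ ≤ C₁ * σ ^ (-2 : ℝ) * gk (16 * M * σ) z * |(a p - a q) * δ| ^ 2 := t1
    _ = C₁ * σ ^ (-2 : ℝ) * δ ^ 2 * |a p - a q| * (|a p - a q| * gk (16 * M * σ) z) := by
        rw [abs_mul, abs_of_pos hδ]; ring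
    _ ≤ C₁ * σ ^ (-2 : ℝ) * δ ^ 2 * M * (C₂ * (σ ^ (1 / 4 : ℝ) + σ ^ (1 / 2 : ℝ)) * G) := by
        gcongr
    _ ≤ C₁ * σ ^ (-2 : ℝ) * δ ^ 2 * M * (C₂ * ((1 + S ^ (1 / 4 : ℝ)) * σ ^ (1 / 4 : ℝ)) * G) := by
        gcongr
    _ = C₁ * M * C₂ * (1 + S ^ (1 / 4 : ℝ)) * (δ ^ 2 * (σ ^ (-2 : ℝ) * σ ^ (1 / 4 : ℝ))) * G := by
        ring
    _ ≤ _ := by gcongr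

/-- On the last interval the coefficient may be frozen at p instead of q: the variances differ by
(a(p) - a(q))σ, whose σ cancels the σ^(-1) of a variance derivative. The second bound is matched to
the square-root modulus of the density, so that ψ(q) may be replaced by ψ(p). -/
lemma exists_near_bound (h : IsCoeff m M L a) : ∃ C : ℝ≥0, ∀ δ : ℝ, 0 < δ → δ ≤ 1 →
    ∀ p q : ℝ × ℝ, p.2 - δ < q.2 →
      ‖fk a 0 p q - lastK a δ p q‖ₑ
        ≤ C * ENNReal.ofReal (δ ^ (1 / 4 : ℝ)) * (tw 0 (p.2 - q.2) * hk (64 * M) p q) ∧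
      ENNReal.ofReal (√|p.1 - q.1| + √|p.2 - q.2|) * ‖fk a 0 p q‖ₑ
        ≤ C * ENNReal.ofReal (δ ^ (1 / 4 : ℝ)) * (tw 0 (p.2 - q.2) * hk (64 * M) p q) := by
  obtain ⟨C₁, hC₁, hb₁⟩ := exists_gkd_var_sub_le h.m_pos h.m_le_M (j := 0) (by norm_num)
  obtain ⟨C₂, hC₂, hb₂⟩ := exists_coeff_sub_mul_gk_le h.m_pos h.m_le_M h.L_nonneg
  obtain ⟨C₃, hC₃, hb₃⟩ := exists_sqrt_mul_gk_le h.m_pos h.m_le_M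
  have hM := h.M_pos
  refine ⟨(C₁ * C₂ * 2 + C₃ * 2).toNNReal, fun δ hδ hδ1 p q hq => ?_⟩
  rcases le_or_gt p.2 q.2 with hpq | hpq
  · simp [fk_of_le h 0 hpq, lastK, hq,
      gk_of_nonpos (mul_nonpos_of_nonneg_of_nonpos (h.a_pos p).le (sub_nonpos.2 hpq))]
  have hσ : 0 < p.2 - q.2 := sub_pos.2 hpq
  have hδσ : p.2 - q.2 ≤ δ := by linarith
  rw [tw_of_pos hσ, hk, neg_zero, Real.rpow_zero, ENNReal.ofReal_one, one_mul]
  have hv0 := h.frozen_var_mem hσ.le q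
  have hv1 := h.frozen_var_mem hσ.le p
  have t1 := hb₁ _ (p.1 - q.1) hσ _ hv1 _ hv0
  have t2 := hb₂ a h p q (16 * M * (p.2 - q.2)) hσ (by nlinarith [h.m_le_M, h.m_pos])
    (by nlinarith)
  have t3 := hb₃ _ _ (p.1 - q.1) hσ hv0.1 (by nlinarith [hv0.2])
  have t4 := rpow_quarter_add_half_le hσ (hδσ.trans hδ1)
  have t5 : (p.2 - q.2) ^ (1 / 4 : ℝ) ≤ δ ^ (1 / 4 : ℝ) :=
    Real.rpow_le_rpow hσ.le hδσ (by norm_num)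
  rw [Real.one_rpow] at t4
  have t6 : (p.2 - q.2) ^ (1 / 4 : ℝ) + (p.2 - q.2) ^ (1 / 2 : ℝ) ≤ 2 * δ ^ (1 / 4 : ℝ) := by
    linarith
  simp only [fk_zero_eq, lastK, if_pos hq]
  set σ := p.2 - q.2
  set z := p.1 - q.1
  set G := gk (64 * M * σ) z
  have hG : 0 ≤ G := gk_nonneg _ _
  constructor
  · rw [mul_assoc]
    apply enorm_le_nnreal_mul (by positivity) (by positivity)
    rw [← mul_sub_right_distrib, abs_mul, abs_of_pos hσ] at t1
    norm_num at t1
    rw [abs_sub_comm (a q)] at t1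
    calc _ ≤ C₁ * σ ^ (-1 : ℝ) * gk (16 * M * σ) z * (|a p - a q| * σ) := by
          simpa [gkd] using t1
      _ = C₁ * (σ ^ (-1 : ℝ) * σ) * (|a p - a q| * gk (16 * M * σ) z) := by ring
      _ = C₁ * (|a p - a q| * gk (16 * M * σ) z) := by
          rw [Real.rpow_neg_one, inv_mul_cancel₀ hσ.ne', mul_one]
      _ ≤ C₁ * (C₂ * (2 * δ ^ (1 / 4 : ℝ)) * G) := by
          have t2' : |a p - a q| * gk (16 * M * σ) z ≤ C₂ * (2 * δ ^ (1 / 4 : ℝ)) * G :=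
            t2.trans (by gcongr)
          gcongr
      _ = C₁ * C₂ * 2 * δ ^ (1 / 4 : ℝ) * G := by ring
      _ ≤ _ := by gcongr; nlinarith
  · rw [Real.enorm_eq_ofReal (gk_nonneg _ _), ← ENNReal.ofReal_mul (by positivity), mul_assoc]
    have := enorm_le_nnreal_mul (x := (√|z| + √|σ|) * gk (a q * σ) z) (g := G)
      (C := C₁ * C₂ * 2 + C₃ * 2) (w := δ ^ (1 / 4 : ℝ)) (by positivity) (by positivity) ?_
    · rwa [Real.enorm_eq_ofReal (mul_nonneg (by positivity) (gk_nonneg _ _))] at this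
    · rw [abs_of_nonneg (mul_nonneg (by positivity) (gk_nonneg _ _))]
      calc _ ≤ _ := t3
        _ ≤ C₃ * (2 * δ ^ (1 / 4 : ℝ)) * G := by gcongr
        _ = C₃ * 2 * δ ^ (1 / 4 : ℝ) * G := by ring
        _ ≤ _ := by gcongr; nlinarith [mul_pos hC₁ hC₂]

end Step

lemma ae_time_ne (θ : ℝ) : ∀ᵐ r : ℝ × ℝ, r.2 ≠ θ := by
  have : (volume : Measure (ℝ × ℝ)) (univ ×ˢ {θ}) = 0 := by
    rw [Measure.volume_eq_prod, Measure.prod_prod]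
    simp
  refine measure_mono_null (fun r hr => ?_) this
  simpa using hr

section OneStep

variable {m M L γ τ₀ T : ℝ} {a : ℝ × ℝ → ℝ} {B : ℝ≥0} {ψ : ℝ × ℝ → ℝ}

/-- The bound of the error kernel for damping constant 0. -/
lemma exists_coeff_sub_mul_fk_bound (h : IsCoeff m M L a) (S : ℝ) : ∃ C : ℝ≥0,
    ∀ p q : ℝ × ℝ, p.2 - q.2 ≤ S →
      ‖(a p - a q) * fk a 2 p q‖ₑ ≤ C * (tw (3 / 4) (p.2 - q.2) * hk (64 * M) p q) := by
  obtain ⟨C, hb⟩ := exists_ek_bound_tw h le_rfl S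
  exact ⟨C, fun p q hpq => by simpa [ek] using hb p q hpq⟩

/-- The potential of a solution of the Volterra equation almost solves the equation over one
time step. -/
lemma exists_one_step (h : IsCoeff m M L a) (hγ : 0 ≤ γ) (hψ : IsBddDensity τ₀ T B ψ)
    (hV : ∀ p : ℝ × ℝ, τ₀ < p.2 → p.2 ≤ T → ψ p = 1 + ∫ q, ek a γ p q * ψ q) :
    ∃ C : ℝ≥0, ∀ ε δ : ℝ, 0 < ε → ε ≤ 1 → 0 < δ → δ ≤ 1 → ∀ p : ℝ × ℝ,
      τ₀ ≤ p.2 - δ → p.2 ≤ T →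
      ‖(∫ q, fk a 0 p q * ψ q)
          - (∫ z, gk (a p * δ) (p.1 - z) * ∫ q, fk a 0 (z, p.2 - δ) q * ψ q)
          - δ * (1 - γ * ∫ q, fk a 0 p q * ψ q)‖ₑ
        ≤ C * ENNReal.ofReal (δ * (ε ^ (1 / 4 : ℝ) + (ε ^ 2)⁻¹ * δ ^ (1 / 8 : ℝ))) := by
  obtain ⟨Cf, hCf⟩ := exists_far_bound h (T - τ₀)
  obtain ⟨Cn, hCn⟩ := exists_near_bound h
  obtain ⟨Cm, hCm⟩ := exists_error_potential_modulus h hγ hψ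
  obtain ⟨C₀, hC₀⟩ := exists_fk_bound_nnreal h (j := 0) (by norm_num)
  obtain ⟨C₃, hC₃⟩ := exists_coeff_sub_mul_fk_bound h (T - τ₀)
  obtain ⟨Cs, hCs⟩ := h.exists_stepK_bound
  have hM := h.M_pos
  have hM' : 0 < 64 * M := by positivity
  set S := ENNReal.ofReal ((T - τ₀) ^ (1 / 8 : ℝ) * 8) with hS
  refine ⟨Cm * C₀ + (Cf * B * ((T - τ₀) ^ (1 / 8 : ℝ) * 8).toNNReal + Cm * Cn + Cn * B
    + C₃ * B * 4), fun ε δ hε hε1 hδ hδ1 p hpδ hp => ?_⟩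
  push_cast
  change _ ≤ (Cm * C₀ + (Cf * B * S + Cm * Cn + Cn * B + C₃ * B * 4)) * _
  simp only [Nat.cast_zero, zero_div] at hC₀
  have hp0 : τ₀ < p.2 := by linarith
  have hm0 : Measurable fun q => fk a 0 p q := h.measurable_fk_comp 0 measurable_const measurable_id
  have hm2 : Measurable fun q => (a p - a q) * fk a 2 p q :=
    (measurable_const.sub h.cont.measurable).mul
      (h.measurable_fk_comp 2 measurable_const measurable_id)
  have i0 := hψ.integrable_mul hM' one_pos hp0.le hp hm0 (fun q _ => hC₀ p q)
  have i2 := hψ.integrable_mul hM' (by norm_num) hp0.le hp hm2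
    (fun q hq => hC₃ p q (by linarith))
  have is := hψ.integrable_mul hM' one_pos hp0.le hp (h.measurable_stepK δ p)
    (fun q _ => hCs δ hδ p q)
  have il := integral_lastK h hδ p
  have hE : (∫ q, ek a γ p q * ψ q)
      = (∫ q, (a p - a q) * fk a 2 p q * ψ q) - γ * ∫ q, fk a 0 p q * ψ q := by
    rw [← integral_const_mul, ← integral_sub i2 (i0.const_mul γ)]
    congr 1; funext q; unfold ek; ring
  -- As `lastK` has integral δ, subtracting `lastK` times ψ(p) subtracts δψ(p). The Volterra
  -- equation at p turns this into δ(1 - γU), with U the potential, plus δ times the undamped error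
  -- potential, which cancels the term added to the far kernel.
  have hident : (∫ q, fk a 0 p q * ψ q)
          - (∫ z, gk (a p * δ) (p.1 - z) * ∫ q, fk a 0 (z, p.2 - δ) q * ψ q)
          - δ * (1 - γ * ∫ q, fk a 0 p q * ψ q)
      = ∫ q, ((fk a 0 p q - stepK a δ p q + δ * ((a p - a q) * fk a 2 p q)) * ψ q
          - lastK a δ p q * ψ p) := by
    rw [integral_step_potential h hψ hδ hp0.le hp]
    have e1 : ∀ q, (fk a 0 p q - stepK a δ p q + δ * ((a p - a q) * fk a 2 p q)) * ψ q
          - lastK a δ p q * ψ p = (fk a 0 p q * ψ q - stepK a δ p q * ψ q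
            + δ * ((a p - a q) * fk a 2 p q * ψ q)) - lastK a δ p q * ψ p := fun q => by ring
    simp_rw [e1]
    have j1 : Integrable fun q => fk a 0 p q * ψ q - stepK a δ p q * ψ q := i0.sub is
    have j2 : Integrable fun q => δ * ((a p - a q) * fk a 2 p q * ψ q) := i2.const_mul δ
    have j12 : Integrable fun q => fk a 0 p q * ψ q - stepK a δ p q * ψ q
        + δ * ((a p - a q) * fk a 2 p q * ψ q) := j1.add j2
    have j3 : Integrable fun q => lastK a δ p q * ψ p := il.1.mul_const _
    rw [integral_sub j12 j3, integral_add j1 j2, integral_sub i0 is, integral_const_mul,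
      integral_mul_const, il.2]
    have := hV p hp0 hp
    rw [hE] at this
    linear_combination δ * this
  rw [hident]
  refine (enorm_integral_le_lintegral_enorm _).trans ?_
  set E4 := ENNReal.ofReal (ε ^ (1 / 4 : ℝ))
  set Ei := ENNReal.ofReal ((ε ^ 2)⁻¹) with hEi
  set d := ENNReal.ofReal δ
  set d4 := ENNReal.ofReal (δ ^ (1 / 4 : ℝ)) with hd4
  set d8 := ENNReal.ofReal (δ ^ (1 / 8 : ℝ)) with hd8
  set c₇ : ℝ≥0∞ := Cf * (d * d8) * B
  set c₀ : ℝ≥0∞ := Cm * (E4 * C₀ + Ei * (Cn * d4)) + Cn * d4 * B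
  set c₃ : ℝ≥0∞ := d * C₃ * B
  have hd98 : ENNReal.ofReal (δ ^ (9 / 8 : ℝ)) = d * d8 := by
    rw [← ENNReal.ofReal_mul hδ.le, ← Real.rpow_one_add' hδ.le (by norm_num)]; norm_num
  -- Before p.2 - δ only the Taylor remainder is present. Afterwards `stepK` is zero, and the terms
  -- are the oscillation of ψ, the refreezing of the coefficient and the error potential of a short
  -- interval. The time p.2 - δ itself is a null set.
  have hpt : ∀ᵐ q : ℝ × ℝ, ‖(fk a 0 p q - stepK a δ p q + δ * ((a p - a q) * fk a 2 p q)) * ψ q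
          - lastK a δ p q * ψ p‖ₑ
      ≤ {q : ℝ × ℝ | τ₀ < q.2}.indicator
          (fun q => c₇ * (tw (7 / 8) (p.2 - q.2) * hk (64 * M) p q)) q
        + {q : ℝ × ℝ | p.2 - δ < q.2}.indicator
          (fun q => c₀ * (tw 0 (p.2 - q.2) * hk (64 * M) p q)
            + c₃ * (tw (3 / 4) (p.2 - q.2) * hk (64 * M) p q)) q := by
    filter_upwards [ae_time_ne (p.2 - δ)] with q hq
    rcases lt_or_gt_of_ne hq with hq | hq
    · refine le_add_right ?_
      have hl : lastK a δ p q = 0 := by unfold lastK; rw [if_neg (not_lt.2 hq.le)]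
      rcases le_or_gt q.2 τ₀ with h0 | h0
      · simp [hl, hψ.zero q h0]
      · rw [hl, zero_mul, sub_zero, enorm_mul, indicator_of_mem (by simpa using h0)]
        calc _ ≤ Cf * (d * d8) * (tw (7 / 8) (p.2 - q.2) * hk (64 * M) p q) * B := by
              rw [← hd98]
              exact mul_le_mul' (hCf δ hδ p q hq (by linarith)) (hψ.bdd q (by linarith))
          _ = _ := by ring
    · refine le_add_left ?_
      have hs : stepK a δ p q = 0 := by unfold stepK; rw [if_neg (not_lt.2 hq.le)]
      rw [hs, indicator_of_mem (by simpa using hq)]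
      rcases le_or_gt p.2 q.2 with hpq | hpq
      · have hl : lastK a δ p q = 0 := by
          unfold lastK
          rw [if_pos hq,
            gk_of_nonpos (mul_nonpos_of_nonneg_of_nonpos (h.a_pos p).le (sub_nonpos.2 hpq))]
        simp [hl, fk_of_le h _ hpq]
      have e1 : (fk a 0 p q - 0 + δ * ((a p - a q) * fk a 2 p q)) * ψ q - lastK a δ p q * ψ p
          = fk a 0 p q * (ψ q - ψ p) + (fk a 0 p q - lastK a δ p q) * ψ p
            + δ * ((a p - a q) * fk a 2 p q) * ψ q := by ring
      have hq0 : τ₀ < q.2 := by linarith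
      obtain ⟨n1, n2⟩ := hCn δ hδ hδ1 p q hq
      set W := tw 0 (p.2 - q.2) * hk (64 * M) p q
      have hmod : ‖ψ q - ψ p‖ₑ ≤ Cm * (E4 + Ei * ENNReal.ofReal (√|p.1 - q.1| + √|p.2 - q.2|)) := by
        have := hCm ε hε hε1 p q hq0.le hpq.le hp
        rw [ENNReal.ofReal_add (by positivity) (by positivity),
          ENNReal.ofReal_mul (by positivity)] at this
        rw [hV p hp0 hp, hV q hq0 (by linarith), add_sub_add_left_eq_sub, ← enorm_neg, neg_sub]
        exact this
      rw [e1]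
      refine (enorm_add_le _ _).trans (add_le_add ((enorm_add_le _ _).trans ?_) ?_)
      · rw [enorm_mul, enorm_mul, add_mul]
        refine add_le_add ?_ ?_
        · calc _ ≤ ‖fk a 0 p q‖ₑ *
                (Cm * (E4 + Ei * ENNReal.ofReal (√|p.1 - q.1| + √|p.2 - q.2|))) := by gcongr
            _ = Cm * (E4 * ‖fk a 0 p q‖ₑ
                + Ei * (ENNReal.ofReal (√|p.1 - q.1| + √|p.2 - q.2|) * ‖fk a 0 p q‖ₑ)) := by ring
            _ ≤ Cm * (E4 * (C₀ * W) + Ei * (Cn * d4 * W)) := by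
                gcongr
                exact hC₀ p q
            _ = _ := by ring
        · calc _ ≤ Cn * d4 * W * B := mul_le_mul' n1 (hψ.bdd p hp)
            _ = _ := by ring
      · rw [enorm_mul, enorm_mul, Real.enorm_eq_ofReal hδ.le]
        calc _ ≤ d * (C₃ * (tw (3 / 4) (p.2 - q.2) * hk (64 * M) p q)) * B :=
              mul_le_mul' (mul_le_mul_right (hC₃ p q (by linarith)) _) (hψ.bdd q (by linarith))
          _ = _ := by ring
  refine (lintegral_mono_ae hpt).trans ?_
  rw [lintegral_add_left (by exact Measurable.indicator (by fun_prop) (measurableSet_after _)),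
    lintegral_indicator (measurableSet_after _), lintegral_indicator (measurableSet_after _),
    lintegral_add_left (by fun_prop), lintegral_const_mul _ (by fun_prop),
    lintegral_const_mul _ (by fun_prop), lintegral_const_mul _ (by fun_prop),
    lintegral_tw_hk_after hM' (by norm_num) hp0.le,
    lintegral_tw_hk_after hM' (by norm_num) (by linarith),
    lintegral_tw_hk_after hM' (by norm_num) (by linarith)]
  have j1 : ENNReal.ofReal ((p.2 - τ₀) ^ (1 - 7 / 8 : ℝ) / (1 - 7 / 8)) ≤ S := by
    apply ENNReal.ofReal_le_ofReal
    have : (p.2 - τ₀) ^ (1 / 8 : ℝ) ≤ (T - τ₀) ^ (1 / 8 : ℝ) := by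
      apply Real.rpow_le_rpow <;> linarith
    rw [show (1 - 7 / 8 : ℝ) = 1 / 8 by norm_num]
    linarith
  have j2 : ENNReal.ofReal ((p.2 - (p.2 - δ)) ^ (1 - 0 : ℝ) / (1 - 0)) = d := by
    simp [d]
  have j3 : ENNReal.ofReal ((p.2 - (p.2 - δ)) ^ (1 - 3 / 4 : ℝ) / (1 - 3 / 4)) = 4 * d4 := by
    rw [show (4 : ℝ≥0∞) = ENNReal.ofReal 4 by norm_num, ← ENNReal.ofReal_mul (by norm_num)]
    rw [show (1 - 3 / 4 : ℝ) = 1 / 4 by norm_num, sub_sub_cancel]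
    congr 1
    ring
  rw [j2, j3, ENNReal.ofReal_mul hδ.le, ENNReal.ofReal_add (by positivity) (by positivity),
    ENNReal.ofReal_mul (by positivity)]
  have k1 : d4 ≤ d8 := by
    apply ENNReal.ofReal_le_ofReal
    exact Real.rpow_le_rpow_of_exponent_ge hδ hδ1 (by norm_num)
  have k2 : 1 ≤ Ei := by
    rw [← ENNReal.ofReal_one]
    apply ENNReal.ofReal_le_ofReal
    rw [one_le_inv₀ (by positivity)]
    exact pow_le_one₀ hε.le hε1
  calc _ ≤ c₇ * S + (c₀ * d + c₃ * (4 * d4)) := by gcongr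
    _ = d * (E4 * (Cm * C₀) + (1 * d8 * (Cf * B * S) + Ei * d4 * (Cm * Cn)
          + 1 * d4 * (Cn * B) + 1 * d4 * (C₃ * B * 4))) := by ring
    _ ≤ d * (E4 * (Cm * C₀) + (Ei * d8 * (Cf * B * S) + Ei * d8 * (Cm * Cn)
          + Ei * d8 * (Cn * B) + Ei * d8 * (C₃ * B * 4))) := by gcongr
    _ ≤ d * (E4 * (Cm * C₀) + (Ei * d8 * (Cf * B * S) + Ei * d8 * (Cm * Cn)
          + Ei * d8 * (Cn * B) + Ei * d8 * (C₃ * B * 4)))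
          + d * (E4 * (Cf * B * S + Cm * Cn + Cn * B + C₃ * B * 4) + Ei * d8 * (Cm * C₀)) :=
        le_self_add
    _ = _ := by ring

end OneStep

/-! ### Uniqueness: the potential of the constant source -/

section Uniqueness

variable {m M L γ τ₀ T : ℝ} {a : ℝ × ℝ → ℝ} {B : ℝ≥0} {ψ : ℝ × ℝ → ℝ}

lemma measurable_fk_potential (h : IsCoeff m M L a) (j : ℕ) (hψ : Measurable ψ) :
    Measurable fun p => ∫ q, fk a j p q * ψ q :=
  ((measurable_fk h j).mul
    (hψ.comp measurable_snd)).stronglyMeasurable.integral_prod_right'.measurable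

/-- The solution of `u' + γ u = 1` starting from `0` at time `τ₀`. -/
noncomputable def dampedTime (γ τ₀ t : ℝ) : ℝ := (1 - Real.exp (-γ * (t - τ₀))) / γ

lemma dampedTime_step (hγ : 0 < γ) {t δ : ℝ} (hδ : 0 ≤ δ) (hγδ : γ * δ ≤ 1) (ht : τ₀ ≤ t) :
    |dampedTime γ τ₀ t - dampedTime γ τ₀ (t - δ) - δ * (1 - γ * dampedTime γ τ₀ t)|
      ≤ γ * δ ^ 2 := by
  have e : dampedTime γ τ₀ t - dampedTime γ τ₀ (t - δ) - δ * (1 - γ * dampedTime γ τ₀ t)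
      = Real.exp (-γ * (t - τ₀)) * ((Real.exp (γ * δ) - 1 - γ * δ) / γ) := by
    unfold dampedTime
    rw [show -γ * (t - δ - τ₀) = -γ * (t - τ₀) + γ * δ by ring, Real.exp_add]
    field_simp
    ring
  have h0 : 0 ≤ γ * δ := by positivity
  have h1 : |Real.exp (γ * δ) - 1 - γ * δ| ≤ (γ * δ) ^ 2 :=
    Real.abs_exp_sub_one_sub_id_le (by rwa [abs_of_nonneg h0])
  have h2 : Real.exp (-γ * (t - τ₀)) ≤ 1 := Real.exp_le_one_iff.2 (by nlinarith)
  rw [e, abs_mul, abs_div, abs_of_pos (Real.exp_pos _), abs_of_pos hγ]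
  calc _ ≤ 1 * ((γ * δ) ^ 2 / γ) := by gcongr
    _ = _ := by field_simp

lemma IsBddDensity.exists_potential_bound (h : IsCoeff m M L a) (hψ : IsBddDensity τ₀ T B ψ) :
    ∃ D : ℝ, ∀ p : ℝ × ℝ, τ₀ ≤ p.2 → p.2 ≤ T → |∫ q, fk a 0 p q * ψ q| ≤ D := by
  obtain ⟨C₀, hC₀⟩ := exists_fk_bound_nnreal h (j := 0) (by norm_num)
  simp only [Nat.cast_zero, zero_div] at hC₀
  have hM := h.M_pos
  refine ⟨C₀ * B * (T - τ₀), fun p h0 hp => ?_⟩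
  have h1 := (enorm_integral_mul_le (μ := volume) (fun q => fk a 0 p q) ψ).trans
    (hψ.lintegral_le (by positivity : 0 < 64 * M) one_pos h0 hp (fun q _ => hC₀ p q))
  have h2 : ‖∫ q, fk a 0 p q * ψ q‖ₑ ≤ ENNReal.ofReal (C₀ * B * (T - τ₀)) := by
    refine h1.trans ?_
    rw [ENNReal.ofReal_mul (by positivity), ENNReal.ofReal_mul (by positivity),
      ENNReal.ofReal_coe_nnreal, ENNReal.ofReal_coe_nnreal]
    gcongr
    simp only [sub_zero, Real.rpow_one, div_one]
    linarith
  rw [← ofReal_norm, ENNReal.ofReal_le_ofReal_iff] at h2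
  · simpa using h2
  · have : 0 ≤ T - τ₀ := by linarith
    positivity

/-- Uniqueness by comparison with the explicit space-independent solution along an implicit
time-stepping scheme: consistency is `exists_one_step`, stability is that a Gaussian average does
not increase a supremum. This takes the place of a maximum principle, which would require two
derivatives of the potential. -/
lemma potential_eq_dampedTime (h : IsCoeff m M L a) (hγ : 0 < γ) (hψ : IsBddDensity τ₀ T B ψ)
    (hV : ∀ p : ℝ × ℝ, τ₀ < p.2 → p.2 ≤ T → ψ p = 1 + ∫ q, ek a γ p q * ψ q)
    {x t : ℝ} (ht0 : τ₀ < t) (htT : t ≤ T) :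
    ∫ q, fk a 0 (x, t) q * ψ q = dampedTime γ τ₀ t := by
  obtain ⟨C, hC⟩ := exists_one_step h hγ.le hψ hV
  obtain ⟨D, hD⟩ := hψ.exists_potential_bound h
  have hUm := measurable_fk_potential h 0 hψ.meas
  set U : ℝ × ℝ → ℝ := fun p => ∫ q, fk a 0 p q * ψ q with hU
  set R := t - τ₀ with hR
  have hR0 : 0 < R := sub_pos.2 ht0
  -- one step of size `δ`
  have step : ∀ ε δ : ℝ, 0 < ε → ε ≤ 1 → 0 < δ → δ ≤ 1 → γ * δ ≤ 1 → ∀ s K : ℝ, τ₀ ≤ s - δ →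
      s ≤ T → (∀ z, |U (z, s - δ) - dampedTime γ τ₀ (s - δ)| ≤ K) →
      ∀ z, |U (z, s) - dampedTime γ τ₀ s|
        ≤ K + (C * (δ * (ε ^ (1 / 4 : ℝ) + (ε ^ 2)⁻¹ * δ ^ (1 / 8 : ℝ))) + γ * δ ^ 2) := by
    intro ε δ hε hε1 hδ hδ1 hγδ s K hs hsT hK z
    have e1 := hC ε δ hε hε1 hδ hδ1 (z, s) hs hsT
    have e2 := dampedTime_step hγ hδ.le hγδ (τ₀ := τ₀) (t := s) (by linarith)
    have hpos : 0 ≤ δ * (ε ^ (1 / 4 : ℝ) + (ε ^ 2)⁻¹ * δ ^ (1 / 8 : ℝ)) := by positivity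
    rw [← ofReal_norm, ← ENNReal.ofReal_coe_nnreal, ← ENNReal.ofReal_mul C.coe_nonneg,
      ENNReal.ofReal_le_ofReal_iff (by positivity), Real.norm_eq_abs] at e1
    change |U (z, s) - (∫ y, gk (a (z, s) * δ) (z - y) * U (y, s - δ)) - δ * (1 - γ * U (z, s))|
      ≤ _ at e1
    have hv : 0 < a (z, s) * δ := mul_pos (h.a_pos _) hδ
    have ig : Integrable fun y => gk (a (z, s) * δ) (z - y) :=
      (integrable_gk _).comp_sub_left z
    have hg1 : ∫ y, gk (a (z, s) * δ) (z - y) = 1 := by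
      rw [integral_sub_left_eq_self (fun y => gk (a (z, s) * δ) y)]
      exact integral_gk hv
    have igU : Integrable fun y => gk (a (z, s) * δ) (z - y) * U (y, s - δ) := by
      refine ig.mul_bdd (c := D) (hUm.comp (by fun_prop)).aestronglyMeasurable
        (Filter.Eventually.of_forall fun y => ?_)
      exact hD (y, s - δ) hs (by dsimp only; linarith)
    have hA : |(∫ y, gk (a (z, s) * δ) (z - y) * U (y, s - δ)) - dampedTime γ τ₀ (s - δ)| ≤ K := by
      have e3 : (∫ y, gk (a (z, s) * δ) (z - y) * U (y, s - δ)) - dampedTime γ τ₀ (s - δ)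
          = ∫ y, gk (a (z, s) * δ) (z - y) * (U (y, s - δ) - dampedTime γ τ₀ (s - δ)) := by
        simp_rw [mul_sub]
        rw [integral_sub igU (ig.mul_const _), integral_mul_const, hg1, one_mul]
      rw [e3]
      calc _ ≤ ∫ y, gk (a (z, s) * δ) (z - y) * K := by
            rw [← Real.norm_eq_abs]
            refine norm_integral_le_of_norm_le (ig.mul_const K)
              (Filter.Eventually.of_forall fun y => ?_)
            rw [Real.norm_eq_abs, abs_mul, abs_of_nonneg (gk_nonneg _ _)]
            exact mul_le_mul_of_nonneg_left (hK y) (gk_nonneg _ _)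
        _ = K := by rw [integral_mul_const, hg1, one_mul]
    set W := U (z, s) - dampedTime γ τ₀ s with hW
    set A := ∫ y, gk (a (z, s) * δ) (z - y) * U (y, s - δ)
    -- The damping term is evaluated at the new time, so it appears as the factor 1 + γδ ≥ 1 in
    -- front of the new error and can be dropped.
    have e4 : (1 + γ * δ) * W = (A - dampedTime γ τ₀ (s - δ))
        + ((U (z, s) - A - δ * (1 - γ * U (z, s)))
          - (dampedTime γ τ₀ s - dampedTime γ τ₀ (s - δ) - δ * (1 - γ * dampedTime γ τ₀ s))) := by
      rw [hW]; ring
    have e5 : |W| ≤ |(1 + γ * δ) * W| := by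
      rw [abs_mul]
      have : 1 ≤ |1 + γ * δ| := by
        rw [abs_of_pos (by positivity)]
        linarith [mul_pos hγ hδ]
      nlinarith [abs_nonneg W]
    rw [e4] at e5
    have e6 := abs_add_le (A - dampedTime γ τ₀ (s - δ))
      ((U (z, s) - A - δ * (1 - γ * U (z, s)))
          - (dampedTime γ τ₀ s - dampedTime γ τ₀ (s - δ) - δ * (1 - γ * dampedTime γ τ₀ s)))
    have e7 := abs_sub (U (z, s) - A - δ * (1 - γ * U (z, s)))
      (dampedTime γ τ₀ s - dampedTime γ τ₀ (s - δ) - δ * (1 - γ * dampedTime γ τ₀ s))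
    linarith
  -- iteration of the step
  have bound : ∀ ε : ℝ, 0 < ε → ε ≤ 1 → ∀ᶠ N : ℕ in Filter.atTop,
      |U (x, t) - dampedTime γ τ₀ t| ≤ C * (R * (ε ^ (1 / 4 : ℝ)
        + (ε ^ 2)⁻¹ * (R / N) ^ (1 / 8 : ℝ))) + γ * (R * (R / N)) := by
    intro ε hε hε1
    have ht : Filter.Tendsto (fun N : ℕ => R / N) Filter.atTop (𝓝 0) :=
      tendsto_const_div_atTop_nhds_zero_nat R
    have h1 : ∀ᶠ N : ℕ in Filter.atTop, R / N ≤ 1 := ht.eventually_le_const one_pos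
    have h2 : ∀ᶠ N : ℕ in Filter.atTop, γ * (R / N) ≤ 1 := by
      have := ht.const_mul γ
      rw [mul_zero] at this
      exact this.eventually_le_const one_pos
    filter_upwards [h1, h2, Filter.eventually_gt_atTop 0] with N hN1 hN2 hN0
    have hN : (0 : ℝ) < N := by exact_mod_cast hN0
    set δ := R / N with hδd
    have hδ : 0 < δ := by positivity
    have hNδ : N * δ = R := by rw [hδd]; field_simp
    have ind : ∀ k : ℕ, k ≤ N → ∀ z, |U (z, τ₀ + k * δ) - dampedTime γ τ₀ (τ₀ + k * δ)|
        ≤ k * (C * (δ * (ε ^ (1 / 4 : ℝ) + (ε ^ 2)⁻¹ * δ ^ (1 / 8 : ℝ))) + γ * δ ^ 2) := by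
      intro k
      induction k with
      | zero =>
        intro _ z
        have hz : U (z, τ₀) = 0 := by
          rw [hU]
          refine integral_eq_zero_of_ae (Filter.Eventually.of_forall fun q => ?_)
          rcases le_or_gt q.2 τ₀ with hq | hq
          · simp [hψ.zero q hq]
          · simp [fk_of_le h 0 (show (z, τ₀).2 ≤ q.2 from hq.le)]
        simp [hz, dampedTime]
      | succ k ih =>
        intro hk z
        have hk' : ((k + 1 : ℕ) : ℝ) ≤ N := by exact_mod_cast hk
        have hle : ((k + 1 : ℕ) : ℝ) * δ ≤ R := by rw [← hNδ]; gcongr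
        have es : τ₀ + ((k + 1 : ℕ) : ℝ) * δ - δ = τ₀ + k * δ := by push_cast; ring
        have := step ε δ hε hε1 hδ hN1 hN2 (τ₀ + ((k + 1 : ℕ) : ℝ) * δ) _
          (by rw [es]; nlinarith [(Nat.cast_nonneg k : (0 : ℝ) ≤ k)]) (by linarith)
          (by rw [es]; exact ih (by omega)) z
        refine this.trans (le_of_eq ?_)
        push_cast
        ring
    have := ind N le_rfl x
    rw [hNδ, show τ₀ + R = t by rw [hR]; ring] at this
    refine this.trans (le_of_eq ?_)
    rw [← hNδ]
    ring
  -- The order of the limits matters: first N → ∞ with ε fixed, which removes the term with ε^(-2),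
  -- and only then ε → 0.
  have lim1 : ∀ ε : ℝ, 0 < ε → ε ≤ 1 → |U (x, t) - dampedTime γ τ₀ t|
      ≤ C * (R * ε ^ (1 / 4 : ℝ)) := by
    intro ε hε hε1
    have ht : Filter.Tendsto (fun N : ℕ => R / N) Filter.atTop (𝓝 0) :=
      tendsto_const_div_atTop_nhds_zero_nat R
    have ht8 : Filter.Tendsto (fun N : ℕ => (R / N) ^ (1 / 8 : ℝ)) Filter.atTop (𝓝 0) := by
      have := ht.rpow_const (p := 1 / 8) (Or.inr (by norm_num))
      rwa [Real.zero_rpow (by norm_num)] at this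
    have hl : Filter.Tendsto (fun N : ℕ => C * (R * (ε ^ (1 / 4 : ℝ)
        + (ε ^ 2)⁻¹ * (R / N) ^ (1 / 8 : ℝ))) + γ * (R * (R / N))) Filter.atTop
        (𝓝 (C * (R * (ε ^ (1 / 4 : ℝ) + (ε ^ 2)⁻¹ * 0)) + γ * (R * 0))) :=
      ((((ht8.const_mul _).const_add _).const_mul _).const_mul _).add
        ((ht.const_mul _).const_mul _)
    refine (ge_of_tendsto hl (bound ε hε hε1)).trans (le_of_eq ?_)
    ring
  have lim2 : |U (x, t) - dampedTime γ τ₀ t| ≤ 0 := by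
    have hl : Filter.Tendsto (fun ε : ℝ => C * (R * ε ^ (1 / 4 : ℝ))) (𝓝[>] 0)
        (𝓝 (C * (R * 0))) := by
      refine Filter.Tendsto.const_mul _ (Filter.Tendsto.const_mul _ ?_)
      have : Filter.Tendsto (fun ε : ℝ => ε ^ (1 / 4 : ℝ)) (𝓝 0) (𝓝 ((0 : ℝ) ^ (1 / 4 : ℝ))) :=
        Filter.tendsto_id.rpow_const (Or.inr (by norm_num))
      rw [Real.zero_rpow (by norm_num)] at this
      exact this.mono_left nhdsWithin_le_nhds
    rw [mul_zero, mul_zero] at hl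
    refine ge_of_tendsto hl ?_
    filter_upwards [Ioc_mem_nhdsGT (zero_lt_one' ℝ)] with ε hε
    exact lim1 ε hε.1 hε.2
  exact sub_eq_zero.1 (abs_nonpos_iff.1 lim2)

end Uniqueness

/-! ### The density of a source -/

/-- The density of the single-layer representation of the Duhamel integral of `F`. -/
noncomputable def dens (a : ℝ × ℝ → ℝ) (γ : ℝ) (F : ℝ × ℝ → ℝ) (p : ℝ × ℝ) : ℝ :=
  F p + ∫ q, densK a γ p q * F q

section Density

variable {m M L γ τ₀ T : ℝ} {a : ℝ × ℝ → ℝ} {B : ℝ≥0} {F : ℝ × ℝ → ℝ}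

lemma IsCoeff.measurable_dens (h : IsCoeff m M L a) (hγ : 0 ≤ γ) (hF : Measurable F) :
    Measurable (dens a γ F) :=
  hF.add ((measurable_densK hγ h).mul
    (hF.comp measurable_snd)).stronglyMeasurable.integral_prod_right'.measurable

lemma exists_densK_bound_tw (hm : 0 < m) (hmM : m ≤ M) (hL : 0 ≤ L) (hγ : 0 ≤ γ) (S : ℝ) :
    ∃ C : ℝ≥0, ∀ a : ℝ × ℝ → ℝ, IsCoeff m M L a → ∀ p q : ℝ × ℝ, p.2 - q.2 ≤ S →
      ‖densK a γ p q‖ₑ ≤ C * (tw (3 / 4) (p.2 - q.2) * hk (64 * M) p q) ∧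
      ∫⁻ r, ‖ek a γ p r‖ₑ * ‖densK a γ r q‖ₑ
        ≤ C * (tw (3 / 4) (p.2 - q.2) * hk (64 * M) p q) := by
  obtain ⟨C, ν, hC, hν, hb⟩ := exists_densK_bound hm hmM hL hγ
  obtain ⟨C₁, hC₁, hb₁⟩ := exists_ek_bound hm hmM hL hγ
  have hM : 0 < M := hm.trans_le hmM
  set E := Real.exp ((1 + ν) * S)
  set K := 8 * Real.Gamma (1 / 4) * ν ^ (-(1 / 4) : ℝ)
  refine ⟨C.toNNReal * E.toNNReal + C₁.toNNReal * C.toNNReal * K.toNNReal * E.toNNReal,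
    fun a h p q hpq => ⟨?_, ?_⟩⟩
  · have hk1 := kw_le_tw (μ := 1 + ν) (by linarith) hpq
    refine (hb a h p q).1.trans ?_
    push_cast
    rw [add_mul]
    refine le_add_right ?_
    calc _ ≤ ENNReal.ofReal C * (ENNReal.ofReal E * tw (3 / 4) (p.2 - q.2) * hk (64 * M) p q) := by
          gcongr
      _ = (C.toNNReal : ℝ≥0∞) * (E.toNNReal : ℝ≥0∞) * _ := by
          rw [ENNReal.ofNNReal_toNNReal, ENNReal.ofNNReal_toNNReal]; ring
  · have hk1 := kw_le_tw (μ := 1 + ν) (by linarith) hpq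
    refine (lintegral_enorm_mul_le (c := 64 * M) (by positivity) (measurable_kw _)
      (measurable_kw _) (fun _ => kw_of_nonpos) (fun _ => kw_of_nonpos) (hb₁ a h)
      (fun p q => (hb a h p q).1) p q).trans ?_
    push_cast
    rw [add_mul]
    refine le_add_left ?_
    calc _ ≤ ENNReal.ofReal C₁ * ENNReal.ofReal C * (ENNReal.ofReal K *
          (ENNReal.ofReal E * tw (3 / 4) (p.2 - q.2)) * hk (64 * M) p q) := by
          gcongr
          exact (kw_tconv_le hν _).trans (mul_le_mul_right hk1 _)
      _ = (C₁.toNNReal : ℝ≥0∞) * (C.toNNReal : ℝ≥0∞) * (K.toNNReal : ℝ≥0∞)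
            * (E.toNNReal : ℝ≥0∞) * _ := by
          simp only [ENNReal.ofNNReal_toNNReal]; ring

namespace IsBddDensity

lemma lintegral_majorant_le (hF : IsBddDensity τ₀ T B F) {c : ℝ} (hc : 0 < c) {ρ : ℝ}
    (hρ : ρ < 1) {p : ℝ × ℝ} (h0 : τ₀ ≤ p.2) (hp : p.2 ≤ T) :
    ∫⁻ q, tw ρ (p.2 - q.2) * hk c p q * ‖F q‖ₑ
      ≤ B * ENNReal.ofReal ((p.2 - τ₀) ^ (1 - ρ) / (1 - ρ)) := by
  have e : ∀ q, ‖(tw ρ (p.2 - q.2) * hk c p q).toReal‖ₑ = tw ρ (p.2 - q.2) * hk c p q :=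
    fun q => by
      rw [Real.enorm_eq_ofReal ENNReal.toReal_nonneg, ENNReal.ofReal_toReal
        (ENNReal.mul_lt_top (tw_lt_top _ _) (hk_lt_top _ _ _)).ne]
  have := hF.lintegral_le hc hρ h0 hp (A := 1)
    (k := fun q => (tw ρ (p.2 - q.2) * hk c p q).toReal) (fun q _ => by rw [e, one_mul])
  simpa only [e, one_mul] using this

lemma exists_dens (h : IsCoeff m M L a) (hγ : 0 ≤ γ) (hF : IsBddDensity τ₀ T B F) :
    ∃ B' : ℝ≥0, IsBddDensity τ₀ T B' (dens a γ F) := by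
  obtain ⟨C, hC⟩ := exists_densK_bound_tw h.m_pos h.m_le_M h.L_nonneg hγ (T - τ₀)
  have hM := h.M_pos
  have hz : ∀ p : ℝ × ℝ, p.2 ≤ τ₀ → ∫ q, densK a γ p q * F q = 0 := fun p hp => by
    refine integral_eq_zero_of_ae (Filter.Eventually.of_forall fun q => ?_)
    rcases le_or_gt q.2 τ₀ with hq | hq
    · simp [hF.zero q hq]
    · simp [densK_of_le hγ h (hp.trans hq.le)]
  refine ⟨B + C * B * ((T - τ₀) ^ (1 / 4 : ℝ) * 4).toNNReal,
    h.measurable_dens hγ hF.meas, fun p hp => ?_, fun p hp => ?_⟩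
  · rw [dens, hF.zero p hp, hz p hp, add_zero]
  · refine (enorm_add_le _ _).trans ?_
    push_cast
    refine add_le_add (hF.bdd p hp) ?_
    rcases le_or_gt p.2 τ₀ with h0 | h0
    · simp [hz p h0]
    refine (enorm_integral_mul_le _ _).trans ((hF.lintegral_le (by positivity : 0 < 64 * M)
      (by norm_num : (3 / 4 : ℝ) < 1) h0.le hp (A := C)
      (fun q hq => (hC a h p q (by linarith)).1)).trans ?_)
    rw [ENNReal.ofNNReal_toNNReal]
    gcongr
    have : (p.2 - τ₀) ^ (1 / 4 : ℝ) ≤ (T - τ₀) ^ (1 / 4 : ℝ) := by gcongr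
    norm_num1
    linarith

/-- The Volterra equation for the density of a bounded source. -/
lemma dens_eq (h : IsCoeff m M L a) (hγ : 0 ≤ γ) (hF : IsBddDensity τ₀ T B F) {p : ℝ × ℝ}
    (h0 : τ₀ < p.2) (hp : p.2 ≤ T) : dens a γ F p = F p + ∫ q, ek a γ p q * dens a γ F q := by
  obtain ⟨C, hC⟩ := exists_densK_bound_tw h.m_pos h.m_le_M h.L_nonneg hγ (T - τ₀)
  obtain ⟨C₁, hC₁⟩ := exists_ek_bound_tw h hγ (T - τ₀)
  have hM := h.M_pos
  have hfin : ∫⁻ q, (∫⁻ r, ‖ek a γ p r‖ₑ * ‖densK a γ r q‖ₑ) * ‖F q‖ₑ < ∞ := by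
    calc _ ≤ ∫⁻ q, C * (tw (3 / 4) (p.2 - q.2) * hk (64 * M) p q * ‖F q‖ₑ) := by
          refine lintegral_mono fun q => ?_
          rcases le_or_gt q.2 τ₀ with hq | hq
          · simp [hF.zero q hq]
          · rw [← mul_assoc]
            exact mul_le_mul_left (hC a h p q (by linarith)).2 _
      _ = C * ∫⁻ q, tw (3 / 4) (p.2 - q.2) * hk (64 * M) p q * ‖F q‖ₑ := by
          have := hF.meas
          rw [lintegral_const_mul _ (by fun_prop)]
      _ < ∞ := ENNReal.mul_lt_top ENNReal.coe_lt_top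
          ((hF.lintegral_majorant_le (by positivity) (by norm_num) h0.le hp).trans_lt
            (ENNReal.mul_lt_top ENNReal.coe_lt_top ENNReal.ofReal_lt_top))
  obtain ⟨i1, i2, i3⟩ := integral_comp_swap (k₁ := fun r => ek a γ p r)
    (k₂ := fun r q => densK a γ r q)
    (h.measurable_ek_comp γ measurable_const measurable_id) (measurable_densK hγ h) hF.meas hfin
  have i0 : Integrable fun q => ek a γ p q * F q :=
    hF.integrable_mul (by positivity : 0 < 64 * M) (by norm_num) h0.le hp
      (h.measurable_ek_comp γ measurable_const measurable_id)
      (fun q hq => hC₁ p q (by linarith))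
  have e1 : ∫ q, densK a γ p q * F q
      = ∫ q, (ek a γ p q * F q + (∫ r, ek a γ p r * densK a γ r q) * F q) := by
    congr 1; funext q
    rw [densK_eq hγ h p q, add_mul]
  have e2 : ∫ q, ek a γ p q * dens a γ F q
      = ∫ q, (ek a γ p q * F q + ek a γ p q * ∫ r, densK a γ q r * F r) := by
    congr 1; funext q
    rw [dens, mul_add]
  rw [e2, integral_add i0 i2, dens, e1, integral_add i0 i1, i3]

end IsBddDensity

/-- The Duhamel integral as a potential of the density. -/
lemma integral_solX_mul (h : IsCoeff m M L a) (hγ : 0 ≤ γ) (hF : Measurable F)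
    (h0 : ∀ q : ℝ × ℝ, q.2 ≤ τ₀ → F q = 0) {p : ℝ × ℝ}
    (hfin : ∫⁻ q, tw (1 / 2) (p.2 - q.2) * hk (64 * M) p q * ‖F q‖ₑ < ∞) :
    Integrable (fun q => solX a γ p q * F q) ∧
      ∫ q, solX a γ p q * F q = ∫ r, fk a 1 p r * dens a γ F r := by
  obtain ⟨C, hC, hb⟩ := exists_solX_bound h.m_pos h.m_le_M h.L_nonneg hγ
    (T := |p.2 - τ₀| + 1) (by positivity)
  obtain ⟨C₁, hC₁⟩ := exists_fk_bound_nnreal h (j := 1) (by norm_num)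
  have hq : ∀ q : ℝ × ℝ, τ₀ < q.2 → p.2 - q.2 ≤ |p.2 - τ₀| + 1 := fun q hq => by
    linarith [le_abs_self (p.2 - τ₀)]
  have hs : Measurable fun q => ‖F q‖ₑ := hF.enorm
  have hfin' : ∫⁻ q, (∫⁻ r, ‖fk a 1 p r‖ₑ * ‖densK a γ r q‖ₑ) * ‖F q‖ₑ < ∞ := by
    calc _ ≤ ∫⁻ q, ENNReal.ofReal C * (tw (1 / 2) (p.2 - q.2) * hk (64 * M) p q * ‖F q‖ₑ) := by
          refine lintegral_mono fun q => ?_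
          rcases le_or_gt q.2 τ₀ with h1 | h1
          · simp [h0 q h1]
          · rw [← mul_assoc]
            exact mul_le_mul_left (hb a h p q (hq q h1)).2 _
      _ < ∞ := by
          rw [lintegral_const_mul _ (by fun_prop)]
          exact ENNReal.mul_lt_top ENNReal.ofReal_lt_top hfin
  have i0 : Integrable fun q => fk a 1 p q * F q := by
    refine integrable_of_lintegral_enorm_mul ((h.measurable_fk_comp 1 measurable_const
      measurable_id).mul hF).aestronglyMeasurable ?_
    calc _ ≤ ∫⁻ q, C₁ * (tw (1 / 2) (p.2 - q.2) * hk (64 * M) p q * ‖F q‖ₑ) := by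
          refine lintegral_mono fun q => ?_
          rw [← mul_assoc]
          refine mul_le_mul_left ((hC₁ p q).trans (le_of_eq ?_)) _
          norm_num
      _ < ∞ := by
          rw [lintegral_const_mul _ (by fun_prop)]
          exact ENNReal.mul_lt_top ENNReal.coe_lt_top hfin
  obtain ⟨i1, i2, i3⟩ := integral_comp_swap (k₁ := fun r => fk a 1 p r)
    (k₂ := fun r q => densK a γ r q)
    (h.measurable_fk_comp 1 measurable_const measurable_id) (measurable_densK hγ h) hF hfin'
  have e1 : ∀ q, solX a γ p q * F q
      = fk a 1 p q * F q + (∫ r, fk a 1 p r * densK a γ r q) * F q := fun q => add_mul _ _ _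
  have e2 : ∀ q, fk a 1 p q * dens a γ F q
      = fk a 1 p q * F q + fk a 1 p q * ∫ r, densK a γ q r * F r := fun q => mul_add _ _ _
  simp_rw [e1, e2]
  exact ⟨i0.add i1, by rw [integral_add i0 i1, integral_add i0 i2, i3]⟩

/-! ### Cancellation -/

/-- The source equal to one after time `τ₀`. -/
noncomputable def oneAfter (τ₀ : ℝ) : ℝ × ℝ → ℝ := {q : ℝ × ℝ | τ₀ < q.2}.indicator 1

lemma isBddDensity_oneAfter (τ₀ T : ℝ) : IsBddDensity τ₀ T 1 (oneAfter τ₀) where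
  meas := measurable_const.indicator (measurableSet_after τ₀)
  zero r hr := indicator_of_notMem (by simpa using hr) _
  bdd r _ := by
    unfold oneAfter
    by_cases h : τ₀ < r.2 <;> simp [indicator, h]

/-- The integral is the space derivative of the potential with unit source after τ₀, and that
potential is a function of t alone by `potential_eq_dampedTime`. -/
lemma integral_solX_oneAfter (h : IsCoeff m M L a) (hγ : 0 < γ) {x t : ℝ} (ht : τ₀ < t) :
    Integrable (fun q => solX a γ (x, t) q * oneAfter τ₀ q) ∧
      ∫ q, solX a γ (x, t) q * oneAfter τ₀ q = 0 := by
  have hF := isBddDensity_oneAfter τ₀ t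
  obtain ⟨B, hψ⟩ := hF.exists_dens h hγ.le
  have hM := h.M_pos
  have hM' : 0 < 64 * M := by positivity
  obtain ⟨i1, e1⟩ := integral_solX_mul h hγ.le hF.meas hF.zero (p := (x, t))
    ((hF.lintegral_majorant_le hM' (by norm_num) ht.le le_rfl).trans_lt
      (ENNReal.mul_lt_top ENNReal.coe_lt_top ENNReal.ofReal_lt_top))
  refine ⟨i1, ?_⟩
  rw [e1]
  have hV : ∀ p : ℝ × ℝ, τ₀ < p.2 → p.2 ≤ t → dens a γ (oneAfter τ₀) p
      = 1 + ∫ q, ek a γ p q * dens a γ (oneAfter τ₀) q := fun p h0 hp => by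
    rw [hF.dens_eq h hγ.le h0 hp, oneAfter, indicator_of_mem (by simpa using h0), Pi.one_apply]
  have hN : ∀ ρ : ℝ, ρ < 1 →
      ∫⁻ s, tw ρ (t - s) * (Ioi τ₀).indicator (fun _ => (B : ℝ≥0∞)) s < ∞ := fun ρ hρ => by
    have e : ∀ s, tw ρ (t - s) * (Ioi τ₀).indicator (fun _ => (B : ℝ≥0∞)) s
        = (Ioi τ₀).indicator (fun s => tw ρ (t - s) * B) s := fun s => by
      by_cases hs : τ₀ < s <;> simp [indicator, hs]
    simp_rw [e]
    rw [lintegral_indicator measurableSet_Ioi, lintegral_mul_const _ (by fun_prop),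
      lintegral_tw_sub hρ ht.le]
    exact ENNReal.mul_lt_top ENNReal.ofReal_lt_top ENNReal.coe_lt_top
  have hd := (hasDerivAt_potential h hψ.meas (t := t)
    (N := (Ioi τ₀).indicator fun _ => (B : ℝ≥0∞))
    (fun s hs => ⟨B, fun y => by
      have := hψ.bdd (y, s) hs.le
      rw [← ofReal_norm, ENNReal.ofReal_le_coe] at this
      simpa [Real.norm_eq_abs] using this⟩)
    (measurable_const.indicator measurableSet_Ioi) (fun s hs x' => ?_) (hN 0 one_pos)
    (hN (1 / 2) (by norm_num)) x).2.2
  · have hc : (fun x' => ∫ r, fk a 0 (x', t) r * dens a γ (oneAfter τ₀) r)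
        = fun _ => dampedTime γ τ₀ t :=
      funext fun x' => potential_eq_dampedTime h hγ hψ hV ht le_rfl
    rw [hc] at hd
    exact hd.unique (hasDerivAt_const _ _)
  · by_cases h0 : τ₀ < s
    · rw [indicator_of_mem (by simpa using h0)]
      calc _ ≤ ∫⁻ y, hk (64 * M) (x', t) (y, s) * B :=
            lintegral_mono fun y => mul_le_mul_right (hψ.bdd (y, s) hs.le) _
        _ = _ := by
            rw [lintegral_mul_const _ (by fun_prop), lintegral_hk_slice hM' hs, one_mul]
    · have : ∀ y, dens a γ (oneAfter τ₀) (y, s) = 0 := fun y => hψ.zero _ (not_lt.1 h0)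
      simp [this]

/-- The space derivative of the fundamental solution has mean zero at almost every source time. -/
lemma ae_integral_solX_eq_zero (h : IsCoeff m M L a) (hγ : 0 < γ) (x t : ℝ) :
    ∀ᵐ τ, 0 < τ → τ < t →
      Integrable (fun ξ => solX a γ (x, t) (ξ, τ)) ∧ ∫ ξ, solX a γ (x, t) (ξ, τ) = 0 := by
  rcases le_or_gt t 0 with ht | ht
  · exact Filter.Eventually.of_forall fun τ h1 h2 => by linarith
  set g : ℝ → ℝ := fun s => ∫ ξ, solX a γ (x, t) (ξ, s) * oneAfter 0 (ξ, s) with hg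
  have i0 := (integral_solX_oneAfter h hγ ht (x := x)).1
  have ig : Integrable g := i0.integral_prod_right
  have hint : ∀ τ, 0 ≤ τ → τ < t → ∫ s in Ioi τ, g s = 0 := by
    intro τ h0 h1
    obtain ⟨i1, e1⟩ := integral_solX_oneAfter h hγ h1 (x := x)
    rw [Measure.volume_eq_prod, integral_prod_symm _ i1] at e1
    rw [← integral_indicator measurableSet_Ioi, ← e1]
    congr 1; funext s
    by_cases hs : τ < s
    · rw [indicator_of_mem (by simpa using hs), hg]
      simp [oneAfter, indicator, hs, h0.trans_lt hs]
    · rw [indicator_of_notMem (by simpa using hs)]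
      simp [oneAfter, indicator, hs]
  have hI : ∀ τ, 0 ≤ τ → τ < t → ∫ s in (0)..τ, g s = 0 := by
    intro τ h0 h1
    have := intervalIntegral.integral_interval_add_Ioi (a := 0) (b := τ) ig.integrableOn
      ig.integrableOn
    rwa [hint τ h0 h1, hint 0 le_rfl ht, add_zero] at this
  -- The primitive of g vanishes on (0, t), so g vanishes at every Lebesgue point there. This is why
  -- the cancellation is stated for almost every τ.
  filter_upwards [LocallyIntegrable.ae_hasDerivAt_integral ig.locallyIntegrable, i0.prod_left_ae] with τ hd hi h0 h1
  have e : ∀ ξ, oneAfter 0 (ξ, τ) = 1 := fun ξ => by simp [oneAfter, indicator, h0]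
  have hgτ : g τ = ∫ ξ, solX a γ (x, t) (ξ, τ) := by simp [hg, e]
  simp only [e, mul_one] at hi
  refine ⟨hi, ?_⟩
  rw [← hgτ]
  refine (hd 0).unique ((hasDerivAt_const τ (0 : ℝ)).congr_of_eventuallyEq ?_)
  filter_upwards [Ioo_mem_nhds h0 h1] with s hs
  exact hI s hs.1.le hs.2

end Density

/-! ### Sources controlled by their Gaussian averages -/

/-- Sources switched on at time `0` whose Gaussian averages up to time `T` have a singularity of
order at most `1/4`. -/
structure IsSource (c T : ℝ) (B : ℝ≥0) (F : ℝ × ℝ → ℝ) : Prop where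
  meas : Measurable F
  zero : ∀ r : ℝ × ℝ, r.2 ≤ 0 → F r = 0
  bound : ∀ᵐ s, ∀ x t, s < t → t ≤ T →
    ∫⁻ y, hk c (x, t) (y, s) * ‖F (y, s)‖ₑ ≤ B * tw (1 / 4) (t - s)

lemma lintegral_tw_past {ρ r θ : ℝ} (hρ : 1 < ρ) (h : θ < r) :
    ∫⁻ s in Iio θ, tw ρ (r - s) = ENNReal.ofReal ((r - θ) ^ (1 - ρ) / (ρ - 1)) := by
  have hpos : 0 < r - θ := sub_pos.2 h
  have e : ∫⁻ s in Iio θ, tw ρ (r - s) = ∫⁻ s in Ioi (r - θ), tw ρ s := by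
    rw [← lintegral_indicator measurableSet_Iio, ← lintegral_indicator measurableSet_Ioi,
      ← lintegral_sub_left_eq_self (fun s => (Ioi (r - θ)).indicator (tw ρ) s) r]
    congr 1
    funext s
    simp [indicator]
  have e2 : ∫⁻ s in Ioi (r - θ), tw ρ s = ∫⁻ s in Ioi (r - θ), ENNReal.ofReal (s ^ (-ρ)) :=
    setLIntegral_congr_fun measurableSet_Ioi fun s hs => tw_of_pos (hpos.trans hs)
  rw [e, e2, ← ofReal_integral_eq_lintegral_ofReal
    (integrableOn_Ioi_rpow_of_lt (by linarith) hpos)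
    ((ae_restrict_iff' measurableSet_Ioi).2 (Filter.Eventually.of_forall fun s hs =>
      Real.rpow_nonneg (hpos.trans hs).le _)),
    integral_Ioi_rpow_of_lt (by linarith) hpos]
  congr 1
  rw [show -ρ + 1 = 1 - ρ by ring, show ρ - 1 = -(1 - ρ) by ring, div_neg, neg_div]

lemma lintegral_tw_Ioc_le {ρ t θ : ℝ} (hρ : ρ < 1) (h : θ ≤ t) :
    ∫⁻ r in Ioc θ t, tw ρ (r - θ) ≤ ENNReal.ofReal ((t - θ) ^ (1 - ρ) / (1 - ρ)) := by
  rw [← lintegral_tw_Iio hρ (sub_nonneg.2 h), ← Measure.restrict_congr_set (Ioo_ae_eq_Ioc),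
    ← lintegral_indicator measurableSet_Iio, ← lintegral_indicator measurableSet_Ioo,
    ← lintegral_sub_right_eq_self (fun s => (Iio (t - θ)).indicator (tw ρ) s) θ]
  refine lintegral_mono fun s => ?_
  dsimp only
  by_cases hs : s ∈ Ioo θ t
  · rw [indicator_of_mem hs, indicator_of_mem (by simpa using hs.2)]
  · rw [indicator_of_notMem hs]
    exact zero_le

namespace IsSource

variable {c T : ℝ} {B : ℝ≥0} {F : ℝ × ℝ → ℝ}

lemma lintegral_after_le (hF : IsSource c T B F) {ρ : ℝ} (hρ : ρ < 3 / 4)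
    {p : ℝ × ℝ} {θ : ℝ} (hθ : θ ≤ p.2) (hp : p.2 ≤ T) :
    ∫⁻ q in {q : ℝ × ℝ | θ < q.2}, tw ρ (p.2 - q.2) * hk c p q * ‖F q‖ₑ
      ≤ B * ENNReal.ofReal ((p.2 - θ) ^ (3 / 4 - ρ) / (3 / 4 - ρ)) := by
  have hm := hF.meas
  have e := lintegral_tw_sub (ρ := ρ + 1 / 4) (by linarith) hθ
  rw [show 1 - (ρ + 1 / 4) = 3 / 4 - ρ by ring] at e
  rw [← e, ← lintegral_const_mul _ (by fun_prop), ← lintegral_indicator (measurableSet_after θ),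
    ← lintegral_indicator measurableSet_Ioi,
    lintegral_spacetime (Measurable.indicator (by fun_prop) (measurableSet_after θ))]
  refine lintegral_mono_ae ?_
  filter_upwards [hF.bound] with s hs
  by_cases h1 : θ < s
  · have e1 : ∀ y, {q : ℝ × ℝ | θ < q.2}.indicator
        (fun q => tw ρ (p.2 - q.2) * hk c p q * ‖F q‖ₑ) (y, s)
        = tw ρ (p.2 - s) * (hk c p (y, s) * ‖F (y, s)‖ₑ) := fun y => by
      simp [indicator, h1, mul_assoc]
    simp_rw [e1]
    rw [lintegral_const_mul _ (by fun_prop), indicator_of_mem (by simpa using h1)]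
    rcases lt_or_ge s p.2 with h2 | h2
    · calc _ ≤ tw ρ (p.2 - s) * (B * tw (1 / 4) (p.2 - s)) := by
            gcongr
            exact hs p.1 p.2 h2 hp
        _ = _ := by rw [← tw_add]; ring
    · simp [tw_of_nonpos (sub_nonpos.2 h2)]
  · simp [indicator, h1]

lemma lintegral_le (hF : IsSource c T B F) {ρ : ℝ} (hρ : ρ < 3 / 4)
    {p : ℝ × ℝ} (h0 : 0 ≤ p.2) (hp : p.2 ≤ T) :
    ∫⁻ q, tw ρ (p.2 - q.2) * hk c p q * ‖F q‖ₑ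
      ≤ B * ENNReal.ofReal (p.2 ^ (3 / 4 - ρ) / (3 / 4 - ρ)) := by
  have := hF.lintegral_after_le hρ h0 hp
  rw [sub_zero] at this
  refine le_trans (le_of_eq ?_) this
  rw [← lintegral_indicator (measurableSet_after 0)]
  congr 1; funext r
  by_cases hr : 0 < r.2
  · simp [indicator, hr]
  · simp [indicator, hr, hF.zero r (not_lt.1 hr)]

end IsSource

lemma dens_of_le {m M L γ τ₀ : ℝ} {a : ℝ × ℝ → ℝ} {F : ℝ × ℝ → ℝ} (h : IsCoeff m M L a)
    (hγ : 0 ≤ γ) (hF : ∀ r : ℝ × ℝ, r.2 ≤ τ₀ → F r = 0) {p : ℝ × ℝ} (hp : p.2 ≤ τ₀) :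
    dens a γ F p = 0 := by
  rw [dens, hF p hp, zero_add]
  refine integral_eq_zero_of_ae (Filter.Eventually.of_forall fun q => ?_)
  rcases le_or_gt q.2 τ₀ with hq | hq
  · simp [hF q hq]
  · simp [densK_of_le hγ h (hp.trans hq.le)]

/-- Averaging the Volterra term at time s composes two Gaussians into one from the original source
time r, where the assumption on F applies. The remaining weight (s - r)^(-3/4) is integrable in r.
-/
lemma exists_isSource_dens {m M L γ T : ℝ} (hm : 0 < m) (hmM : m ≤ M) (hL : 0 ≤ L) (hγ : 0 ≤ γ) :
    ∃ C : ℝ≥0, ∀ a : ℝ × ℝ → ℝ, IsCoeff m M L a → ∀ (B : ℝ≥0) (F : ℝ × ℝ → ℝ),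
      IsSource (64 * M) T B F → IsSource (64 * M) T (C * B) (dens a γ F) := by
  obtain ⟨C, hC⟩ := exists_densK_bound_tw hm hmM hL hγ T
  have hM : 0 < M := hm.trans_le hmM
  have hM' : 0 < 64 * M := by positivity
  refine ⟨1 + C * (T ^ (1 / 4 : ℝ) * 4).toNNReal, fun a h B F hF =>
    ⟨h.measurable_dens hγ hF.meas, fun r hr => dens_of_le h hγ hF.zero hr, ?_⟩⟩
  filter_upwards [hF.bound] with s hs x t hst htT
  rcases le_or_gt s 0 with h0 | h0
  · simp [fun y => dens_of_le h hγ hF.zero (show (y, s).2 ≤ 0 from h0)]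
  have hFm := hF.meas
  have hdm : Measurable fun z : (ℝ × ℝ) × (ℝ × ℝ) => densK a γ z.1 z.2 := measurable_densK hγ h
  have h1 : ∀ y, ‖dens a γ F (y, s)‖ₑ ≤ ‖F (y, s)‖ₑ
      + ∫⁻ q, C * (tw (3 / 4) (s - q.2) * hk (64 * M) (y, s) q * ‖F q‖ₑ) := fun y => by
    refine (enorm_add_le _ _).trans (add_le_add le_rfl ((enorm_integral_mul_le _ _).trans ?_))
    refine lintegral_mono fun q => ?_
    rcases le_or_gt q.2 0 with hq | hq
    · simp [hF.zero q hq]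
    · rw [← mul_assoc]
      exact mul_le_mul_left (hC a h (y, s) q (by dsimp only; linarith)).1 _
  have h2 : ∫⁻ y, hk (64 * M) (x, t) (y, s) *
        ∫⁻ q, C * (tw (3 / 4) (s - q.2) * hk (64 * M) (y, s) q * ‖F q‖ₑ)
      ≤ C * ∫⁻ q, tw (3 / 4) (s - q.2) * hk (64 * M) (x, t) q * ‖F q‖ₑ := by
    calc _ = ∫⁻ y, ∫⁻ q, C * (tw (3 / 4) (s - q.2) * ‖F q‖ₑ) *
            (hk (64 * M) (x, t) (y, s) * hk (64 * M) (y, s) q) := by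
          congr 1; funext y
          rw [← lintegral_const_mul _ (by fun_prop)]
          congr 1; funext q
          ring
      _ = ∫⁻ q, ∫⁻ y, C * (tw (3 / 4) (s - q.2) * ‖F q‖ₑ) *
            (hk (64 * M) (x, t) (y, s) * hk (64 * M) (y, s) q) := by
          rw [lintegral_lintegral_swap]
          fun_prop
      _ ≤ ∫⁻ q, C * (tw (3 / 4) (s - q.2) * hk (64 * M) (x, t) q * ‖F q‖ₑ) := by
          refine lintegral_mono fun q => ?_
          rw [lintegral_const_mul _ (by fun_prop)]
          rcases le_or_gt s q.2 with hq | hq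
          · simp [tw_of_nonpos (sub_nonpos.2 hq)]
          have e : ∫⁻ y, hk (64 * M) (x, t) (y, s) * hk (64 * M) (y, s) q
              = hk (64 * M) (x, t) q := by
            simp only [hk]
            rw [lintegral_gk_mul_gk (mul_pos hM' (sub_pos.2 hst)) (mul_pos hM' (sub_pos.2 hq))]
            congr 2
            ring
          rw [e]
          exact le_of_eq (by ring)
      _ = _ := lintegral_const_mul _ (by fun_prop)
  have h3 : ∫⁻ q, tw (3 / 4) (s - q.2) * hk (64 * M) (x, t) q * ‖F q‖ₑ
      ≤ B * tw (1 / 4) (t - s) * ENNReal.ofReal (T ^ (1 / 4 : ℝ) * 4) := by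
    have e := lintegral_tw_sub (ρ := 3 / 4) (by norm_num) h0.le
    have e' : ENNReal.ofReal ((s - 0) ^ (1 - 3 / 4 : ℝ) / (1 - 3 / 4))
        ≤ ENNReal.ofReal (T ^ (1 / 4 : ℝ) * 4) := by
      apply ENNReal.ofReal_le_ofReal
      have : s ^ (1 / 4 : ℝ) ≤ T ^ (1 / 4 : ℝ) := by
        gcongr
        linarith
      rw [sub_zero]
      norm_num1
      linarith
    refine le_trans ?_ (mul_le_mul_right (e.le.trans e') _)
    rw [← lintegral_const_mul _ (by fun_prop), ← lintegral_indicator measurableSet_Ioi,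
      lintegral_spacetime (by fun_prop)]
    refine lintegral_mono_ae ?_
    filter_upwards [hF.bound] with r hr
    rcases le_or_gt r 0 with hr0 | hr0
    · simp [fun y => hF.zero (y, r) hr0]
    rw [indicator_of_mem (by simpa using hr0)]
    rcases le_or_gt s r with hsr | hsr
    · simp [tw_of_nonpos (sub_nonpos.2 hsr)]
    simp_rw [mul_assoc]
    rw [lintegral_const_mul _ (by fun_prop)]
    calc _ ≤ tw (3 / 4) (s - r) * (B * tw (1 / 4) (t - r)) := by
          gcongr
          exact hr x t (by linarith) htT
      -- Since r < s, the lag t - r is the longer one; the singular factor becomes independent of r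
      -- and the class is reproduced with the same exponent.
      _ ≤ tw (3 / 4) (s - r) * (B * tw (1 / 4) (t - s)) := by
          gcongr
          rw [tw_of_pos (by linarith), tw_of_pos (by linarith)]
          exact ENNReal.ofReal_le_ofReal
            (Real.rpow_le_rpow_of_nonpos (by linarith) (by linarith) (by norm_num))
      _ = _ := by ring
  calc _ ≤ ∫⁻ y, (hk (64 * M) (x, t) (y, s) * ‖F (y, s)‖ₑ + hk (64 * M) (x, t) (y, s) *
        ∫⁻ q, C * (tw (3 / 4) (s - q.2) * hk (64 * M) (y, s) q * ‖F q‖ₑ)) := by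
        refine lintegral_mono fun y => ?_
        rw [← mul_add]
        exact mul_le_mul_right (h1 y) _
    _ ≤ B * tw (1 / 4) (t - s)
        + C * (B * tw (1 / 4) (t - s) * ENNReal.ofReal (T ^ (1 / 4 : ℝ) * 4)) := by
        rw [lintegral_add_left (by fun_prop)]
        exact add_le_add (hs x t hst htT) (h2.trans (mul_le_mul_right h3 _))
    _ = _ := by
        push_cast
        rw [ENNReal.ofNNReal_toNNReal]
        ring

/-! ### Estimates for the space derivative of potentials -/

section PotentialEstimates

variable {m M L T : ℝ}

/-- The uniform version of `exists_fk_bound`. -/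
lemma exists_fk_bound_unif (hm : 0 < m) (hmM : m ≤ M) {j : ℕ} (hj : j ≤ 4) :
    ∃ C : ℝ≥0, ∀ a : ℝ × ℝ → ℝ, IsCoeff m M L a → ∀ p q : ℝ × ℝ,
      ‖fk a j p q‖ₑ ≤ C * (tw (j / 2) (p.2 - q.2) * hk (64 * M) p q) := by
  obtain ⟨C, hC, hb⟩ := exists_fk_bound hm hmM hj
  exact ⟨C.toNNReal, fun a h => hb L a h⟩

lemma exists_slice_bound (hm : 0 < m) (hmM : m ≤ M) {j : ℕ} (hj : j ≤ 4) :
    ∃ C : ℝ≥0, ∀ a : ℝ × ℝ → ℝ, IsCoeff m M L a → ∀ (B : ℝ≥0) (ψ : ℝ × ℝ → ℝ),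
      IsSource (64 * M) T B ψ → ∀ᵐ s, ∀ x t, s < t → t ≤ T →
        ∫⁻ y, ‖fk a j (x, t) (y, s)‖ₑ * ‖ψ (y, s)‖ₑ ≤ C * B * tw (j / 2 + 1 / 4) (t - s) := by
  obtain ⟨C, hC⟩ := exists_fk_bound_unif (L := L) hm hmM hj
  refine ⟨C, fun a h B ψ hψ => ?_⟩
  have hψm := hψ.meas
  filter_upwards [hψ.bound] with s hs x t hst htT
  calc _ ≤ ∫⁻ y, C * tw (j / 2) (t - s) * (hk (64 * M) (x, t) (y, s) * ‖ψ (y, s)‖ₑ) := by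
        refine lintegral_mono fun y => (mul_le_mul_left (hC a h (x, t) (y, s)) _).trans
          (le_of_eq ?_)
        ring
    _ ≤ C * tw (j / 2) (t - s) * (B * tw (1 / 4) (t - s)) := by
        rw [lintegral_const_mul _ (by fun_prop)]
        gcongr
        exact hs x t hst htT
    _ = _ := by rw [← tw_add]; ring

lemma exists_potential_bound (hm : 0 < m) (hmM : m ≤ M) :
    ∃ C : ℝ≥0, ∀ a : ℝ × ℝ → ℝ, IsCoeff m M L a → ∀ (B : ℝ≥0) (ψ : ℝ × ℝ → ℝ),
      IsSource (64 * M) T B ψ → ∀ p : ℝ × ℝ, 0 ≤ p.2 → p.2 ≤ T →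
        (Integrable fun r => fk a 1 p r * ψ r) ∧
        ‖∫ r, fk a 1 p r * ψ r‖ₑ ≤ C * B * ENNReal.ofReal (p.2 ^ (1 / 4 : ℝ)) := by
  obtain ⟨C, hC⟩ := exists_fk_bound_unif (L := L) hm hmM (j := 1) (by norm_num)
  refine ⟨C * 4, fun a h B ψ hψ p h0 hp => ?_⟩
  have hψm := hψ.meas
  have key : ∫⁻ r, ‖fk a 1 p r‖ₑ * ‖ψ r‖ₑ
      ≤ (C * 4 : ℝ≥0) * B * ENNReal.ofReal (p.2 ^ (1 / 4 : ℝ)) := by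
    calc _ ≤ ∫⁻ r, C * (tw (1 / 2) (p.2 - r.2) * hk (64 * M) p r * ‖ψ r‖ₑ) := by
          refine lintegral_mono fun r => (mul_le_mul_left (hC a h p r) _).trans (le_of_eq ?_)
          rw [Nat.cast_one]
          ring
      _ ≤ C * (B * ENNReal.ofReal (p.2 ^ (3 / 4 - 1 / 2 : ℝ) / (3 / 4 - 1 / 2))) := by
          rw [lintegral_const_mul _ (by fun_prop)]
          gcongr
          exact hψ.lintegral_le (by norm_num) h0 hp
      _ = _ := by
          rw [show p.2 ^ (3 / 4 - 1 / 2 : ℝ) / (3 / 4 - 1 / 2) = 4 * p.2 ^ (1 / 4 : ℝ) by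
            norm_num; ring, ENNReal.ofReal_mul (by norm_num)]
          push_cast
          rw [ENNReal.ofReal_ofNat]
          ring
  refine ⟨integrable_of_lintegral_enorm_mul ((h.measurable_fk_comp 1 measurable_const
    measurable_id).mul hψm).aestronglyMeasurable (key.trans_lt ?_),
    (enorm_integral_mul_le _ _).trans key⟩
  exact ENNReal.mul_lt_top (ENNReal.mul_lt_top ENNReal.coe_lt_top ENNReal.coe_lt_top)
    ENNReal.ofReal_lt_top

/-- Interpolation between a size bound and a Lipschitz bound. -/
lemma min_tw_le {d σ : ℝ} (hd : 0 ≤ d) {X A : ℝ≥0∞} (h1 : X ≤ A * tw (3 / 4) σ)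
    (h2 : X ≤ ENNReal.ofReal d * (A * tw (5 / 4) σ)) :
    X ≤ ENNReal.ofReal (d ^ (1 / 4 : ℝ)) * (A * tw (7 / 8) σ) := by
  rcases le_or_gt σ 0 with hσ | hσ
  · rw [tw_of_nonpos hσ, mul_zero] at h1
    exact h1.trans zero_le
  rw [tw_of_pos hσ] at h1 h2 ⊢
  -- The threshold is the parabolic scale d = √σ. Below it the Lipschitz bound is better, above it
  -- the size bound.
  rcases le_total d (σ ^ (1 / 2 : ℝ)) with h | h
  · refine h2.trans ?_
    rw [mul_left_comm, mul_left_comm (ENNReal.ofReal (d ^ (1 / 4 : ℝ))),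
      ← ENNReal.ofReal_mul hd, ← ENNReal.ofReal_mul (by positivity)]
    refine mul_le_mul_right (ENNReal.ofReal_le_ofReal ?_) A
    calc d * σ ^ (-(5 / 4) : ℝ) = d ^ (1 / 4 : ℝ) * (d ^ (3 / 4 : ℝ) * σ ^ (-(5 / 4) : ℝ)) := by
          rw [← mul_assoc, ← Real.rpow_add_of_nonneg hd (by norm_num) (by norm_num)]
          norm_num
      _ ≤ d ^ (1 / 4 : ℝ) * ((σ ^ (1 / 2 : ℝ)) ^ (3 / 4 : ℝ) * σ ^ (-(5 / 4) : ℝ)) := by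
          gcongr
      _ = _ := by
          rw [← Real.rpow_mul hσ.le, ← Real.rpow_add hσ]
          norm_num
  · refine h1.trans ?_
    rw [mul_left_comm (ENNReal.ofReal (d ^ (1 / 4 : ℝ))), ← ENNReal.ofReal_mul (by positivity)]
    gcongr
    calc σ ^ (-(3 / 4) : ℝ) = (σ ^ (1 / 2 : ℝ)) ^ (1 / 4 : ℝ) * σ ^ (-(7 / 8) : ℝ) := by
          rw [← Real.rpow_mul hσ.le, ← Real.rpow_add hσ]
          norm_num
      _ ≤ _ := by gcongr

/-- The difference of slices is at most of order σ^(-3/4), and at most d σ^(-5/4) with d = |x - x'|.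
Interpolation gives d^(1/4) σ^(-7/8), which is integrable in time. -/
lemma exists_potential_sub_space (hm : 0 < m) (hmM : m ≤ M) :
    ∃ C : ℝ≥0, ∀ a : ℝ × ℝ → ℝ, IsCoeff m M L a → ∀ (B : ℝ≥0) (ψ : ℝ × ℝ → ℝ),
      IsSource (64 * M) T B ψ → ∀ x x' t : ℝ, 0 ≤ t → t ≤ T →
        ‖(∫ r, fk a 1 (x, t) r * ψ r) - ∫ r, fk a 1 (x', t) r * ψ r‖ₑ
          ≤ C * B * ENNReal.ofReal (|x - x'| ^ (1 / 4 : ℝ)) := by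
  obtain ⟨C₀, hC₀⟩ := exists_potential_bound (L := L) (T := T) hm hmM
  obtain ⟨C₁, hC₁⟩ := exists_slice_bound (L := L) (T := T) hm hmM (j := 1) (by norm_num)
  obtain ⟨C₂, hC₂⟩ := exists_slice_bound (L := L) (T := T) hm hmM (j := 2) (by norm_num)
  refine ⟨(2 * C₁ + C₂) * (T ^ (1 / 8 : ℝ) * 8).toNNReal, fun a h B ψ hψ x x' t h0 ht => ?_⟩
  have hψm := hψ.meas
  have hm1 : ∀ z, Measurable fun r => fk a 1 (z, t) r := fun z =>
    h.measurable_fk_comp 1 measurable_const measurable_id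
  have hmy : ∀ z s, Measurable fun y => fk a 1 (z, t) (y, s) := fun z s =>
    h.measurable_fk_comp 1 measurable_const (by fun_prop)
  rw [← integral_sub (hC₀ a h B ψ hψ (x, t) h0 ht).1 (hC₀ a h B ψ hψ (x', t) h0 ht).1]
  simp_rw [← sub_mul]
  refine (enorm_integral_mul_le _ _).trans ?_
  have hmd : Measurable fun r => ‖fk a 1 (x, t) r - fk a 1 (x', t) r‖ₑ * ‖ψ r‖ₑ :=
    ((hm1 x).sub (hm1 x')).enorm.mul hψm.enorm
  rw [lintegral_spacetime hmd]
  set A : ℝ≥0∞ := (2 * C₁ + C₂) * B with hA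
  set D := ENNReal.ofReal (|x - x'| ^ (1 / 4 : ℝ))
  calc _ ≤ ∫⁻ s, (Ioi 0).indicator (fun s => D * (A * tw (7 / 8) (t - s))) s := by
        refine lintegral_mono_ae ?_
        filter_upwards [hC₁ a h B ψ hψ, hC₂ a h B ψ hψ] with s h1 h2
        rcases le_or_gt s 0 with hs0 | hs0
        · simp [fun y => hψ.zero (y, s) hs0]
        rcases le_or_gt t s with hts | hts
        · simp [fun z y => fk_of_le h 1 (show (z, t).2 ≤ (y, s).2 from hts)]
        rw [indicator_of_mem (by simpa using hs0)]
        have e1 : ((1 : ℕ) / 2 + 1 / 4 : ℝ) = 3 / 4 := by norm_num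
        have e2 : ((2 : ℕ) / 2 + 1 / 4 : ℝ) = 5 / 4 := by norm_num
        rw [e1] at h1
        rw [e2] at h2
        refine min_tw_le (abs_nonneg _) ?_ ?_
        · calc _ ≤ ∫⁻ y, (‖fk a 1 (x, t) (y, s)‖ₑ * ‖ψ (y, s)‖ₑ
                + ‖fk a 1 (x', t) (y, s)‖ₑ * ‖ψ (y, s)‖ₑ) := by
                refine lintegral_mono fun y => ?_
                rw [← add_mul]
                exact mul_le_mul_left (enorm_sub_le) _
            _ ≤ C₁ * B * tw (3 / 4) (t - s) + C₁ * B * tw (3 / 4) (t - s) := by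
                have hml : Measurable fun y => ‖fk a 1 (x, t) (y, s)‖ₑ * ‖ψ (y, s)‖ₑ :=
                  (hmy x s).enorm.mul (by fun_prop)
                rw [lintegral_add_left hml]
                exact add_le_add (h1 x t hts ht) (h1 x' t hts ht)
            _ = 2 * C₁ * B * tw (3 / 4) (t - s) := by ring
            _ ≤ _ := by
                rw [hA]
                gcongr
                exact le_self_add
        · refine (lintegral_fk_sub_space_le h 1 (φ := fun y => ‖ψ (y, s)‖ₑ) (by fun_prop)
            (fun z => h2 z t hts ht)).trans ?_
          rw [hA]
          gcongr
          exact le_add_self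
    _ = D * (A * ENNReal.ofReal ((t - 0) ^ (1 - 7 / 8 : ℝ) / (1 - 7 / 8))) := by
        rw [lintegral_indicator measurableSet_Ioi, lintegral_const_mul _ (by fun_prop),
          lintegral_const_mul _ (by fun_prop), lintegral_tw_sub (by norm_num) h0]
    _ ≤ D * (A * ENNReal.ofReal (T ^ (1 / 8 : ℝ) * 8)) := by
        gcongr
        have : t ^ (1 / 8 : ℝ) ≤ T ^ (1 / 8 : ℝ) := by gcongr
        rw [sub_zero]
        norm_num1
        linarith
    _ = _ := by
        push_cast
        rw [ENNReal.ofNNReal_toNNReal]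
        ring

/-- Sources before t' are treated by the time derivative, of order σ^(-7/4); integrating first over
the source times and then over (t', t) gives (t - t')^(1/4). For sources after t' only the potential
at t is present, and its size over that interval is of the same order. -/
lemma exists_potential_sub_time (hm : 0 < m) (hmM : m ≤ M) :
    ∃ C : ℝ≥0, ∀ a : ℝ × ℝ → ℝ, IsCoeff m M L a → ∀ (B : ℝ≥0) (ψ : ℝ × ℝ → ℝ),
      IsSource (64 * M) T B ψ → ∀ x t t' : ℝ, 0 ≤ t' → t' ≤ t → t ≤ T →
        ‖(∫ r, fk a 1 (x, t) r * ψ r) - ∫ r, fk a 1 (x, t') r * ψ r‖ₑ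
          ≤ C * B * ENNReal.ofReal ((t - t') ^ (1 / 4 : ℝ)) := by
  obtain ⟨C₀, hC₀⟩ := exists_potential_bound (L := L) (T := T) hm hmM
  obtain ⟨C₁, hC₁⟩ := exists_slice_bound (L := L) (T := T) hm hmM (j := 1) (by norm_num)
  obtain ⟨C₃, hC₃⟩ := exists_slice_bound (L := L) (T := T) hm hmM (j := 3) (by norm_num)
  refine ⟨M.toNNReal * C₃ * 16 + C₁ * 4, fun a h B ψ hψ x t t' h0 htt ht => ?_⟩
  have hψm := hψ.meas
  have hm1 : ∀ t, Measurable fun r => fk a 1 (x, t) r := fun t =>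
    h.measurable_fk_comp 1 measurable_const measurable_id
  rw [← integral_sub (hC₀ a h B ψ hψ (x, t) (h0.trans htt) ht).1
    (hC₀ a h B ψ hψ (x, t') h0 (htt.trans ht)).1]
  simp_rw [← sub_mul]
  refine (enorm_integral_mul_le _ _).trans ?_
  have hmd : Measurable fun r => ‖fk a 1 (x, t) r - fk a 1 (x, t') r‖ₑ * ‖ψ r‖ₑ :=
    ((hm1 t).sub (hm1 t')).enorm.mul hψm.enorm
  rw [lintegral_spacetime hmd]
  have hM := h.M_pos
  set D := ENNReal.ofReal ((t - t') ^ (1 / 4 : ℝ)) with hD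
  have hne : ∀ᵐ s : ℝ, s ≠ t' := by simp [ae_iff]
  have h4 : ENNReal.ofReal ((t - t') ^ (1 - 3 / 4 : ℝ) / (1 - 3 / 4)) = 4 * D := by
    rw [hD, ← ENNReal.ofReal_ofNat, ← ENNReal.ofReal_mul (by norm_num)]
    congr 1
    norm_num
    ring
  have far : ∫⁻ s in Iio t', ∫⁻ r in Ioc t' t, C₃ * B * tw (7 / 4) (r - s)
      ≤ C₃ * B * (16 * D) := by
    rw [lintegral_lintegral_swap (by fun_prop)]
    calc _ ≤ ∫⁻ r in Ioc t' t, C₃ * B * (4 * tw (3 / 4) (r - t')) := by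
          refine setLIntegral_mono' measurableSet_Ioc fun r hr => ?_
          rw [lintegral_const_mul _ (by fun_prop), lintegral_tw_past (by norm_num) hr.1]
          gcongr
          rw [tw_of_pos (sub_pos.2 hr.1), ← ENNReal.ofReal_ofNat,
            ← ENNReal.ofReal_mul (by norm_num)]
          apply ENNReal.ofReal_le_ofReal
          have : 0 ≤ (r - t') ^ (-(3 / 4) : ℝ) := Real.rpow_nonneg (sub_pos.2 hr.1).le _
          norm_num1 at this ⊢
          linarith
      _ ≤ C₃ * B * (4 * ENNReal.ofReal ((t - t') ^ (1 - 3 / 4 : ℝ) / (1 - 3 / 4))) := by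
          rw [lintegral_const_mul _ (by fun_prop), lintegral_const_mul _ (by fun_prop)]
          gcongr
          exact lintegral_tw_Ioc_le (by norm_num) htt
      _ = _ := by rw [h4]; ring
  have near : ∫⁻ s in Ioi t', C₁ * B * tw (3 / 4) (t - s) = C₁ * B * (4 * D) := by
    rw [lintegral_const_mul _ (by fun_prop), lintegral_tw_sub (by norm_num) htt, h4]
  have hmf : Measurable fun s => ∫⁻ r in Ioc t' t, C₃ * B * tw (7 / 4) (r - s) :=
    Measurable.lintegral_prod_right' (f := fun z : ℝ × ℝ => C₃ * B * tw (7 / 4) (z.2 - z.1))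
      (by fun_prop)
  calc _ ≤ ∫⁻ s, ((Iio t').indicator (fun s => ENNReal.ofReal M *
          ∫⁻ r in Ioc t' t, C₃ * B * tw (7 / 4) (r - s)) s
        + (Ioi t').indicator (fun s => C₁ * B * tw (3 / 4) (t - s)) s) := by
        refine lintegral_mono_ae ?_
        filter_upwards [hC₁ a h B ψ hψ, hC₃ a h B ψ hψ, hne] with s h1 h3 hs
        have e1 : ((1 : ℕ) / 2 + 1 / 4 : ℝ) = 3 / 4 := by norm_num
        have e3 : ((3 : ℕ) / 2 + 1 / 4 : ℝ) = 7 / 4 := by norm_num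
        rw [e1] at h1
        rw [e3] at h3
        rcases lt_or_gt_of_ne hs with hs | hs
        · rw [indicator_of_mem (by simpa using hs)]
          refine le_add_right ((lintegral_fk_sub_time_le h 1 hs htt
            (φ := fun y => ‖ψ (y, s)‖ₑ) (by fun_prop)).trans ?_)
          refine mul_le_mul_right (setLIntegral_mono' measurableSet_Ioc fun r hr => ?_) _
          exact h3 x r (hs.trans hr.1) (hr.2.trans ht)
        · refine le_add_left ?_
          rw [indicator_of_mem (by simpa using hs)]
          rcases le_or_gt t s with hts | hts
          · simp [fun y => fk_of_le h 1 (show (x, t).2 ≤ (y, s).2 from hts),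
              fun y => fk_of_le h 1 (show (x, t').2 ≤ (y, s).2 from le_of_lt hs)]
          · simp only [fun y => fk_of_le h 1 (show (x, t').2 ≤ (y, s).2 from le_of_lt hs), sub_zero]
            exact h1 x t hts ht
    _ ≤ ENNReal.ofReal M * (C₃ * B * (16 * D)) + C₁ * B * (4 * D) := by
        rw [lintegral_add_left ((hmf.const_mul _).indicator measurableSet_Iio),
          lintegral_indicator measurableSet_Iio, lintegral_indicator measurableSet_Ioi,
          lintegral_const_mul _ hmf, near]
        gcongr
    _ = _ := by
        push_cast
        rw [show (M.toNNReal : ℝ≥0∞) = ENNReal.ofReal M from rfl]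
        ring

end PotentialEstimates

/-! ### Gaussian averages of bounded, square integrable and absolutely continuous functions -/

/-- Cauchy-Schwarz for the measure with density w, applied to 1 and φ. -/
lemma sq_lintegral_mul_le {α : Type*} [MeasurableSpace α] (μ : Measure α) {w φ : α → ℝ≥0∞}
    (hw : Measurable w) (hφ : Measurable φ) :
    (∫⁻ x, w x * φ x ∂μ) ^ 2 ≤ (∫⁻ x, w x ∂μ) * ∫⁻ x, w x * φ x ^ 2 ∂μ := by
  have h := ENNReal.lintegral_mul_le_Lp_mul_Lq (μ.withDensity w) Real.HolderConjugate.two_two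
    (f := fun _ => 1) (g := φ) aemeasurable_const hφ.aemeasurable
  simp only [Pi.mul_apply, one_mul, ENNReal.one_rpow] at h
  rw [lintegral_withDensity_eq_lintegral_mul _ hw hφ,
    lintegral_withDensity_eq_lintegral_mul _ hw (hφ.pow_const _),
    lintegral_withDensity_eq_lintegral_mul _ hw measurable_const,
    ← ENNReal.mul_rpow_of_nonneg _ _ (by norm_num)] at h
  simp only [Pi.mul_apply, mul_one] at h
  calc _ ≤ (((∫⁻ x, w x ∂μ) * ∫⁻ x, w x * φ x ^ (2 : ℝ) ∂μ) ^ (1 / 2 : ℝ)) ^ 2 := by gcongr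
    _ = _ := by
        rw [← ENNReal.rpow_natCast, ← ENNReal.rpow_mul]
        norm_num

/-- Almost every time slice of an almost everywhere property. -/
lemma ae_ae_slice {P : ℝ × ℝ → Prop} (h : ∀ᵐ r, P r) : ∀ᵐ s : ℝ, ∀ᵐ y : ℝ, P (y, s) := by
  have h1 : ∀ᵐ r : ℝ × ℝ ∂(volume.prod volume), P r.swap :=
    (Measure.measurePreserving_swap (μ := volume) (ν := volume)).quasiMeasurePreserving.ae h
  exact Measure.ae_ae_of_ae_prod h1

/-- The averages have no singularity at all; the factor T^(1/4) only pads the bound so that G fits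
the same class as f. -/
lemma isSource_of_bdd {c T : ℝ} (hc : 0 < c) {C₀ : ℝ≥0} {G : ℝ × ℝ → ℝ} (hG : Measurable G)
    (h0 : ∀ r : ℝ × ℝ, r.2 ≤ 0 → G r = 0) (hb : ∀ᵐ r, ‖G r‖ₑ ≤ C₀) :
    IsSource c T (C₀ * (T ^ (1 / 4 : ℝ)).toNNReal) G := by
  refine ⟨hG, h0, ?_⟩
  filter_upwards [ae_ae_slice hb] with s hs x t hst htT
  rcases le_or_gt s 0 with hs0 | hs0
  · simp [fun y => h0 (y, s) hs0]
  calc ∫⁻ y, hk c (x, t) (y, s) * ‖G (y, s)‖ₑ ≤ ∫⁻ y, hk c (x, t) (y, s) * C₀ := by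
        refine lintegral_mono_ae ?_
        filter_upwards [hs] with y hy
        gcongr
    _ = C₀ := by rw [lintegral_mul_const _ (by fun_prop), lintegral_hk_slice hc hst, one_mul]
    _ ≤ C₀ * (ENNReal.ofReal (T ^ (1 / 4 : ℝ)) * tw (1 / 4) (t - s)) := by
        have h1 : tw 0 (t - s) ≤ ENNReal.ofReal (T ^ (1 / 4 - 0 : ℝ)) * tw (1 / 4) (t - s) :=
          tw_le_tw (by norm_num) (by linarith)
        rw [tw_of_pos (sub_pos.2 hst), neg_zero, Real.rpow_zero, ENNReal.ofReal_one,
          sub_zero] at h1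
        exact le_mul_of_one_le_right zero_le h1
    _ = _ := by
        push_cast
        rw [mul_assoc]
        rfl

/-- Cauchy-Schwarz and the supremum (cσ)^(-1/2) of the Gaussian give σ^(-1/4) after the square root.
This is where the exponent in `IsSource` comes from. -/
lemma isSource_of_sq {c T : ℝ} (hc : 0 < c) {C₀ : ℝ≥0} {f : ℝ × ℝ → ℝ} (hf : Measurable f)
    (h0 : ∀ r : ℝ × ℝ, r.2 ≤ 0 → f r = 0) (hb : ∀ᵐ s : ℝ, ∫⁻ y, ‖f (y, s)‖ₑ ^ 2 ≤ C₀ ^ 2) :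
    IsSource c T (C₀ * (c ^ (-(1 / 4) : ℝ)).toNNReal) f := by
  refine ⟨hf, h0, ?_⟩
  filter_upwards [hb] with s hs x t hst htT
  have hσ : 0 < t - s := sub_pos.2 hst
  rw [← ENNReal.pow_le_pow_left_iff two_ne_zero]
  calc _ ≤ (∫⁻ y, hk c (x, t) (y, s)) * ∫⁻ y, hk c (x, t) (y, s) * ‖f (y, s)‖ₑ ^ 2 :=
        sq_lintegral_mul_le _ (by fun_prop) (by fun_prop)
    _ ≤ 1 * ∫⁻ y, ENNReal.ofReal (1 / √(c * (t - s))) * ‖f (y, s)‖ₑ ^ 2 := by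
        rw [lintegral_hk_slice hc hst]
        gcongr with y
        exact ENNReal.ofReal_le_ofReal (gk_le_sup (by positivity) _)
    _ ≤ ENNReal.ofReal (1 / √(c * (t - s))) * C₀ ^ 2 := by
        rw [one_mul, lintegral_const_mul _ (by fun_prop)]
        gcongr
    _ = _ := by
        rw [tw_of_pos hσ]
        push_cast
        change _ = ((C₀ : ℝ≥0∞) * ENNReal.ofReal (c ^ (-(1 / 4) : ℝ)) * _) ^ 2
        rw [mul_assoc, ← ENNReal.ofReal_mul (by positivity), mul_pow, ← ENNReal.ofReal_pow
          (by positivity), mul_comm, ← Real.mul_rpow hc.le hσ.le, ← Real.rpow_natCast,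
          ← Real.rpow_mul (by positivity), Real.sqrt_eq_rpow, one_div, ← Real.rpow_neg
          (by positivity)]
        norm_num

/-- With w = x - ξ, the increment of ψ is at most the integral of |q| over the interval of radius
|w| about x. Integrating in x first gives 2|w| ‖q‖₁, and the Gaussian mean of |w| is of order √v.
The symmetric interval costs a factor 2 and avoids distinguishing the sign of w. -/
lemma lintegral_gk_mul_enorm_sub_le_of_measurable {v : ℝ} (hv : 0 < v) {q : ℝ → ℝ}
    (hqm : Measurable q) (hq : Integrable q) {b : ℝ} {ψ : ℝ → ℝ}
    (hψ : ∀ᵐ ξ, ψ ξ = b + ∫ z in Iic ξ, q z) :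
    ∫⁻ x, ∫⁻ ξ, ENNReal.ofReal (gk v (x - ξ)) * ‖ψ ξ - ψ x‖ₑ
      ≤ ENNReal.ofReal (8 * √v) * ∫⁻ z, ‖q z‖ₑ := by
  set H : ℝ → ℝ → ℝ≥0∞ := fun x w => ∫⁻ z, {z | |x - z| ≤ |w|}.indicator (fun z => ‖q z‖ₑ) z
    with hH
  have hjm : Measurable fun r : (ℝ × ℝ) × ℝ =>
      {z | |r.1.1 - z| ≤ |r.1.2|}.indicator (fun z => ‖q z‖ₑ) r.2 := by
    have : (fun r : (ℝ × ℝ) × ℝ => {z | |r.1.1 - z| ≤ |r.1.2|}.indicator (fun z => ‖q z‖ₑ) r.2)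
        = {r : (ℝ × ℝ) × ℝ | |r.1.1 - r.2| ≤ |r.1.2|}.indicator (fun r => ‖q r.2‖ₑ) := by
      funext r; simp [indicator]
    rw [this]
    exact Measurable.indicator (by fun_prop) (measurableSet_le (by fun_prop) (by fun_prop))
  have hHm : Measurable fun r : ℝ × ℝ => H r.1 r.2 := hjm.lintegral_prod_right'
  have hle : ∀ᵐ x, ∀ᵐ ξ, ‖ψ ξ - ψ x‖ₑ ≤ H x (x - ξ) := by
    filter_upwards [hψ] with x hx
    filter_upwards [hψ] with ξ hξ
    rw [hx, hξ, add_sub_add_left_eq_sub, intervalIntegral.integral_Iic_sub_Iic hq.integrableOn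
      hq.integrableOn, hH]
    dsimp only
    have hms : MeasurableSet {z | |x - z| ≤ |x - ξ|} :=
      measurableSet_le (by fun_prop) (by fun_prop)
    rw [lintegral_indicator hms]
    have h1 : ‖∫ z in x..ξ, q z‖ₑ ≤ ∫⁻ z in uIoc x ξ, ‖q z‖ₑ := by
      rcases le_total x ξ with hxi | hxi
      · rw [intervalIntegral.integral_of_le hxi, uIoc_of_le hxi]
        exact enorm_integral_le_lintegral_enorm _
      · rw [intervalIntegral.integral_of_ge hxi, uIoc_of_ge hxi, enorm_neg]
        exact enorm_integral_le_lintegral_enorm _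
    refine h1.trans (lintegral_mono_set fun z hz => ?_)
    have := abs_sub_left_of_mem_uIcc (uIoc_subset_uIcc hz)
    simpa [abs_sub_comm] using this
  have hH1 : ∀ w, ∫⁻ x, H x w = ENNReal.ofReal (2 * |w|) * ∫⁻ z, ‖q z‖ₑ := by
    intro w
    have hjw : Measurable fun r : ℝ × ℝ =>
        {z | |r.1 - z| ≤ |w|}.indicator (fun z => ‖q z‖ₑ) r.2 :=
      hjm.comp (by fun_prop : Measurable fun r : ℝ × ℝ => ((r.1, w), r.2))
    rw [hH, lintegral_lintegral_swap hjw.aemeasurable, ← lintegral_const_mul _ (by fun_prop)]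
    congr 1; funext z
    have e : ∀ x, {z | |x - z| ≤ |w|}.indicator (fun z => ‖q z‖ₑ) z
        = (Icc (z - |w|) (z + |w|)).indicator (fun _ => ‖q z‖ₑ) x := fun x => by
      have : |x - z| ≤ |w| ↔ z - |w| ≤ x ∧ x ≤ z + |w| := by
        rw [abs_le]; constructor <;> rintro ⟨h1, h2⟩ <;> constructor <;> linarith
      simp [indicator, this]
    simp_rw [e]
    rw [lintegral_indicator measurableSet_Icc, setLIntegral_const, Real.volume_Icc, mul_comm]
    congr 2
    ring
  calc _ ≤ ∫⁻ x, ∫⁻ ξ, ENNReal.ofReal (gk v (x - ξ)) * H x (x - ξ) := by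
        refine lintegral_mono_ae ?_
        filter_upwards [hle] with x hx
        refine lintegral_mono_ae ?_
        filter_upwards [hx] with ξ hξ
        gcongr
    _ = ∫⁻ x, ∫⁻ w, ENNReal.ofReal (gk v w) * H x w := by
        congr 1; funext x
        exact lintegral_sub_left_eq_self (fun w => ENNReal.ofReal (gk v w) * H x w) x
    _ = ∫⁻ w, ENNReal.ofReal (gk v w) * (ENNReal.ofReal (2 * |w|) * ∫⁻ z, ‖q z‖ₑ) := by
        rw [lintegral_lintegral_swap]
        · congr 1; funext w
          rw [lintegral_const_mul, hH1]
          exact hHm.comp (by fun_prop : Measurable fun x : ℝ => (x, w))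
        · refine (Measurable.mul (by fun_prop) hHm).aemeasurable
    _ ≤ ∫⁻ w, ENNReal.ofReal (8 * √v) * (∫⁻ z, ‖q z‖ₑ) * ENNReal.ofReal (gk (2 * v) w) := by
        refine lintegral_mono fun w => ?_
        rw [← mul_assoc, ← ENNReal.ofReal_mul (gk_nonneg _ _),
          mul_right_comm (ENNReal.ofReal (8 * √v)), ← ENNReal.ofReal_mul (by positivity)]
        refine mul_le_mul_left (ENNReal.ofReal_le_ofReal ?_) _
        have := abs_mul_gk_le hv w
        linarith
    _ = _ := by
        rw [lintegral_const_mul _ (by fun_prop), lintegral_gk (by positivity), mul_one]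

/-- The oscillation of an absolutely continuous function in Gaussian mean. -/
lemma lintegral_gk_mul_enorm_sub_le {v : ℝ} (hv : 0 < v) {q : ℝ → ℝ} (hq : Integrable q) {b : ℝ}
    {ψ : ℝ → ℝ} (hψ : ∀ᵐ ξ, ψ ξ = b + ∫ z in Iic ξ, q z) :
    ∫⁻ x, ∫⁻ ξ, ENNReal.ofReal (gk v (x - ξ)) * ‖ψ ξ - ψ x‖ₑ
      ≤ ENNReal.ofReal (8 * √v) * ∫⁻ z, ‖q z‖ₑ := by
  have he := hq.aestronglyMeasurable.ae_eq_mk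
  have e1 : ∫⁻ z, ‖q z‖ₑ = ∫⁻ z, ‖hq.aestronglyMeasurable.mk q z‖ₑ := by
    refine lintegral_congr_ae ?_
    filter_upwards [he] with z hz
    rw [hz]
  rw [e1]
  refine lintegral_gk_mul_enorm_sub_le_of_measurable hv
    hq.aestronglyMeasurable.stronglyMeasurable_mk.measurable (hq.congr he) (b := b) ?_
  filter_upwards [hψ] with ξ hξ
  rw [hξ]
  congr 1
  exact integral_congr_ae (ae_restrict_of_ae he)

/-! ### The Duhamel integral -/

/-- The space derivative of the Duhamel integral of `F`. -/
noncomputable def duh (a : ℝ × ℝ → ℝ) (γ : ℝ) (F : ℝ × ℝ → ℝ) (p : ℝ × ℝ) : ℝ :=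
  ∫ q, solX a γ p q * F q

section Duhamel

variable {m M L γ T : ℝ}

lemma IsCoeff.measurable_duh {a : ℝ × ℝ → ℝ} (h : IsCoeff m M L a) (hγ : 0 ≤ γ)
    {F : ℝ × ℝ → ℝ} (hF : Measurable F) : Measurable (duh a γ F) :=
  ((measurable_solX h hγ).mul
    (hF.comp measurable_snd)).stronglyMeasurable.integral_prod_right'.measurable

lemma abs_le_of_enorm_le {y r : ℝ} {C B : ℝ≥0} (hr : 0 ≤ r)
    (h : ‖y‖ₑ ≤ C * B * ENNReal.ofReal r) : |y| ≤ C * B * r := by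
  rwa [← ENNReal.ofReal_coe_nnreal, ← ENNReal.ofReal_coe_nnreal, ← ENNReal.ofReal_mul (by simp),
    ← ENNReal.ofReal_mul (by positivity), ← ofReal_norm, ENNReal.ofReal_le_ofReal_iff
    (by positivity), Real.norm_eq_abs] at h

lemma IsSource.integral_solX_mul {a : ℝ × ℝ → ℝ} (h : IsCoeff m M L a) (hγ : 0 ≤ γ) {B : ℝ≥0}
    {F : ℝ × ℝ → ℝ} (hF : IsSource (64 * M) T B F) {p : ℝ × ℝ} (h0 : 0 ≤ p.2) (hp : p.2 ≤ T) :
    Integrable (fun q => solX a γ p q * F q) ∧ duh a γ F p = ∫ r, fk a 1 p r * dens a γ F r :=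
  _root_.integral_solX_mul h hγ hF.meas hF.zero ((hF.lintegral_le (by norm_num) h0 hp).trans_lt
    (ENNReal.mul_lt_top ENNReal.coe_lt_top ENNReal.ofReal_lt_top))

/-- Size and Hölder continuity of the Duhamel integral. -/
lemma exists_duh_estimates (hm : 0 < m) (hmM : m ≤ M) (hL : 0 ≤ L) (hγ : 0 ≤ γ) :
    ∃ C : ℝ, 0 < C ∧ ∀ a : ℝ × ℝ → ℝ, IsCoeff m M L a → ∀ (B : ℝ≥0) (F : ℝ × ℝ → ℝ),
      IsSource (64 * M) T B F →
        (∀ p : ℝ × ℝ, 0 ≤ p.2 → p.2 ≤ T → |duh a γ F p| ≤ C * B * p.2 ^ (1 / 4 : ℝ)) ∧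
        (∀ p r : ℝ × ℝ, 0 ≤ r.2 → r.2 ≤ p.2 → p.2 ≤ T → |duh a γ F r - duh a γ F p|
          ≤ C * B * (|r.1 - p.1| ^ (1 / 4 : ℝ) + |r.2 - p.2| ^ (1 / 4 : ℝ))) := by
  obtain ⟨C, hC⟩ := exists_isSource_dens (T := T) hm hmM hL hγ
  obtain ⟨C₀, h₀⟩ := exists_potential_bound (L := L) (T := T) hm hmM
  obtain ⟨C₁, h₁⟩ := exists_potential_sub_space (L := L) (T := T) hm hmM
  obtain ⟨C₂, h₂⟩ := exists_potential_sub_time (L := L) (T := T) hm hmM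
  refine ⟨(C₀ + C₁ + C₂) * C + 1, by positivity, fun a h B F hF => ?_⟩
  have hψ := hC a h B F hF
  have hx : ∀ {D : ℝ≥0} {r : ℝ}, 0 ≤ r → D ≤ C₀ + C₁ + C₂ →
      (D : ℝ) * (C * B : ℝ≥0) * r ≤ ((C₀ + C₁ + C₂) * C + 1) * B * r := by
    intro D r hr hD
    have : (D : ℝ) ≤ C₀ + C₁ + C₂ := by exact_mod_cast hD
    push_cast
    refine mul_le_mul_of_nonneg_right ?_ hr
    calc (D : ℝ) * (C * B) ≤ (C₀ + C₁ + C₂) * (C * B) := by gcongr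
      _ ≤ _ := by nlinarith [B.coe_nonneg]
  constructor
  · intro p h0 hp
    rw [(hF.integral_solX_mul h hγ h0 hp).2]
    have hr : 0 ≤ p.2 ^ (1 / 4 : ℝ) := by positivity
    exact (abs_le_of_enorm_le hr (h₀ a h _ _ hψ p h0 hp).2).trans
      (hx hr (le_add_right le_self_add))
  · rintro ⟨x, t⟩ ⟨x', t'⟩ h0 hrp hp
    dsimp only at h0 hrp hp ⊢
    rw [(hF.integral_solX_mul h hγ (p := (x', t')) h0 (hrp.trans hp)).2,
      (hF.integral_solX_mul h hγ (p := (x, t)) (h0.trans hrp) hp).2]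
    set P : ℝ × ℝ → ℝ := fun p => ∫ r, fk a 1 p r * dens a γ F r
    have k1 : |P (x', t') - P (x, t')|
        ≤ ((C₀ + C₁ + C₂) * C + 1) * B * |x' - x| ^ (1 / 4 : ℝ) :=
      (abs_le_of_enorm_le (by positivity) (h₁ a h _ _ hψ x' x t' h0 (hrp.trans hp))).trans
        (hx (by positivity) (le_add_right le_add_self))
    have k2 : |P (x, t) - P (x, t')|
        ≤ ((C₀ + C₁ + C₂) * C + 1) * B * (t - t') ^ (1 / 4 : ℝ) :=
      (abs_le_of_enorm_le (Real.rpow_nonneg (sub_nonneg.2 hrp) _)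
        (h₂ a h _ _ hψ x t t' h0 hrp hp)).trans
        (hx (Real.rpow_nonneg (sub_nonneg.2 hrp) _) le_add_self)
    rw [abs_sub_comm t' t, abs_of_nonneg (sub_nonneg.2 hrp), mul_add]
    rw [abs_sub_comm] at k2
    exact (abs_sub_le _ (P (x, t')) _).trans (add_le_add k1 k2)

lemma exists_enorm_duh_le (hm : 0 < m) (hmM : m ≤ M) (hL : 0 ≤ L) (hγ : 0 ≤ γ) (hT : 0 < T) :
    ∃ C : ℝ≥0, ∀ a : ℝ × ℝ → ℝ, IsCoeff m M L a → ∀ p q : ℝ × ℝ, p.2 - q.2 ≤ T →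
      ‖solX a γ p q‖ₑ ≤ C * (tw (1 / 2) (p.2 - q.2) * hk (64 * M) p q) := by
  obtain ⟨C, hC, hb⟩ := exists_solX_bound hm hmM hL hγ hT
  exact ⟨C.toNNReal, fun a h p q hpq => (hb a h p q hpq).1⟩

/-- The space norm of the Duhamel integral of a square integrable source. -/
lemma exists_lintegral_sq_duh_le_of_sq (hm : 0 < m) (hmM : m ≤ M) (hL : 0 ≤ L) (hγ : 0 ≤ γ)
    (hT : 0 < T) :
    ∃ K : ℝ≥0, ∀ a : ℝ × ℝ → ℝ, IsCoeff m M L a → ∀ (C₀ : ℝ≥0) (f : ℝ × ℝ → ℝ), Measurable f →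
      (∀ r : ℝ × ℝ, r.2 ≤ 0 → f r = 0) → (∀ᵐ s : ℝ, ∫⁻ y, ‖f (y, s)‖ₑ ^ 2 ≤ C₀ ^ 2) →
      ∀ t, 0 ≤ t → t ≤ T → ∫⁻ x, ‖duh a γ f (x, t)‖ₑ ^ 2 ≤ K * C₀ ^ 2 := by
  obtain ⟨C, hC⟩ := exists_enorm_duh_le hm hmM hL hγ hT
  have hM : 0 < M := hm.trans_le hmM
  have hM' : 0 < 64 * M := by positivity
  refine ⟨C ^ 2 * (T ^ (1 / 2 : ℝ) * 2).toNNReal ^ 2, fun a h C₀ f hf h0 hb t ht0 htT => ?_⟩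
  set S := {q : ℝ × ℝ | 0 < q.2} with hS
  have hSm : MeasurableSet S := measurableSet_after 0
  have hE : ENNReal.ofReal ((t - 0) ^ (1 - 1 / 2 : ℝ) / (1 - 1 / 2))
      ≤ ENNReal.ofReal (T ^ (1 / 2 : ℝ) * 2) := by
    apply ENNReal.ofReal_le_ofReal
    have : t ^ (1 / 2 : ℝ) ≤ T ^ (1 / 2 : ℝ) := by gcongr
    rw [sub_zero]
    norm_num1
    linarith
  set E := ENNReal.ofReal (T ^ (1 / 2 : ℝ) * 2) with hEd
  -- Schur's test: Cauchy-Schwarz against the majorant uses its total mass in the source variable,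
  -- and the later integration in x uses its mass in x. Both are finite, so no pointwise bound on f
  -- is needed.
  have h1 : ∀ x, ‖duh a γ f (x, t)‖ₑ ^ 2
      ≤ C ^ 2 * (E * ∫⁻ q in S, tw (1 / 2) (t - q.2) * hk (64 * M) (x, t) q * ‖f q‖ₑ ^ 2) := by
    intro x
    have k1 : ‖duh a γ f (x, t)‖ₑ
        ≤ C * ∫⁻ q in S, tw (1 / 2) (t - q.2) * hk (64 * M) (x, t) q * ‖f q‖ₑ := by
      refine (enorm_integral_mul_le _ _).trans ?_
      rw [← lintegral_const_mul _ (by fun_prop), ← lintegral_indicator hSm]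
      refine lintegral_mono fun q => ?_
      by_cases hq : 0 < q.2
      · rw [indicator_of_mem (by simpa [hS] using hq), ← mul_assoc]
        exact mul_le_mul_left (hC a h (x, t) q (by dsimp only; linarith)) _
      · simp [h0 q (not_lt.1 hq)]
    calc _ ≤ (C * ∫⁻ q in S, tw (1 / 2) (t - q.2) * hk (64 * M) (x, t) q * ‖f q‖ₑ) ^ 2 := by
          gcongr
      _ ≤ C ^ 2 * ((∫⁻ q in S, tw (1 / 2) (t - q.2) * hk (64 * M) (x, t) q) *
          ∫⁻ q in S, tw (1 / 2) (t - q.2) * hk (64 * M) (x, t) q * ‖f q‖ₑ ^ 2) := by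
          rw [mul_pow]
          gcongr
          exact sq_lintegral_mul_le _ (by fun_prop) (by fun_prop)
      _ ≤ _ := by
          gcongr
          exact (lintegral_tw_hk_after hM' (by norm_num) (p := (x, t)) ht0).le.trans hE
  have h2 : ∫⁻ x, ∫⁻ q in S, tw (1 / 2) (t - q.2) * hk (64 * M) (x, t) q * ‖f q‖ₑ ^ 2
      ≤ E * C₀ ^ 2 := by
    rw [lintegral_lintegral_swap (by fun_prop)]
    have k2 : ∀ q : ℝ × ℝ, ∫⁻ x, tw (1 / 2) (t - q.2) * hk (64 * M) (x, t) q * ‖f q‖ₑ ^ 2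
        = tw (1 / 2) (t - q.2) * ‖f q‖ₑ ^ 2 := by
      intro q
      rcases le_or_gt t q.2 with hq | hq
      · simp [tw_of_nonpos (sub_nonpos.2 hq)]
      simp_rw [mul_right_comm _ _ (‖f q‖ₑ ^ 2)]
      rw [lintegral_const_mul _ (by fun_prop)]
      have : ∫⁻ x, hk (64 * M) (x, t) q = 1 :=
        lintegral_gk_sub' (mul_pos hM' (sub_pos.2 hq)) q.1
      rw [this, mul_one]
    simp_rw [k2]
    rw [← lintegral_indicator hSm, lintegral_spacetime
      (Measurable.indicator (by fun_prop) hSm)]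
    calc _ ≤ ∫⁻ s, (Ioi 0).indicator (fun s => tw (1 / 2) (t - s) * C₀ ^ 2) s := by
          refine lintegral_mono_ae ?_
          filter_upwards [hb] with s hs
          by_cases hs0 : 0 < s
          · have e : ∀ y, S.indicator (fun q => tw (1 / 2) (t - q.2) * ‖f q‖ₑ ^ 2) (y, s)
                = tw (1 / 2) (t - s) * ‖f (y, s)‖ₑ ^ 2 := fun y => by simp [hS, indicator, hs0]
            simp_rw [e]
            rw [lintegral_const_mul _ (by fun_prop), indicator_of_mem (by simpa using hs0)]
            gcongr
          · simp [hS, indicator, hs0]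
      _ = ENNReal.ofReal ((t - 0) ^ (1 - 1 / 2 : ℝ) / (1 - 1 / 2)) * C₀ ^ 2 := by
          rw [lintegral_indicator measurableSet_Ioi, lintegral_mul_const _ (by fun_prop),
            lintegral_tw_sub (by norm_num) ht0]
      _ ≤ _ := by gcongr
  have hmm : Measurable fun x =>
      ∫⁻ q in S, tw (1 / 2) (t - q.2) * hk (64 * M) (x, t) q * ‖f q‖ₑ ^ 2 :=
    Measurable.lintegral_prod_right' (f := fun z : ℝ × (ℝ × ℝ) =>
      tw (1 / 2) (t - z.2.2) * hk (64 * M) (z.1, t) z.2 * ‖f z.2‖ₑ ^ 2) (by fun_prop)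
  calc _ ≤ C ^ 2 * (E * (E * C₀ ^ 2)) := by
        refine (lintegral_mono h1).trans ?_
        rw [lintegral_const_mul _ (hmm.const_mul _), lintegral_const_mul _ hmm]
        gcongr
    _ = _ := by
        push_cast
        rw [show (((T ^ (1 / 2 : ℝ) * 2).toNNReal : ℝ≥0) : ℝ≥0∞) = E from rfl]
        ring

/-- The Duhamel integral in terms of the oscillation of the source. -/
lemma exists_enorm_duh_le_oscillation (hm : 0 < m) (hmM : m ≤ M) (hL : 0 ≤ L) (hγ : 0 < γ)
    (hT : 0 < T) :
    ∃ C : ℝ≥0, ∀ a : ℝ × ℝ → ℝ, IsCoeff m M L a → ∀ (B : ℝ≥0) (G : ℝ × ℝ → ℝ),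
      IsSource (64 * M) T B G → ∀ x t, 0 ≤ t → t ≤ T →
        ‖duh a γ G (x, t)‖ₑ ≤ C * ∫⁻ τ in Ioo 0 t, tw (1 / 2) (t - τ) *
          ∫⁻ ξ, hk (64 * M) (x, t) (ξ, τ) * ‖G (ξ, τ) - G (x, τ)‖ₑ := by
  obtain ⟨C, hC⟩ := exists_enorm_duh_le hm hmM hL hγ.le hT
  refine ⟨C, fun a h B G hG x t ht0 htT => ?_⟩
  have hGm := hG.meas
  have i1 := (hG.integral_solX_mul h hγ.le (p := (x, t)) ht0 htT).1
  have hmi : Measurable fun τ => tw (1 / 2) (t - τ) *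
      ∫⁻ ξ, hk (64 * M) (x, t) (ξ, τ) * ‖G (ξ, τ) - G (x, τ)‖ₑ :=
    Measurable.mul (by fun_prop) (Measurable.lintegral_prod_right' (f := fun z : ℝ × ℝ =>
      hk (64 * M) (x, t) (z.2, z.1) * ‖G (z.2, z.1) - G (x, z.1)‖ₑ) (by fun_prop))
  rw [duh, Measure.volume_eq_prod, integral_prod_symm _ i1,
    ← lintegral_const_mul _ hmi, ← lintegral_indicator measurableSet_Ioo]
  refine (enorm_integral_le_lintegral_enorm _).trans (lintegral_mono_ae ?_)
  filter_upwards [ae_integral_solX_eq_zero h hγ x t, i1.prod_left_ae] with τ hτ hi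
  by_cases h0 : 0 < τ ∧ τ < t
  · rw [indicator_of_mem (by simpa using h0)]
    obtain ⟨j1, e1⟩ := hτ h0.1 h0.2
    -- By the cancellation the value G(x,τ), constant in ξ, may be subtracted from the source.
    have e2 : ∫ ξ, solX a γ (x, t) (ξ, τ) * G (ξ, τ)
        = ∫ ξ, solX a γ (x, t) (ξ, τ) * (G (ξ, τ) - G (x, τ)) := by
      simp_rw [mul_sub]
      rw [integral_sub hi (j1.mul_const _), integral_mul_const, e1, zero_mul, sub_zero]
    rw [e2]
    refine (enorm_integral_mul_le _ _).trans ?_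
    rw [← mul_assoc, ← lintegral_const_mul _ (by fun_prop)]
    refine lintegral_mono fun ξ => ?_
    calc _ ≤ C * (tw (1 / 2) (t - τ) * hk (64 * M) (x, t) (ξ, τ)) * ‖G (ξ, τ) - G (x, τ)‖ₑ :=
          mul_le_mul_left (hC a h (x, t) (ξ, τ) (by dsimp only; linarith)) _
      _ = _ := by ring
  · have e0 : ∀ ξ, solX a γ (x, t) (ξ, τ) * G (ξ, τ) = 0 := fun ξ => by
      rcases le_or_gt τ 0 with h1 | h1
      · rw [hG.zero (ξ, τ) h1, mul_zero]
      · have h2 : t ≤ τ := not_lt.1 fun h2 => h0 ⟨h1, h2⟩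
        have := hC a h (x, t) (ξ, τ) (by dsimp only; linarith)
        rw [tw_of_nonpos (sub_nonpos.2 h2), zero_mul, mul_zero] at this
        simp [enorm_eq_zero.1 (le_antisymm this zero_le)]
    simp [e0]

/-- The √σ from the oscillation of an absolutely continuous function exactly cancels the singularity
σ^(-1/2) of Γₓ, so the bound is uniform in τ. -/
lemma lintegral_oscillation_slice_le {c : ℝ} (hc : 0 < c) {D : ℝ≥0} {t τ : ℝ} (hτ : τ < t)
    {φ : ℝ → ℝ} (hφ : Measurable φ) {q : ℝ → ℝ} {b : ℝ} (hq : Integrable q)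
    (hqD : ∫⁻ z, ‖q z‖ₑ ≤ D) (hqφ : ∀ᵐ ξ, φ ξ = b + ∫ z in Iic ξ, q z) :
    ∫⁻ x, tw (1 / 2) (t - τ) * ∫⁻ ξ, hk c (x, t) (ξ, τ) * ‖φ ξ - φ x‖ₑ
      ≤ ENNReal.ofReal (8 * √c) * D := by
  have hσ : 0 < t - τ := sub_pos.2 hτ
  have hjs : Measurable fun x => ∫⁻ ξ, hk c (x, t) (ξ, τ) * ‖φ ξ - φ x‖ₑ :=
    Measurable.lintegral_prod_right' (f := fun z : ℝ × ℝ =>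
      hk c (z.1, t) (z.2, τ) * ‖φ z.2 - φ z.1‖ₑ) (by fun_prop)
  rw [lintegral_const_mul _ hjs]
  calc _ ≤ tw (1 / 2) (t - τ) * (ENNReal.ofReal (8 * √(c * (t - τ))) * D) :=
        mul_le_mul_right ((lintegral_gk_mul_enorm_sub_le (mul_pos hc hσ) hq hqφ).trans
          (mul_le_mul_right hqD _)) _
    _ = _ := by
        rw [tw_of_pos hσ, ← mul_assoc, ← ENNReal.ofReal_mul (by positivity)]
        congr 2
        rw [Real.sqrt_mul hc.le, Real.sqrt_eq_rpow (t - τ), Real.rpow_neg hσ.le]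
        field_simp

/-- The space integral of the Duhamel integral of a source with integrable derivative. -/
lemma exists_lintegral_duh_le (hm : 0 < m) (hmM : m ≤ M) (hL : 0 ≤ L) (hγ : 0 < γ)
    (hT : 0 < T) :
    ∃ K : ℝ≥0, ∀ a : ℝ × ℝ → ℝ, IsCoeff m M L a → ∀ (B D : ℝ≥0) (G : ℝ × ℝ → ℝ),
      IsSource (64 * M) T B G →
      (∀ᵐ τ, 0 < τ → τ < T → ∃ (q : ℝ → ℝ) (b : ℝ), Integrable q ∧ ∫⁻ z, ‖q z‖ₑ ≤ D ∧
        ∀ᵐ ξ, G (ξ, τ) = b + ∫ z in Iic ξ, q z) →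
      ∀ t, 0 ≤ t → t ≤ T → ∫⁻ x, ‖duh a γ G (x, t)‖ₑ ≤ K * D := by
  obtain ⟨C, hC⟩ := exists_enorm_duh_le_oscillation hm hmM hL hγ hT
  have hM : 0 < M := hm.trans_le hmM
  have hM' : 0 < 64 * M := by positivity
  refine ⟨C * T.toNNReal * (8 * √(64 * M)).toNNReal, fun a h B D G hG hder t ht0 htT => ?_⟩
  have hGm := hG.meas
  have hjm : Measurable fun z : ℝ × ℝ => tw (1 / 2) (t - z.2) *
      ∫⁻ ξ, hk (64 * M) (z.1, t) (ξ, z.2) * ‖G (ξ, z.2) - G (z.1, z.2)‖ₑ :=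
    Measurable.mul (by fun_prop) (Measurable.lintegral_prod_right' (f := fun z : (ℝ × ℝ) × ℝ =>
      hk (64 * M) (z.1.1, t) (z.2, z.1.2) * ‖G (z.2, z.1.2) - G (z.1.1, z.1.2)‖ₑ) (by fun_prop))
  set A : ℝ≥0∞ := ENNReal.ofReal (8 * √(64 * M)) * D with hA
  have hsl : ∀ᵐ τ ∂(volume.restrict (Ioo 0 t)), ∫⁻ x, tw (1 / 2) (t - τ) *
      ∫⁻ ξ, hk (64 * M) (x, t) (ξ, τ) * ‖G (ξ, τ) - G (x, τ)‖ₑ ≤ A := by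
    rw [ae_restrict_iff' measurableSet_Ioo]
    filter_upwards [hder] with τ hτ hτt
    obtain ⟨q, b, hq, hqD, hqG⟩ := hτ hτt.1 (hτt.2.trans_le htT)
    exact lintegral_oscillation_slice_le hM' hτt.2 (φ := fun ξ => G (ξ, τ)) (by fun_prop)
      hq hqD hqG
  calc _ ≤ C * ∫⁻ x, ∫⁻ τ in Ioo 0 t, tw (1 / 2) (t - τ) *
        ∫⁻ ξ, hk (64 * M) (x, t) (ξ, τ) * ‖G (ξ, τ) - G (x, τ)‖ₑ := by
        rw [← lintegral_const_mul _ hjm.lintegral_prod_right']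
        exact lintegral_mono fun x => hC a h B G hG x t ht0 htT
    _ ≤ C * ∫⁻ τ in Ioo 0 t, A := by
        rw [lintegral_lintegral_swap hjm.aemeasurable]
        exact mul_le_mul_right (lintegral_mono_ae hsl) _
    _ ≤ C * (A * ENNReal.ofReal T) := by
        rw [setLIntegral_const, Real.volume_Ioo, sub_zero]
        gcongr
    _ = _ := by
        push_cast
        simp only [ENNReal.ofNNReal_toNNReal]
        rw [hA]
        ring

/-- The space norm of the Duhamel integral of a bounded source with integrable derivative. -/
lemma exists_lintegral_sq_duh_le_of_bdd (hm : 0 < m) (hmM : m ≤ M) (hL : 0 ≤ L) (hγ : 0 < γ)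
    (hT : 0 < T) :
    ∃ K : ℝ≥0, ∀ a : ℝ × ℝ → ℝ, IsCoeff m M L a → ∀ (B D : ℝ≥0) (G : ℝ × ℝ → ℝ),
      IsSource (64 * M) T B G →
      (∀ᵐ τ, 0 < τ → τ < T → ∃ (q : ℝ → ℝ) (b : ℝ), Integrable q ∧ ∫⁻ z, ‖q z‖ₑ ≤ D ∧
        ∀ᵐ ξ, G (ξ, τ) = b + ∫ z in Iic ξ, q z) →
      ∀ t, 0 ≤ t → t ≤ T → ∫⁻ x, ‖duh a γ G (x, t)‖ₑ ^ 2 ≤ K * B * D := by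
  obtain ⟨C, hC⟩ := exists_lintegral_duh_le hm hmM hL hγ hT
  obtain ⟨C₁, hC₁, hb⟩ := exists_duh_estimates (T := T) hm hmM hL hγ.le
  refine ⟨(C₁ * T ^ (1 / 4 : ℝ)).toNNReal * C, fun a h B D G hG hder t ht0 htT => ?_⟩
  set A := ENNReal.ofReal (C₁ * T ^ (1 / 4 : ℝ)) with hA
  have hsup : ∀ x, ‖duh a γ G (x, t)‖ₑ ≤ A * B := fun x => by
    have := (hb a h B G hG).1 (x, t) ht0 htT
    rw [← ofReal_norm, ← ENNReal.ofReal_coe_nnreal, hA, ← ENNReal.ofReal_mul (by positivity)]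
    apply ENNReal.ofReal_le_ofReal
    rw [Real.norm_eq_abs]
    calc _ ≤ C₁ * B * t ^ (1 / 4 : ℝ) := this
      _ ≤ C₁ * B * T ^ (1 / 4 : ℝ) := by gcongr
      _ = _ := by ring
  -- The L² norm is obtained by interpolation, as the product of the sup bound and the L¹ bound.
  calc ∫⁻ x, ‖duh a γ G (x, t)‖ₑ ^ 2
      ≤ ∫⁻ x, A * B * ‖duh a γ G (x, t)‖ₑ := by
        refine lintegral_mono fun x => ?_
        rw [sq]
        exact mul_le_mul_left (hsup x) _
    _ ≤ A * B * (C * D) := by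
        have hds : Measurable fun x => ‖duh a γ G (x, t)‖ₑ :=
          ((h.measurable_duh hγ.le hG.meas).comp
            (by fun_prop : Measurable fun x : ℝ => (x, t))).enorm
        rw [lintegral_const_mul _ hds]
        exact mul_le_mul_right (hC a h B D G hG hder t ht0 htT) _
    _ = _ := by
        push_cast
        simp only [ENNReal.ofNNReal_toNNReal]
        rw [hA]
        ring

end Duhamel

/-! ### The weighted norms -/

/-- Equivalent to (λt)^β ≤ e^(λt). It turns vanishing at t = 0 into smallness for large λ. -/
lemma exp_neg_mul_rpow_le {lam t β : ℝ} (hlam : 0 < lam) (ht : 0 ≤ t) (hβ : 0 < β) (hβ1 : β ≤ 1) :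
    Real.exp (-lam * t) * t ^ β ≤ lam ^ (-β) := by
  rcases ht.eq_or_lt with rfl | ht
  · rw [Real.zero_rpow hβ.ne', mul_zero]
    positivity
  have h := rpow_le_exp (mul_pos hlam ht) hβ.le hβ1
  rw [Real.mul_rpow hlam.le ht.le] at h
  rw [neg_mul, Real.exp_neg, Real.rpow_neg hlam.le, inv_mul_le_iff₀ (Real.exp_pos _),
    le_mul_inv_iff₀ (by positivity)]
  linarith

/-- Equality is required at every point of the closed strip, not almost everywhere, because the
Hölder seminorm sees single points. -/
lemma normNT_congr {α lam T : ℝ} {S S' : ℝ → ℝ → ℝ} (h : ∀ x, ∀ t ∈ Icc 0 T, S x t = S' x t) :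
    normNT α lam T S = normNT α lam T S' := by
  have h1 : ∀ p, weightedLpNorm p lam T S = weightedLpNorm p lam T S' := fun p => by
    refine eLpNorm_congr_ae ?_
    refine (ae_restrict_iff' (MeasurableSet.univ.prod measurableSet_Icc)).2 ?_
    exact Filter.Eventually.of_forall fun q hq => by
      dsimp only
      rw [h _ _ hq.2]
  have h2 : weightedHolderNorm α lam T S = weightedHolderNorm α lam T S' := by
    unfold weightedHolderNorm
    refine iSup_congr fun x => iSup_congr fun t => iSup_congr fun h₁ => iSup_congr fun h₂ =>
      iSup_congr fun hh => ?_
    rw [h _ _ hh.1, h _ _ hh.2.1]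
  rw [normNT, normNT, h1, h1, h2]

section Norms

variable {α lam T A Q R : ℝ} {S : ℝ → ℝ → ℝ}

lemma weightedLpNorm_top_le (hlam : 0 < lam) (hA : 0 ≤ A)
    (hsup : ∀ x, ∀ t ∈ Icc 0 T, |S x t| ≤ A * t ^ (1 / 4 : ℝ))
    (hR : A * lam ^ (-(1 / 4) : ℝ) ≤ R) : weightedLpNorm ⊤ lam T S ≤ ENNReal.ofReal R := by
  rw [weightedLpNorm, eLpNorm_exponent_top]
  refine eLpNormEssSup_le_of_ae_bound ((ae_restrict_iff'
    (MeasurableSet.univ.prod measurableSet_Icc)).2 (Filter.Eventually.of_forall fun q hq => ?_))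
  rw [norm_mul, Real.norm_eq_abs, Real.norm_eq_abs, abs_of_pos (Real.exp_pos _)]
  have h1 := hsup q.1 q.2 hq.2
  have h2 := exp_neg_mul_rpow_le hlam hq.2.1 (by norm_num : (0 : ℝ) < 1 / 4) (by norm_num)
  calc _ ≤ Real.exp (-lam * q.2) * (A * q.2 ^ (1 / 4 : ℝ)) := by gcongr
    _ = A * (Real.exp (-lam * q.2) * q.2 ^ (1 / 4 : ℝ)) := by ring
    _ ≤ A * lam ^ (-(1 / 4) : ℝ) := by gcongr
    _ ≤ R := hR

lemma weightedLpNorm_two_le (hlam : 0 < lam) (hR0 : 0 ≤ R)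
    (hS : Measurable fun q : ℝ × ℝ => S q.1 q.2)
    (hsq : ∀ t ∈ Icc 0 T, ∫⁻ x, ‖S x t‖ₑ ^ 2 ≤ ENNReal.ofReal Q) (hQ : 0 ≤ Q)
    (hR : Q / lam ≤ R ^ 2) : weightedLpNorm 2 lam T S ≤ ENNReal.ofReal R := by
  have key : ∫⁻ q, ‖Real.exp (-lam * q.2) * S q.1 q.2‖ₑ ^ 2 ∂(stripMeasure T)
      ≤ ENNReal.ofReal R ^ 2 := by
    rw [stripMeasure, Measure.volume_eq_prod, ← Measure.prod_restrict, Measure.restrict_univ,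
      lintegral_prod_symm' _ (by fun_prop)]
    have hx : ∀ t ∈ Icc 0 T, ∫⁻ x, ‖Real.exp (-lam * t) * S x t‖ₑ ^ 2
        ≤ ENNReal.ofReal Q * ENNReal.ofReal (Real.exp (-(2 * lam) * t)) := by
      intro t ht
      have e : ∀ x, ‖Real.exp (-lam * t) * S x t‖ₑ ^ 2
          = ENNReal.ofReal (Real.exp (-(2 * lam) * t)) * ‖S x t‖ₑ ^ 2 := fun x => by
        rw [enorm_mul, mul_pow, Real.enorm_eq_ofReal (Real.exp_pos _).le,
          ← ENNReal.ofReal_pow (Real.exp_pos _).le, ← Real.exp_nat_mul]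
        congr 3
        push_cast
        ring
      simp_rw [e]
      have hSt : Measurable fun x => ‖S x t‖ₑ ^ 2 :=
        (hS.comp (by fun_prop : Measurable fun x : ℝ => (x, t))).enorm.pow_const 2
      rw [lintegral_const_mul _ hSt, mul_comm]
      exact mul_le_mul_left (hsq t ht) _
    have hexp : ∫⁻ t in Icc 0 T, ENNReal.ofReal (Real.exp (-(2 * lam) * t))
        ≤ ENNReal.ofReal (1 / lam) := by
      have hneg : -(2 * lam) < 0 := by linarith
      calc _ ≤ ∫⁻ t in Ici 0, ENNReal.ofReal (Real.exp (-(2 * lam) * t)) :=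
            lintegral_mono_set Icc_subset_Ici_self
        _ = ∫⁻ t in Ioi 0, ENNReal.ofReal (Real.exp (-(2 * lam) * t)) := by
            rw [Measure.restrict_congr_set Ioi_ae_eq_Ici]
        _ = ENNReal.ofReal (∫ t in Ioi 0, Real.exp (-(2 * lam) * t)) :=
            (ofReal_integral_eq_lintegral_ofReal (integrableOn_exp_mul_Ioi hneg 0)
              (Filter.Eventually.of_forall fun t => (Real.exp_pos _).le)).symm
        _ ≤ _ := by
            apply ENNReal.ofReal_le_ofReal
            rw [integral_exp_mul_Ioi hneg, mul_zero, Real.exp_zero, neg_div_neg_eq]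
            exact one_div_le_one_div_of_le hlam (by linarith)
    calc _ ≤ ∫⁻ t in Icc 0 T, ENNReal.ofReal Q * ENNReal.ofReal (Real.exp (-(2 * lam) * t)) :=
          setLIntegral_mono' measurableSet_Icc hx
      _ ≤ ENNReal.ofReal Q * ENNReal.ofReal (1 / lam) := by
          rw [lintegral_const_mul _ (by fun_prop)]
          gcongr
      _ ≤ _ := by
          rw [← ENNReal.ofReal_mul hQ, ← ENNReal.ofReal_pow hR0, mul_one_div]
          exact ENNReal.ofReal_le_ofReal hR
  rw [weightedLpNorm, eLpNorm_eq_lintegral_rpow_enorm_toReal two_ne_zero ENNReal.ofNat_ne_top]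
  simp only [ENNReal.toReal_ofNat, ENNReal.rpow_ofNat]
  calc _ ≤ (ENNReal.ofReal R ^ 2) ^ (1 / 2 : ℝ) := by gcongr
    _ = _ := by
        rw [← ENNReal.rpow_natCast, ← ENNReal.rpow_mul]
        norm_num

/-- Hölder continuity of order 1/4 alone gives no decay in λ. With n the size of the increment, the
Hölder bound is used for n ≤ t and the size bound t^(1/4) for n > t; both yield t^(1/4-α) n^α with t
the later time. As the weight is taken there, it absorbs the power of t. -/
lemma weightedHolderNorm_le (hα : α ∈ Ioo (0 : ℝ) (1 / 4)) (hlam : 0 < lam) (hA : 0 ≤ A)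
    (hsup : ∀ x, ∀ t ∈ Icc 0 T, |S x t| ≤ A * t ^ (1 / 4 : ℝ))
    (hhol : ∀ x t x' t', 0 ≤ t' → t' ≤ t → t ≤ T →
      |S x' t' - S x t| ≤ A * (|x' - x| ^ (1 / 4 : ℝ) + |t' - t| ^ (1 / 4 : ℝ)))
    (hR : 2 * A * lam ^ (-(1 / 4 - α)) ≤ R) :
    weightedHolderNorm α lam T S ≤ ENNReal.ofReal R := by
  obtain ⟨hα0, hα1⟩ := hα
  refine iSup_le fun x => iSup_le fun t => iSup_le fun h₁ => iSup_le fun h₂ => iSup_le fun hh =>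
    ENNReal.ofReal_le_ofReal ?_
  obtain ⟨ht, ht', h2, hne⟩ := hh
  set n := √(h₁ ^ 2 + h₂ ^ 2) with hn
  have hpos : 0 < h₁ ^ 2 + h₂ ^ 2 := by
    rcases hne with h | h
    · have := sq_pos_of_ne_zero h
      positivity
    · have := sq_pos_of_ne_zero h
      positivity
  have hn0 : 0 < n := Real.sqrt_pos.2 hpos
  have hn1 : |h₁| ≤ n := Real.abs_le_sqrt (by nlinarith)
  have hn2 : |h₂| ≤ n := Real.abs_le_sqrt (by nlinarith)
  have hβ : 0 < 1 / 4 - α := by linarith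
  have hΔ : |S (x + h₁) (t + h₂) - S x t| ≤ 2 * A * (t ^ (1 / 4 - α) * n ^ α) := by
    rcases le_or_gt n t with hnt | hnt
    · have h3 := hhol x t (x + h₁) (t + h₂) ht'.1 (by linarith) ht.2
      rw [add_sub_cancel_left, add_sub_cancel_left] at h3
      calc _ ≤ A * (|h₁| ^ (1 / 4 : ℝ) + |h₂| ^ (1 / 4 : ℝ)) := h3
        _ ≤ A * (n ^ (1 / 4 : ℝ) + n ^ (1 / 4 : ℝ)) := by gcongr
        _ = 2 * A * (n ^ (1 / 4 - α) * n ^ α) := by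
            rw [← Real.rpow_add hn0]
            ring_nf
        _ ≤ _ := by gcongr
    · have h3 := hsup x t ht
      have h4 := hsup (x + h₁) (t + h₂) ht'
      have ht0 := ht.1
      have h5 : (t + h₂) ^ (1 / 4 : ℝ) ≤ t ^ (1 / 4 : ℝ) :=
        Real.rpow_le_rpow ht'.1 (by linarith) (by norm_num)
      calc _ ≤ |S (x + h₁) (t + h₂)| + |S x t| := abs_sub _ _
        _ ≤ A * t ^ (1 / 4 : ℝ) + A * t ^ (1 / 4 : ℝ) :=
            add_le_add (h4.trans (by gcongr)) h3
        _ = 2 * A * (t ^ (1 / 4 - α) * t ^ α) := by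
            rw [← Real.rpow_add_of_nonneg ht.1 hβ.le hα0.le]
            ring_nf
        _ ≤ _ := by gcongr
  have hexp := exp_neg_mul_rpow_le hlam ht.1 hβ (by linarith)
  rw [div_le_iff₀ (by positivity)]
  calc _ ≤ Real.exp (-lam * t) * (2 * A * (t ^ (1 / 4 - α) * n ^ α)) := by gcongr
    _ = 2 * A * (Real.exp (-lam * t) * t ^ (1 / 4 - α)) * n ^ α := by ring
    _ ≤ 2 * A * lam ^ (-(1 / 4 - α)) * n ^ α := by gcongr
    _ ≤ _ := by gcongr

end Norms

/-! ### The coefficient of the liquid crystal equation -/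

namespace LeslieCoeffs

variable (P : LeslieCoeffs)

/-- With X = cos 2θ, 4g is a nonnegative multiple of 1 - X² plus the quadratic βX² + 2γ₂X + γ₁.
Under Parodi's relation the last inequality on the coefficients says that its discriminant is
negative. Its minimum over all real X gives the lower bound. -/
lemma exists_pos_le_g : ∃ m : ℝ, 0 < m ∧ ∀ θ, m ≤ P.g θ := by
  obtain ⟨a1, a2, a3, a4, a5, a6, h1, h2, h3, h4, h5, h6⟩ := P
  set β := 2 * a4 + a5 + a6 with hβ
  set γ₂ := a2 + a3 with hγ₂
  have hd : γ₂ ^ 2 < (a3 - a2) * β := by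
    rw [← h1] at h6
    nlinarith
  refine ⟨((a3 - a2) - γ₂ ^ 2 / β) / 4, ?_, fun θ => ?_⟩
  · have : γ₂ ^ 2 / β < a3 - a2 := by rwa [div_lt_iff₀ h5]
    linarith
  have hs := Real.sin_sq_add_cos_sq θ
  set X := Real.cos θ ^ 2 - Real.sin θ ^ 2 with hX
  have e1 : Real.sin θ ^ 2 = (1 - X) / 2 := by rw [hX]; linarith
  have e2 : Real.cos θ ^ 2 = (1 + X) / 2 := by rw [hX]; linarith
  have hX2 : 0 ≤ 1 - X ^ 2 := by
    have := mul_nonneg (sq_nonneg (Real.sin θ)) (sq_nonneg (Real.cos θ))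
    rw [e1, e2] at this
    nlinarith
  have e3 : 4 * (g ⟨a1, a2, a3, a4, a5, a6, h1, h2, h3, h4, h5, h6⟩ θ)
      = (a1 + β) * (1 - X ^ 2) + (β * X ^ 2 + 2 * γ₂ * X + (a3 - a2)) := by
    simp only [g, e1, e2]
    rw [hβ, hγ₂]
    linear_combination (-X) * h1
  have e4 : (a3 - a2) - γ₂ ^ 2 / β ≤ β * X ^ 2 + 2 * γ₂ * X + (a3 - a2) := by
    have : β * X ^ 2 + 2 * γ₂ * X + γ₂ ^ 2 / β = (β * X + γ₂) ^ 2 / β := by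
      field_simp
      ring
    have : 0 ≤ (β * X + γ₂) ^ 2 / β := by positivity
    linarith
  have e5 : 0 ≤ (a1 + β) * (1 - X ^ 2) := mul_nonneg (by linarith) hX2
  linarith

lemma g_eq (θ : ℝ) : P.g θ = P.a1 * (Real.sin θ ^ 2 * (1 - Real.sin θ ^ 2))
    + (P.a5 - P.a2) / 2 * Real.sin θ ^ 2 + (P.a3 + P.a6) / 2 * (1 - Real.sin θ ^ 2)
    + P.a4 / 2 := by
  rw [g, Real.cos_sq']
  ring

lemma exists_g_le : ∃ M : ℝ, ∀ θ, P.g θ ≤ M := by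
  refine ⟨|P.a1| + |(P.a5 - P.a2) / 2| + |(P.a3 + P.a6) / 2| + P.a4 / 2, fun θ => ?_⟩
  rw [g_eq]
  have h0 : 0 ≤ Real.sin θ ^ 2 := sq_nonneg _
  have h1 : Real.sin θ ^ 2 ≤ 1 := Real.sin_sq_le_one θ
  set s := Real.sin θ ^ 2
  have k : ∀ c u : ℝ, 0 ≤ u → u ≤ 1 → c * u ≤ |c| := fun c u hu hu1 =>
    (mul_le_mul_of_nonneg_right (le_abs_self c) hu).trans
      (mul_le_of_le_one_right (abs_nonneg c) hu1)
  have k1 := k P.a1 (s * (1 - s)) (mul_nonneg h0 (by linarith)) (by nlinarith)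
  have k2 := k ((P.a5 - P.a2) / 2) s h0 h1
  have k3 := k ((P.a3 + P.a6) / 2) (1 - s) (by linarith) (by linarith)
  linarith

lemma exists_g_lipschitz : ∃ K : ℝ, 0 ≤ K ∧ ∀ θ θ', |P.g θ - P.g θ'| ≤ K * |θ - θ'| := by
  set c := |P.a1| + |(P.a5 - P.a2) / 2 - (P.a3 + P.a6) / 2| with hc
  refine ⟨2 * c, by positivity, fun θ θ' => ?_⟩
  have h0 : 0 ≤ Real.sin θ ^ 2 := sq_nonneg _
  have h1 : Real.sin θ ^ 2 ≤ 1 := Real.sin_sq_le_one θ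
  have h0' : 0 ≤ Real.sin θ' ^ 2 := sq_nonneg _
  have h1' : Real.sin θ' ^ 2 ≤ 1 := Real.sin_sq_le_one θ'
  have hss : |Real.sin θ ^ 2 - Real.sin θ' ^ 2| ≤ 2 * |θ - θ'| := by
    rw [sq_sub_sq, abs_mul]
    have k1 : |Real.sin θ + Real.sin θ'| ≤ 2 := (abs_add_le _ _).trans (by
      linarith [Real.abs_sin_le_one θ, Real.abs_sin_le_one θ'])
    have k2 := Real.abs_sin_sub_sin_le θ θ'
    gcongr
  rw [g_eq, g_eq]
  set s := Real.sin θ ^ 2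
  set s' := Real.sin θ' ^ 2
  have e : P.a1 * (s * (1 - s)) + (P.a5 - P.a2) / 2 * s + (P.a3 + P.a6) / 2 * (1 - s) + P.a4 / 2
      - (P.a1 * (s' * (1 - s')) + (P.a5 - P.a2) / 2 * s' + (P.a3 + P.a6) / 2 * (1 - s')
        + P.a4 / 2)
      = (P.a1 * (1 - s - s') + ((P.a5 - P.a2) / 2 - (P.a3 + P.a6) / 2)) * (s - s') := by ring
  have k3 : |P.a1 * (1 - s - s') + ((P.a5 - P.a2) / 2 - (P.a3 + P.a6) / 2)| ≤ c := by
    refine (abs_add_le _ _).trans ?_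
    rw [hc, abs_mul]
    have : |1 - s - s'| ≤ 1 := abs_le.2 ⟨by linarith, by linarith⟩
    gcongr
    exact mul_le_of_le_one_right (abs_nonneg _) this
  rw [e, abs_mul]
  calc _ ≤ c * (2 * |θ - θ'|) := by gcongr
    _ = _ := by ring

end LeslieCoeffs

/-- The extension of the angle to all times, constant outside `[0,T]`. -/
noncomputable def clampTime (T : ℝ) (th : ℝ → ℝ → ℝ) (x t : ℝ) : ℝ := th x (max 0 (min t T))

lemma clampTime_of_mem {T t : ℝ} (th : ℝ → ℝ → ℝ) (x : ℝ) (ht : t ∈ Icc 0 T) :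
    clampTime T th x t = th x t := by
  rw [clampTime, min_eq_left ht.2, max_eq_right ht.1]

/-- The diffusion coefficient as a function on space-time. -/
noncomputable def coeff (P : LeslieCoeffs) (th : ℝ → ℝ → ℝ) (p : ℝ × ℝ) : ℝ := P.g (th p.1 p.2)

lemma sqrt_max_le (u v : ℝ) : √(max u v) ≤ √u + √v := by
  rcases le_total u v with h | h
  · rw [max_eq_right h]; linarith [Real.sqrt_nonneg u]
  · rw [max_eq_left h]; linarith [Real.sqrt_nonneg v]

lemma continuous_of_sqrt_modulus {a : ℝ × ℝ → ℝ} {L : ℝ}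
    (h : ∀ p q : ℝ × ℝ, |a p - a q| ≤ L * (√|p.1 - q.1| + √|p.2 - q.2|)) : Continuous a := by
  rw [continuous_iff_continuousAt]
  intro q
  rw [ContinuousAt, tendsto_iff_dist_tendsto_zero]
  have hc : Filter.Tendsto (fun p : ℝ × ℝ => L * (√|p.1 - q.1| + √|p.2 - q.2|)) (𝓝 q) (𝓝 0) := by
    have : Continuous fun p : ℝ × ℝ => L * (√|p.1 - q.1| + √|p.2 - q.2|) := by fun_prop
    simpa using this.tendsto q
  exact squeeze_zero (fun _ => dist_nonneg) (fun p => h p q) hc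

/-- Clamping the time is 1-Lipschitz, so the extended coefficient keeps the Hölder modulus on all of
space-time. The constants depend on the Leslie coefficients and L only, which makes the final
threshold uniform in θ. -/
lemma LeslieCoeffs.exists_isCoeff (P : LeslieCoeffs) {T : ℝ} (hT : 0 ≤ T) (L : ℝ≥0) :
    ∃ m M L' : ℝ, 0 < m ∧ m ≤ M ∧ 0 ≤ L' ∧ ∀ th : ℝ → ℝ → ℝ,
      HolderOnWith L (1 / 2) (fun q : ℝ × ℝ => th q.1 q.2) (univ ×ˢ Icc 0 T) →
      IsCoeff m M L' (coeff P (clampTime T th)) := by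
  obtain ⟨m, hm, hmg⟩ := P.exists_pos_le_g
  obtain ⟨M, hM⟩ := P.exists_g_le
  obtain ⟨K, hK, hKg⟩ := P.exists_g_lipschitz
  refine ⟨m, M, K * L, hm, (hmg 0).trans (hM 0), by positivity, fun th hth => ?_⟩
  have hol : ∀ p q : ℝ × ℝ, |coeff P (clampTime T th) p - coeff P (clampTime T th) q|
      ≤ K * L * (√|p.1 - q.1| + √|p.2 - q.2|) := by
    intro p q
    have hmem : ∀ r : ℝ × ℝ, (r.1, max 0 (min r.2 T)) ∈ (univ : Set ℝ) ×ˢ Icc 0 T := fun r =>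
      ⟨mem_univ _, le_max_left _ _, max_le hT (min_le_right _ _)⟩
    have h1 := hth.dist_le (hmem p) (hmem q)
    have h2 : |max 0 (min p.2 T) - max 0 (min q.2 T)| ≤ |p.2 - q.2| :=
      calc _ ≤ max |0 - 0| |min p.2 T - min q.2 T| := abs_max_sub_max_le_max _ _ _ _
        _ = |min p.2 T - min q.2 T| := by simp
        _ ≤ max |p.2 - q.2| |T - T| := abs_min_sub_min_le_max _ _ _ _
        _ = _ := by simp
    have h3 : |clampTime T th p.1 p.2 - clampTime T th q.1 q.2|
        ≤ L * (√|p.1 - q.1| + √|p.2 - q.2|) := by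
      rw [← Real.dist_eq]
      refine h1.trans (mul_le_mul_of_nonneg_left ?_ L.coe_nonneg)
      rw [Prod.dist_eq, Real.dist_eq, Real.dist_eq]
      have e : ((1 / 2 : ℝ≥0) : ℝ) = 1 / 2 := by push_cast; rfl
      rw [e, ← Real.sqrt_eq_rpow]
      refine (sqrt_max_le _ _).trans ?_
      gcongr
    calc _ ≤ K * |clampTime T th p.1 p.2 - clampTime T th q.1 q.2| := hKg _ _
      _ ≤ K * (L * (√|p.1 - q.1| + √|p.2 - q.2|)) := by gcongr
      _ = _ := by ring
  exact ⟨continuous_of_sqrt_modulus hol, hm, fun p => hmg _, fun p => hM _, by positivity, hol⟩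

/-! ### The fundamental solution in space-time notation -/

section Link

variable {P : LeslieCoeffs} {T : ℝ} {th th' : ℝ → ℝ → ℝ}

lemma parametrixError_congr (hth : ∀ x, ∀ t ∈ Icc 0 T, th x t = th' x t) {t τ : ℝ}
    (ht : t ∈ Icc 0 T) (hτ : τ ∈ Icc 0 T) (x ξ : ℝ) :
    parametrixError P th x t ξ τ = parametrixError P th' x t ξ τ := by
  simp only [parametrixError, frozenKernel, hth x t ht, hth ξ τ hτ]

lemma iteratedError_congr (hth : ∀ x, ∀ t ∈ Icc 0 T, th x t = th' x t) (n : ℕ) {t τ : ℝ}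
    (ht : t ∈ Icc 0 T) (hτ : τ ∈ Icc 0 T) (x ξ : ℝ) :
    iteratedError P th n x t ξ τ = iteratedError P th' n x t ξ τ := by
  induction n generalizing x t with
  | zero => exact parametrixError_congr hth ht hτ x ξ
  | succ n ih =>
    refine intervalIntegral.integral_congr fun s hs => integral_congr_ae
      (Filter.Eventually.of_forall fun y => ?_)
    have hs' : s ∈ Icc 0 T := uIcc_subset_Icc hτ ht hs
    dsimp only
    rw [parametrixError_congr hth ht hs', ih hs']

/-- The parametrix construction between two times in [0,T] uses the angle at intermediate times
only, so the clamped extension does not alter Γₓ. -/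
lemma fundSolX_congr (hth : ∀ x, ∀ t ∈ Icc 0 T, th x t = th' x t) {t τ : ℝ}
    (ht : t ∈ Icc 0 T) (hτ : τ ∈ Icc 0 T) (x ξ : ℝ) :
    fundSolX P th x t ξ τ = fundSolX P th' x t ξ τ := by
  have h : ∀ x', fundSol P th x' t ξ τ = fundSol P th' x' t ξ τ := by
    intro x'
    unfold fundSol
    congr 1
    · simp only [frozenKernel, hth ξ τ hτ]
    · refine intervalIntegral.integral_congr fun s hs => integral_congr_ae
        (Filter.Eventually.of_forall fun y => ?_)
      have hs' : s ∈ Icc 0 T := uIcc_subset_Icc hτ ht hs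
      simp only [frozenKernel, levyDensity, hth y s hs',
        fun n => iteratedError_congr (P := P) hth n hs' hτ y ξ]
  unfold fundSolX
  congr 1
  exact funext h

variable {m M L : ℝ}

lemma frozenKernel_eq (x t ξ τ : ℝ) :
    frozenKernel P th x t ξ τ = fk (coeff P th) 0 (x, t) (ξ, τ) := by
  rw [frozenKernel, heatKernel_eq]
  rfl

lemma parametrixError_eq (x t ξ τ : ℝ) :
    parametrixError P th x t ξ τ = ek (coeff P th) P.gamma1 (x, t) (ξ, τ) := by
  have e1 : (fun x' => frozenKernel P th x' t ξ τ)
      = fun x' => fk (coeff P th) 0 (x', t) (ξ, τ) := funext fun x' => frozenKernel_eq _ _ _ _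
  have e2 : deriv (fun x' => fk (coeff P th) 0 (x', t) (ξ, τ))
      = fun x' => fk (coeff P th) 1 (x', t) (ξ, τ) :=
    funext fun x' => (hasDerivAt_fk _ 0 x' t _).deriv
  rw [parametrixError, e1, iteratedDeriv_succ, iteratedDeriv_one, e2,
    (hasDerivAt_fk _ 1 x t _).deriv, frozenKernel_eq]
  rfl

lemma iterK_of_le (h : IsCoeff m M L (coeff P th)) {γ : ℝ} (hγ : 0 ≤ γ) (n : ℕ) {p q : ℝ × ℝ}
    (hpq : p.2 ≤ q.2) : iterK (coeff P th) γ n p q = 0 := by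
  obtain ⟨C, ν, hC, hν, hb⟩ := exists_iterK_bound h.m_pos h.m_le_M h.L_nonneg hγ
  have := (hb _ h n p q).1
  rw [kw_of_nonpos (by linarith)] at this
  simpa using this

lemma integrable_ek_mul_iterK (h : IsCoeff m M L (coeff P th)) {γ : ℝ} (hγ : 0 ≤ γ) (n : ℕ)
    (p q : ℝ × ℝ) : Integrable fun r => ek (coeff P th) γ p r * iterK (coeff P th) γ n r q := by
  obtain ⟨C, ν, hC, hν, hb⟩ := exists_iterK_bound h.m_pos h.m_le_M h.L_nonneg hγ
  refine integrable_of_lintegral_enorm_mul (Measurable.mul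
    (h.measurable_ek_comp γ measurable_const measurable_id)
    ((measurable_iterK h γ n).comp (by fun_prop : Measurable fun r : ℝ × ℝ => (r, q)))
    ).aestronglyMeasurable ((hb _ h n p q).2.trans_lt ?_)
  exact ENNReal.mul_lt_top ENNReal.ofReal_lt_top
    (ENNReal.mul_lt_top (kw_lt_top _ _) (hk_lt_top _ _ _))

/-- The integrand vanishes unless τ < s < t, and it is absolutely integrable, so Fubini identifies
the iterated integral with the one over space-time. -/
lemma iteratedError_eq (h : IsCoeff m M L (coeff P th)) (n : ℕ) (x t ξ τ : ℝ) :
    iteratedError P th n x t ξ τ = iterK (coeff P th) P.gamma1 n (x, t) (ξ, τ) := by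
  have hγ : 0 ≤ P.gamma1 := P.pos_damping.le
  induction n generalizing x t with
  | zero => exact parametrixError_eq x t ξ τ
  | succ n ih =>
    simp only [iteratedError, iterK, ih, parametrixError_eq]
    refine integral_spacetime_interval (f := fun r => ek (coeff P th) P.gamma1 (x, t) r *
      iterK (coeff P th) P.gamma1 n r (ξ, τ)) (integrable_ek_mul_iterK h hγ n _ _) fun r hr => ?_
    rcases not_and_or.1 hr with h1 | h1
    · rw [iterK_of_le h hγ n (not_lt.1 h1), mul_zero]
    · rw [ek_of_le h _ (not_lt.1 h1), zero_mul]

lemma fundSol_eq (h : IsCoeff m M L (coeff P th)) (x t ξ τ : ℝ) :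
    fundSol P th x t ξ τ = solK (coeff P th) P.gamma1 (x, t) (ξ, τ) := by
  have hγ : 0 ≤ P.gamma1 := P.pos_damping.le
  have hd : ∀ y s, levyDensity P th y s ξ τ = densK (coeff P th) P.gamma1 (y, s) (ξ, τ) :=
    fun y s => by simp only [levyDensity, densK, iteratedError_eq h]
  simp only [fundSol, solK, frozenKernel_eq, hd]
  congr 1
  refine integral_spacetime_interval (f := fun r => fk (coeff P th) 0 (x, t) r *
    densK (coeff P th) P.gamma1 r (ξ, τ)) ((hasDerivAt_solK h hγ t (ξ, τ) x).2 x) fun r hr => ?_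
  rcases not_and_or.1 hr with h1 | h1
  · rw [densK_of_le hγ h (not_lt.1 h1), mul_zero]
  · rw [fk_of_le h _ (not_lt.1 h1), zero_mul]

lemma fundSolX_eq (h : IsCoeff m M L (coeff P th)) (x t ξ τ : ℝ) :
    fundSolX P th x t ξ τ = solX (coeff P th) P.gamma1 (x, t) (ξ, τ) := by
  have hγ : 0 ≤ P.gamma1 := P.pos_damping.le
  rw [fundSolX, ← (hasDerivAt_solK h hγ t (ξ, τ) x).1.deriv]
  congr 1
  exact funext fun x' => fundSol_eq h x' t ξ τ

end Link

/-! ### Duhamel integrals of measurable classes -/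

section Version

variable {P : LeslieCoeffs} {T m M L : ℝ} {th F : ℝ → ℝ → ℝ}

/-- `F'` is measurable, vanishes outside the open strip and represents `F` there. -/
structure IsVersion (T : ℝ) (F : ℝ → ℝ → ℝ) (F' : ℝ × ℝ → ℝ) : Prop where
  meas : Measurable F'
  zero : ∀ r : ℝ × ℝ, r.2 ≤ 0 → F' r = 0
  zero' : ∀ r : ℝ × ℝ, T ≤ r.2 → F' r = 0
  ae_eq : ∀ᵐ r : ℝ × ℝ, r.2 ∈ Ioo 0 T → F' r = F r.1 r.2

lemma exists_isVersion
    (hF : AEStronglyMeasurable (fun q : ℝ × ℝ => F q.1 q.2) (stripMeasure T)) :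
    ∃ F', IsVersion T F F' := by
  have hm : MeasurableSet {q : ℝ × ℝ | q.2 ∈ Ioo 0 T} := measurable_snd measurableSet_Ioo
  refine ⟨{q : ℝ × ℝ | q.2 ∈ Ioo 0 T}.indicator (hF.mk _),
    hF.stronglyMeasurable_mk.measurable.indicator hm, fun r hr => ?_, fun r hr => ?_, ?_⟩
  · exact indicator_of_notMem (fun h => absurd h.1 (not_lt.2 hr)) _
  · exact indicator_of_notMem (fun h => absurd h.2 (not_lt.2 hr)) _
  · have h : ∀ᵐ q ∂(volume.restrict ((univ : Set ℝ) ×ˢ Icc 0 T)), F q.1 q.2 = hF.mk _ q :=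
      hF.ae_eq_mk
    rw [ae_restrict_iff' (MeasurableSet.univ.prod measurableSet_Icc)] at h
    filter_upwards [h] with r hr hr2
    rw [indicator_of_mem (show r ∈ {q : ℝ × ℝ | q.2 ∈ Ioo 0 T} from hr2),
      hr ⟨mem_univ _, Ioo_subset_Icc_self hr2⟩]

lemma solX_of_le {a : ℝ × ℝ → ℝ} (h : IsCoeff m M L a) {γ : ℝ} (hγ : 0 ≤ γ) {p q : ℝ × ℝ}
    (hpq : p.2 ≤ q.2) : solX a γ p q = 0 := by
  obtain ⟨C, hC, hb⟩ := exists_solX_bound h.m_pos h.m_le_M h.L_nonneg hγ one_pos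
  have := (hb a h p q (by linarith)).1
  rw [tw_of_nonpos (by linarith)] at this
  simpa using this

lemma fundSolX_eq_solX (h : IsCoeff m M L (coeff P (clampTime T th))) {t τ : ℝ}
    (ht : t ∈ Icc 0 T) (hτ : τ ∈ Icc 0 T) (x ξ : ℝ) :
    fundSolX P th x t ξ τ = solX (coeff P (clampTime T th)) P.gamma1 (x, t) (ξ, τ) := by
  rw [← fundSolX_eq h]
  exact fundSolX_congr (fun x t ht => (clampTime_of_mem th x ht).symm) ht hτ x ξ

namespace IsVersion

variable {F' : ℝ × ℝ → ℝ}

lemma integrableOn (hF : IsVersion T F F') (h : IsCoeff m M L (coeff P (clampTime T th)))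
    {x t : ℝ} (ht : t ∈ Icc 0 T)
    (hi : Integrable fun q => solX (coeff P (clampTime T th)) P.gamma1 (x, t) q * F' q) :
    IntegrableOn (fun q : ℝ × ℝ => fundSolX P th x t q.1 q.2 * F q.1 q.2)
      (univ ×ˢ Ioo 0 t) := by
  refine hi.integrableOn.congr ((ae_restrict_iff' (MeasurableSet.univ.prod
    measurableSet_Ioo)).2 ?_)
  filter_upwards [hF.ae_eq] with q hq hqt
  have hq2 : q.2 ∈ Ioo 0 T := ⟨hqt.2.1, hqt.2.2.trans_le ht.2⟩
  rw [hq hq2, fundSolX_eq_solX h ht (Ioo_subset_Icc_self hq2)]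

lemma duhamelX_eq (hF : IsVersion T F F') (h : IsCoeff m M L (coeff P (clampTime T th)))
    {x t : ℝ} (ht : t ∈ Icc 0 T)
    (hi : Integrable fun q => solX (coeff P (clampTime T th)) P.gamma1 (x, t) q * F' q) :
    duhamelX P th F x t = duh (coeff P (clampTime T th)) P.gamma1 F' (x, t) := by
  rw [duh, duhamelX, Measure.volume_eq_prod, integral_prod_symm _ hi,
    intervalIntegral.integral_of_le ht.1, ← integral_indicator measurableSet_Ioc]
  refine integral_congr_ae ?_
  -- The representative is zero at the end time T, while F need not be; this matters only for t = T
  -- and on a null set of times.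
  have hT : ∀ᵐ τ : ℝ, τ ≠ T := by simp [ae_iff]
  filter_upwards [ae_ae_slice hF.ae_eq, hT] with τ hτ hτT
  by_cases hτt : τ ∈ Ioc 0 t
  · have hτ2 : τ ∈ Ioo 0 T := ⟨hτt.1, lt_of_le_of_ne (hτt.2.trans ht.2) hτT⟩
    rw [indicator_of_mem hτt]
    refine integral_congr_ae ?_
    filter_upwards [hτ] with ξ hξ
    rw [hξ hτ2, fundSolX_eq_solX h ht (Ioo_subset_Icc_self hτ2)]
  · rw [indicator_of_notMem hτt]
    refine (integral_eq_zero_of_ae (Filter.Eventually.of_forall fun ξ => ?_)).symm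
    rcases not_and_or.1 hτt with h1 | h1
    · simp [hF.zero (ξ, τ) (not_lt.1 h1)]
    · exact mul_eq_zero_of_left (solX_of_le h P.pos_damping.le
        (show (x, t).2 ≤ (ξ, τ).2 from (not_le.1 h1).le)) _

end IsVersion

/-- The `N_T` norm of a Duhamel integral from the control of its source and its space norms. -/
lemma normNT_duhamelX_le {α lam C Q R : ℝ} (hα : α ∈ Ioo (0 : ℝ) (1 / 4)) (hlam : 0 < lam)
    (hC : 0 ≤ C) (hR0 : 0 ≤ R) (hQ : 0 ≤ Q) {B : ℝ≥0} {F' : ℝ × ℝ → ℝ}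
    (h : IsCoeff m M L (coeff P (clampTime T th))) (hF : IsVersion T F F')
    (hs : IsSource (64 * M) T B F')
    (hsup : ∀ p : ℝ × ℝ, 0 ≤ p.2 → p.2 ≤ T →
      |duh (coeff P (clampTime T th)) P.gamma1 F' p| ≤ C * B * p.2 ^ (1 / 4 : ℝ))
    (hhol : ∀ p r : ℝ × ℝ, 0 ≤ r.2 → r.2 ≤ p.2 → p.2 ≤ T →
      |duh (coeff P (clampTime T th)) P.gamma1 F' r
        - duh (coeff P (clampTime T th)) P.gamma1 F' p|
          ≤ C * B * (|r.1 - p.1| ^ (1 / 4 : ℝ) + |r.2 - p.2| ^ (1 / 4 : ℝ)))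
    (hsq : ∀ t, 0 ≤ t → t ≤ T →
      ∫⁻ x, ‖duh (coeff P (clampTime T th)) P.gamma1 F' (x, t)‖ₑ ^ 2 ≤ ENNReal.ofReal Q)
    (h1 : C * B * lam ^ (-(1 / 4) : ℝ) ≤ R) (h2 : 2 * (C * B) * lam ^ (-(1 / 4 - α)) ≤ R)
    (h3 : Q / lam ≤ R ^ 2) :
    normNT α lam T (duhamelX P th F) ≤ ENNReal.ofReal R := by
  have hγ := P.pos_damping.le
  have hCB : 0 ≤ C * B := by positivity
  rw [normNT_congr (S' := fun x t => duh (coeff P (clampTime T th)) P.gamma1 F' (x, t))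
    fun x t ht => hF.duhamelX_eq h ht (hs.integral_solX_mul h hγ (p := (x, t)) ht.1 ht.2).1]
  refine max_le ?_ (max_le ?_ ?_)
  · exact weightedLpNorm_top_le hlam hCB (fun x t ht => hsup (x, t) ht.1 ht.2) h1
  · exact weightedLpNorm_two_le hlam hR0 (h.measurable_duh hγ hF.meas)
      (fun t ht => hsq t ht.1 ht.2) hQ h3
  · exact weightedHolderNorm_le hα hlam hCB (fun x t ht => hsup (x, t) ht.1 ht.2)
      (fun x t x' t' h0 htt ht => hhol (x, t) (x', t') h0 htt ht) h2

lemma exists_weight_threshold {A N β : ℝ} (hβ : 0 < β) :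
    ∃ lam₀ : ℝ, 0 < lam₀ ∧ ∀ lam, lam₀ ≤ lam →
      A * lam ^ (-(1 / 4) : ℝ) ≤ 1 ∧ 2 * A * lam ^ (-β) ≤ 1 ∧ N / lam ≤ 1 := by
  have e1 : ∀ᶠ lam : ℝ in Filter.atTop, A * lam ^ (-(1 / 4) : ℝ) ≤ 1 := by
    have := (tendsto_rpow_neg_atTop (by norm_num : (0 : ℝ) < 1 / 4)).const_mul A
    rw [mul_zero] at this
    exact this.eventually_le_const one_pos
  have e2 : ∀ᶠ lam : ℝ in Filter.atTop, 2 * A * lam ^ (-β) ≤ 1 := by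
    have := (tendsto_rpow_neg_atTop hβ).const_mul (2 * A)
    rw [mul_zero] at this
    exact this.eventually_le_const one_pos
  have e3 : ∀ᶠ lam : ℝ in Filter.atTop, N / lam ≤ 1 :=
    (Filter.tendsto_id.const_div_atTop N).eventually_le_const one_pos
  obtain ⟨l, hl⟩ := Filter.eventually_atTop.1 ((e1.and e2).and e3)
  exact ⟨max l 1, by positivity, fun lam h =>
    have := hl lam ((le_max_left _ _).trans h)
    ⟨this.1.1, this.1.2, this.2⟩⟩

lemma IsVersion.ae_enorm_le {F' : ℝ × ℝ → ℝ} (hF : IsVersion T F F') {C₀ : ℝ}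
    (hb : eLpNorm (fun q : ℝ × ℝ => F q.1 q.2) ⊤ (stripMeasure T) ≤ ENNReal.ofReal C₀) :
    ∀ᵐ r, ‖F' r‖ₑ ≤ C₀.toNNReal := by
  rw [eLpNorm_exponent_top] at hb
  have h := enorm_ae_le_eLpNormEssSup (fun q : ℝ × ℝ => F q.1 q.2) (stripMeasure T)
  rw [stripMeasure, ae_restrict_iff' (MeasurableSet.univ.prod measurableSet_Icc)] at h
  filter_upwards [h, hF.ae_eq] with r hr hr2
  by_cases hrT : r.2 ∈ Ioo 0 T
  · rw [hr2 hrT]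
    exact (hr ⟨mem_univ _, Ioo_subset_Icc_self hrT⟩).trans hb
  · rcases not_and_or.1 hrT with h1 | h1
    · simp [hF.zero r (not_lt.1 h1)]
    · simp [hF.zero' r (not_lt.1 h1)]

lemma IsVersion.ae_lintegral_sq_le {F' : ℝ × ℝ → ℝ} (hF : IsVersion T F F') {C₀ : ℝ}
    (hb : ∀ᵐ τ ∂(volume.restrict (Ioo 0 T)),
      eLpNorm (fun ξ => F ξ τ) 2 volume ≤ ENNReal.ofReal C₀) :
    ∀ᵐ s : ℝ, ∫⁻ y, ‖F' (y, s)‖ₑ ^ 2 ≤ C₀.toNNReal ^ 2 := by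
  rw [ae_restrict_iff' measurableSet_Ioo] at hb
  filter_upwards [hb, ae_ae_slice hF.ae_eq] with s hs hs2
  by_cases hsT : s ∈ Ioo 0 T
  · have h1 := hs hsT
    have e : ∫⁻ y, ‖F' (y, s)‖ₑ ^ 2 = eLpNorm (fun ξ => F ξ s) 2 volume ^ 2 := by
      rw [eLpNorm_eq_lintegral_rpow_enorm_toReal two_ne_zero ENNReal.ofNat_ne_top,
        ← ENNReal.rpow_natCast _ 2, ← ENNReal.rpow_mul]
      norm_num
      refine lintegral_congr_ae ?_
      filter_upwards [hs2] with y hy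
      rw [hy hsT]
    rw [e]
    exact pow_le_pow_left' h1 2
  · rcases not_and_or.1 hsT with h1 | h1
    · simp [fun y => hF.zero (y, s) (not_lt.1 h1)]
    · simp [fun y => hF.zero' (y, s) (not_lt.1 h1)]

lemma IsVersion.ae_exists_deriv {F' : ℝ × ℝ → ℝ} (hF : IsVersion T F F') {D : ℝ}
    (hb : SpaceDerivL1Bound T D F) :
    ∀ᵐ τ, 0 < τ → τ < T → ∃ (q : ℝ → ℝ) (b : ℝ), Integrable q ∧ ∫⁻ z, ‖q z‖ₑ ≤ D.toNNReal ∧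
        ∀ᵐ ξ, F' (ξ, τ) = b + ∫ z in Iic ξ, q z := by
  rw [SpaceDerivL1Bound, ae_restrict_iff' measurableSet_Ioo] at hb
  filter_upwards [hb, ae_ae_slice hF.ae_eq] with τ h1 h2 h3 h4
  obtain ⟨q, b, hq, hqD, hqF⟩ := h1 ⟨h3, h4⟩
  refine ⟨q, b, hq, ?_, ?_⟩
  · rw [← ofReal_integral_norm_eq_lintegral_enorm hq]
    exact ENNReal.ofReal_le_ofReal (by simpa using hqD)
  · filter_upwards [hqF, h2] with ξ h5 h6
    rw [h6 ⟨h3, h4⟩, h5]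

end Version

/-! ### Choice of the weight and conclusion. -/

theorem proposition6p5 (P : LeslieCoeffs) (T : ℝ) (hT : 1 < T)
    (α : ℝ) (hα : α ∈ Set.Ioo (0 : ℝ) (1 / 4)) (L : NNReal) (κ : ℝ) (hκ : 0 ≤ κ) :
    ∃ lam₀ : ℝ, 0 < lam₀ ∧ ∀ lam : ℝ, lam₀ ≤ lam →
      ∀ th : ℝ → ℝ → ℝ,
        HolderOnWith L (1 / 2) (fun q : ℝ × ℝ => th q.1 q.2) (Set.univ ×ˢ Set.Icc 0 T) →
      ∀ (C₀ : ℝ) (_ : 0 ≤ C₀) (G f : ℝ → ℝ → ℝ),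
        AEStronglyMeasurable (fun q : ℝ × ℝ => G q.1 q.2) (stripMeasure T) →
        AEStronglyMeasurable (fun q : ℝ × ℝ => f q.1 q.2) (stripMeasure T) →
        eLpNorm (fun q : ℝ × ℝ => G q.1 q.2) ⊤ (stripMeasure T) ≤ ENNReal.ofReal C₀ →
        (∀ᵐ τ ∂(volume.restrict (Set.Ioo 0 T)),
          eLpNorm (fun ξ => f ξ τ) 2 volume ≤ ENNReal.ofReal C₀) →
        SpaceDerivL1Bound T (κ * C₀) G →
        (∀ x : ℝ, ∀ t ∈ Set.Icc 0 T,
          IntegrableOn (fun q : ℝ × ℝ => fundSolX P th x t q.1 q.2 * G q.1 q.2)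
            (Set.univ ×ˢ Set.Ioo 0 t) ∧
          IntegrableOn (fun q : ℝ × ℝ => fundSolX P th x t q.1 q.2 * f q.1 q.2)
            (Set.univ ×ˢ Set.Ioo 0 t)) ∧
        max (normNT α lam T (duhamelX P th G)) (normNT α lam T (duhamelX P th f))
          ≤ ENNReal.ofReal (max C₀ (C₀ ^ 2) * T ^ 2) := by
  have hT0 : 0 < T := by linarith
  obtain ⟨m, M, L', hm, hmM, hL', hcoeff⟩ := P.exists_isCoeff hT0.le L
  have hγ : 0 < P.gamma1 := P.pos_damping
  have hM : 0 < M := hm.trans_le hmM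
  have hc : 0 < 64 * M := by positivity
  obtain ⟨C, hC, hest⟩ := exists_duh_estimates (T := T) hm hmM hL' hγ.le
  obtain ⟨K₁, hK₁⟩ := exists_lintegral_sq_duh_le_of_bdd hm hmM hL' hγ hT0
  obtain ⟨K₂, hK₂⟩ := exists_lintegral_sq_duh_le_of_sq hm hmM hL' hγ.le hT0
  set b₁ : ℝ≥0 := (T ^ (1 / 4 : ℝ)).toNNReal with hb₁
  set b₂ : ℝ≥0 := ((64 * M) ^ (-(1 / 4) : ℝ)).toNNReal with hb₂
  -- The threshold is fixed before θ, C₀, G and f. This is possible since the source constants are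
  -- C₀b₁ and C₀b₂ and the squared L² bounds are C₀² times K₁b₁κ and K₂, so C₀ factors out of all
  -- three requirements.
  obtain ⟨lam₀, hlam₀, hthr⟩ := exists_weight_threshold (A := C * (b₁ + b₂))
    (N := K₁ * b₁ * κ + K₂) (β := 1 / 4 - α) (by linarith [hα.2])
  refine ⟨lam₀, hlam₀, fun lam hlam th hth C₀ hC₀ G f hG hf hGb hfb hGx => ?_⟩
  have h := hcoeff th hth
  have hl : 0 < lam := hlam₀.trans_le hlam
  obtain ⟨t1, t2, t3⟩ := hthr lam hlam
  obtain ⟨G', hG'⟩ := exists_isVersion hG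
  obtain ⟨f', hf'⟩ := exists_isVersion hf
  have sG : IsSource (64 * M) T (C₀.toNNReal * b₁) G' :=
    isSource_of_bdd hc hG'.meas hG'.zero (hG'.ae_enorm_le hGb)
  have sf : IsSource (64 * M) T (C₀.toNNReal * b₂) f' :=
    isSource_of_sq hc hf'.meas hf'.zero (hf'.ae_lintegral_sq_le hfb)
  have hC₀' : ((C₀.toNNReal : ℝ≥0) : ℝ) = C₀ := Real.coe_toNNReal _ hC₀
  refine ⟨fun x t ht => ⟨hG'.integrableOn h ht
    (sG.integral_solX_mul h hγ.le (p := (x, t)) ht.1 ht.2).1,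
    hf'.integrableOn h ht (sf.integral_solX_mul h hγ.le (p := (x, t)) ht.1 ht.2).1⟩, ?_⟩
  -- Both norms are in fact bounded by C₀; T > 1 is used only here, to pass to the stated bound.
  have hfinal : C₀ ≤ max C₀ (C₀ ^ 2) * T ^ 2 := by
    have h1 : C₀ ≤ max C₀ (C₀ ^ 2) := le_max_left _ _
    have h2 : 1 ≤ T ^ 2 := by nlinarith
    exact h1.trans (le_mul_of_one_le_right (hC₀.trans h1) h2)
  have scale : ∀ b : ℝ≥0, b ≤ b₁ + b₂ →
      C * (C₀.toNNReal * b : ℝ≥0) * lam ^ (-(1 / 4) : ℝ) ≤ C₀ ∧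
      2 * (C * (C₀.toNNReal * b : ℝ≥0)) * lam ^ (-(1 / 4 - α)) ≤ C₀ := by
    intro b hb
    have hb' : (b : ℝ) ≤ b₁ + b₂ := by exact_mod_cast hb
    have hp1 : 0 ≤ lam ^ (-(1 / 4) : ℝ) := by positivity
    have hp2 : 0 ≤ lam ^ (-(1 / 4 - α)) := by positivity
    rw [NNReal.coe_mul, hC₀']
    constructor
    · calc C * (C₀ * b) * lam ^ (-(1 / 4) : ℝ)
          = C₀ * (C * b * lam ^ (-(1 / 4) : ℝ)) := by ring
        _ ≤ C₀ * (C * (b₁ + b₂) * lam ^ (-(1 / 4) : ℝ)) := by gcongr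
        _ ≤ C₀ * 1 := by gcongr
        _ = C₀ := mul_one _
    · calc 2 * (C * (C₀ * b)) * lam ^ (-(1 / 4 - α))
          = C₀ * (2 * (C * b) * lam ^ (-(1 / 4 - α))) := by ring
        _ ≤ C₀ * (2 * (C * (b₁ + b₂)) * lam ^ (-(1 / 4 - α))) := by gcongr
        _ ≤ C₀ * 1 := by gcongr
        _ = C₀ := mul_one _
  set N : ℝ := K₁ * b₁ * κ + K₂ with hN
  have hN0 : 0 ≤ N := by positivity
  have hQ : C₀ ^ 2 * N / lam ≤ C₀ ^ 2 := by
    rw [mul_div_assoc]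
    exact mul_le_of_le_one_right (sq_nonneg _) t3
  refine (max_le ?_ ?_ : _ ≤ ENNReal.ofReal C₀).trans (ENNReal.ofReal_le_ofReal hfinal)
  · obtain ⟨e1, e2⟩ := hest _ h _ _ sG
    obtain ⟨s1, s2⟩ := scale b₁ le_self_add
    refine normNT_duhamelX_le hα hl hC.le hC₀ (Q := C₀ ^ 2 * N) (by positivity) h hG' sG e1 e2
      (fun t h0 ht => (hK₁ _ h _ _ _ sG (hG'.ae_exists_deriv hGx) t h0 ht).trans ?_) s1 s2 hQ
    rw [← ENNReal.coe_mul, ← ENNReal.coe_mul, ← ENNReal.ofReal_coe_nnreal]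
    apply ENNReal.ofReal_le_ofReal
    push_cast
    rw [hC₀', Real.coe_toNNReal (κ * C₀) (by positivity), hN]
    nlinarith [mul_nonneg (sq_nonneg C₀) K₂.coe_nonneg]
  · obtain ⟨e1, e2⟩ := hest _ h _ _ sf
    obtain ⟨s1, s2⟩ := scale b₂ le_add_self
    refine normNT_duhamelX_le hα hl hC.le hC₀ (Q := C₀ ^ 2 * N) (by positivity) h hf' sf e1 e2
      (fun t h0 ht => (hK₂ _ h _ _ hf'.meas hf'.zero (hf'.ae_lintegral_sq_le hfb) t h0 ht).trans
        ?_) s1 s2 hQ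
    rw [← ENNReal.coe_pow, ← ENNReal.coe_mul, ← ENNReal.ofReal_coe_nnreal]
    apply ENNReal.ofReal_le_ofReal
    push_cast
    rw [hC₀', hN]
    have : 0 ≤ C₀ ^ 2 * (K₁ * b₁ * κ) := by positivity
    nlinarith
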